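/- **Model.** A (simple, bi-infinite) point process on $\mathbb{R}$ is a random locally finite set of points, unbounded in both directions; the space of such configurations carries the vague topology and its Borel $\sigma$-algebra. The points of $\Xi$ are enumerated in increasing order, $\cdots<\Xi_0\le 0<\Xi_1<\cdots$. Given a stationary unit-intensity point process $\Xi^{(0)}$, define $\Xi^{(t)}$, $t\ge 0$, recursively: every point of $\Xi^{(t)}$ moves halfway towards its left or its right neighbour, each with probability $\tfrac12$, independently of the other points, of $\Xi^{(0)}$ and of the earlier moves; points that land at the same location are merged into one; the resulting process (which has intensity $\tfrac34$) is multiplied by $\tfrac34$, and this gives $\Xi^{(t+1)}$. For a stationary point process $\Xi$ of intensity $\lambda\in(0,\infty)$, its Palm shift $\Theta\Xi$ is a point process (with a point at the origin) with law $$\mathbb{P}(\Theta\Xi\in A)=\frac1\lambda\,\mathbb{E}\,\#\{x\in\Xi\cap(0,1] : \Xi-x\in A\}.$$ A stationary point process is a renewal process if the gaps between consecutive points of its Palm shift are independent and identically distributed. **Theorem.** There is a stationary unit-intensity point process $\Xi^{(\infty)}$ such that, for every stationary unit-intensity renewal process $\Xi^{(0)}$ whose inter-renewal distribution has finite variance,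 every $\Xi^{(t)}$ is stationary with unit intensity and the following holds as $t\to\infty$. 1. $\Xi^{(t)}\to\Xi^{(\infty)}$ in the sense of finite-dimensional distributions, both for the counts and for the points: $\big(\#(\Xi^{(t)}\cap B_1),\dots,\#(\Xi^{(t)}\cap B_k)\big)$ converges in distribution to $\big(\#(\Xi^{(\infty)}\cap B_1),\dots,\#(\Xi^{(\infty)}\cap B_k)\big)$ for all bounded Borel sets $B_1,\dots,B_k$ with $\Xi^{(\infty)}\cap\partial B_j=\emptyset$ almost surely, and $(\Xi^{(t)}_i)_{i\in I}$ converges in distribution to $(\Xi^{(\infty)}_i)_{i\in I}$ for every finite $I\subset\mathbb{Z}$. 2. $\Theta\Xi^{(t)}\Rightarrow\Theta\Xi^{(\infty)}$, weakly with respect to the vague topology. In particular, the law of the limit $\Xi^{(\infty)}$ does not depend on $\Xi^{(0)}$. -/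

import Mathlib

open MeasureTheory ProbabilityTheory Filter Topology Set
open scoped ENNReal CompactlySupported

noncomputable section

/-- A realization of a simple point process on the line: a locally finite set of points
that is unbounded in both directions. -/
@[ext]
structure Config where
  carrier : Set ℝ
  finite_inter : ∀ a b : ℝ, (carrier ∩ Icc a b).Finite
  exists_gt : ∀ a : ℝ, ∃ x ∈ carrier, a < x
  exists_lt : ∀ a : ℝ, ∃ x ∈ carrier, x < a

namespace Config

/-- The vague topology: the coarsest one for which `ξ ↦ ∑_{x ∈ ξ} f x` is continuous for every
continuous compactly supported `f`. -/
instance : TopologicalSpace Config :=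
  TopologicalSpace.induced
    (fun (ξ : Config) (f : C_c(ℝ, ℝ)) => ∑ᶠ x ∈ ξ.carrier, f x) inferInstance

instance : MeasurableSpace Config := borel Config

instance : BorelSpace Config := ⟨rfl⟩

/-- The number of points of `ξ` in `B` (used for bounded `B`). -/
def count (ξ : Config) (B : Set ℝ) : ℕ := (ξ.carrier ∩ B).ncard

theorem exists_enum (ξ : Config) :
    ∃ x : ℤ → ℝ, StrictMono x ∧ range x = ξ.carrier ∧ x 0 ≤ 0 ∧ 0 < x 1 := by
  classical
  obtain ⟨p, hp, hp0⟩ := ξ.exists_gt 0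
  have : Nonempty ξ.carrier := ⟨⟨p, hp⟩⟩
  have : NoMaxOrder ξ.carrier :=
    ⟨fun a => by
      obtain ⟨y, hy, h⟩ := ξ.exists_gt a
      exact ⟨⟨y, hy⟩, h⟩⟩
  have : NoMinOrder ξ.carrier :=
    ⟨fun a => by
      obtain ⟨y, hy, h⟩ := ξ.exists_lt a
      exact ⟨⟨y, hy⟩, h⟩⟩
  let _ : LocallyFiniteOrder ξ.carrier := LocallyFiniteOrder.ofFiniteIcc (fun a b => by
    refine Set.Finite.of_finite_image (f := Subtype.val) ?_ Subtype.val_injective.injOn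
    refine (ξ.finite_inter a b).subset ?_
    rintro _ ⟨y, hy, rfl⟩
    exact ⟨y.2, hy.1, hy.2⟩)
  let _ := LinearLocallyFiniteOrder.succOrder ξ.carrier
  let _ := LinearLocallyFiniteOrder.predOrder ξ.carrier
  let e : ξ.carrier ≃o ℤ := orderIsoIntOfLinearSuccPredArch
  have hx : StrictMono (fun i : ℤ => (e.symm i : ℝ)) := fun i j h => e.symm.strictMono h
  obtain ⟨q, hq, hq0⟩ := ξ.exists_lt 0
  obtain ⟨m, hm, hmax⟩ := Int.exists_greatest_of_bdd
    (P := fun i : ℤ => (e.symm i : ℝ) ≤ 0)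
    ⟨e ⟨p, hp⟩, fun z hz => by
      by_contra hlt
      have h1 := hx (not_le.mp hlt)
      simp only [OrderIso.symm_apply_apply] at h1
      linarith⟩
    ⟨e ⟨q, hq⟩, by simpa using hq0.le⟩
  refine ⟨fun i => (e.symm (m + i) : ℝ), fun i j h => hx (by simpa using h), ?_, by simpa using hm,
    ?_⟩
  · ext y
    constructor
    · rintro ⟨i, rfl⟩
      exact (e.symm (m + i)).2
    · intro hy
      exact ⟨e ⟨y, hy⟩ - m, by simp⟩
  · by_contra h
    have := hmax (m + 1) (not_lt.mp h)
    omega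

/-- The points of `ξ` in increasing order, `⋯ < pt ξ 0 ≤ 0 < pt ξ 1 < ⋯`; the properties in
`exists_enum` determine this enumeration uniquely. -/
def pt (ξ : Config) : ℤ → ℝ := ξ.exists_enum.choose

theorem pt_strictMono (ξ : Config) : StrictMono ξ.pt := ξ.exists_enum.choose_spec.1

theorem range_pt (ξ : Config) : range ξ.pt = ξ.carrier := ξ.exists_enum.choose_spec.2.1

theorem pt_zero_le (ξ : Config) : ξ.pt 0 ≤ 0 := ξ.exists_enum.choose_spec.2.2.1

theorem pt_one_pos (ξ : Config) : 0 < ξ.pt 1 := ξ.exists_enum.choose_spec.2.2.2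

/-- The gap to the right of the `i`-th point. -/
def gap (ξ : Config) (i : ℤ) : ℝ := ξ.pt (i + 1) - ξ.pt i

/-- The configuration seen from `s`. -/
def shift (s : ℝ) (ξ : Config) : Config where
  carrier := {y | y + s ∈ ξ.carrier}
  finite_inter a b := by
    refine Set.Finite.of_finite_image (f := fun y => y + s) ?_ (add_left_injective s).injOn
    refine (ξ.finite_inter (a + s) (b + s)).subset ?_
    rintro _ ⟨y, ⟨h1, h2, h3⟩, rfl⟩
    exact ⟨h1, by simpa using h2, by simpa using h3⟩
  exists_gt a := by
    obtain ⟨x, hx, h⟩ := ξ.exists_gt (a + s)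
    exact ⟨x - s, by simpa using hx, by linarith⟩
  exists_lt a := by
    obtain ⟨x, hx, h⟩ := ξ.exists_lt (a + s)
    exact ⟨x - s, by simpa using hx, by linarith⟩

/-- Multiplication of all points by a constant `c > 0`. -/
def scale (c : ℝ) (hc : 0 < c) (ξ : Config) : Config where
  carrier := (fun x => c * x) '' ξ.carrier
  finite_inter a b := by
    refine ((ξ.finite_inter (a / c) (b / c)).image (fun x => c * x)).subset ?_
    rintro _ ⟨⟨x, hx, rfl⟩, h1, h2⟩
    exact ⟨x, ⟨hx, by rw [div_le_iff₀ hc]; linarith, by rw [le_div_iff₀ hc]; linarith⟩, rfl⟩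
  exists_gt a := by
    obtain ⟨x, hx, h⟩ := ξ.exists_gt (a / c)
    exact ⟨_, ⟨x, hx, rfl⟩, by rw [div_lt_iff₀ hc] at h; linarith⟩
  exists_lt a := by
    obtain ⟨x, hx, h⟩ := ξ.exists_lt (a / c)
    exact ⟨_, ⟨x, hx, rfl⟩, by rw [lt_div_iff₀ hc] at h; linarith⟩

/-- Where the `i`-th point lands when it moves halfway to its right (`d i = true`) or left
(`d i = false`) neighbour. -/
def moved (ξ : Config) (d : ℤ → Bool) (i : ℤ) : ℝ :=
  (ξ.pt i + ξ.pt (if d i then i + 1 else i - 1)) / 2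

theorem le_moved (ξ : Config) (d : ℤ → Bool) (i : ℤ) : ξ.pt (i - 1) ≤ ξ.moved d i := by
  have h1 := ξ.pt_strictMono.monotone (show i - 1 ≤ i by omega)
  have h2 := ξ.pt_strictMono.monotone (show i - 1 ≤ if d i then i + 1 else i - 1 by split <;> omega)
  unfold moved
  linarith

theorem moved_le (ξ : Config) (d : ℤ → Bool) (i : ℤ) : ξ.moved d i ≤ ξ.pt (i + 1) := by
  have h1 := ξ.pt_strictMono.monotone (show i ≤ i + 1 by omega)
  have h2 := ξ.pt_strictMono.monotone (show (if d i then i + 1 else i - 1) ≤ i + 1 by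
    split <;> omega)
  unfold moved
  linarith

/-- All points move simultaneously; co-located points are merged, since the result is a set. -/
def moveMerge (ξ : Config) (d : ℤ → Bool) : Config where
  carrier := range (ξ.moved d)
  finite_inter a b := by
    obtain ⟨l, hl, hla⟩ := ξ.exists_lt a
    obtain ⟨u, hu, hub⟩ := ξ.exists_gt b
    rw [← ξ.range_pt] at hl hu
    obtain ⟨i, rfl⟩ := hl
    obtain ⟨j, rfl⟩ := hu
    refine ((finite_Icc (i - 1) (j + 1)).image (ξ.moved d)).subset ?_
    rintro _ ⟨⟨k, rfl⟩, h1, h2⟩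
    refine ⟨k, ⟨?_, ?_⟩, rfl⟩
    · have := ξ.pt_strictMono.lt_iff_lt.mp (hla.trans_le (h1.trans (ξ.moved_le d k)))
      omega
    · have := ξ.pt_strictMono.lt_iff_lt.mp (((ξ.le_moved d k).trans h2).trans_lt hub)
      omega
  exists_gt a := by
    obtain ⟨u, hu, hua⟩ := ξ.exists_gt a
    rw [← ξ.range_pt] at hu
    obtain ⟨j, rfl⟩ := hu
    exact ⟨_, ⟨j + 1, rfl⟩, hua.trans_le (by simpa using ξ.le_moved d (j + 1))⟩
  exists_lt a := by
    obtain ⟨l, hl, hla⟩ := ξ.exists_lt a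
    rw [← ξ.range_pt] at hl
    obtain ⟨j, rfl⟩ := hl
    exact ⟨_, ⟨j - 1, rfl⟩, lt_of_le_of_lt (by simpa using ξ.moved_le d (j - 1)) hla⟩

/-- One step of the dynamics: move and merge, then multiply by `3/4`, the intensity of the merged
process. -/
def step (ξ : Config) (d : ℤ → Bool) : Config :=
  (ξ.moveMerge d).scale (3 / 4) (by norm_num)

end Config

/-- Invariance of the law `P` of a point process under all translations. -/
def StationaryLaw (P : Measure Config) : Prop :=
  ∀ s : ℝ, P.map (Config.shift s) = P

/-- The mean number of points in `(0, 1]`. -/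
def intensity (P : Measure Config) : ℝ≥0∞ :=
  ∫⁻ ξ, (ξ.count (Ioc 0 1) : ℝ≥0∞) ∂P

/-- The law of the Palm shift of a stationary point process with law `P` and intensity `lam`:
`palm P A = (1 / lam) * E #{x ∈ ξ ∩ (0, 1] | shift x ξ ∈ A}`. -/
def palm (P : Measure Config) : Measure Config :=
  (intensity P)⁻¹ • Measure.sum (fun i : ℤ =>
    (P.restrict {ξ | ξ.pt i ∈ Ioc (0 : ℝ) 1}).map (fun ξ => ξ.shift (ξ.pt i)))

/-- `P` is the law of a stationary unit-intensity renewal process: seen from a typical point, the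
gaps are independent and identically distributed. -/
structure IsUnitRenewal (P : Measure Config) : Prop where
  stationary : StationaryLaw P
  intensity_eq : intensity P = 1
  indep : iIndepFun (fun (i : ℤ) (ξ : Config) => ξ.gap i) (palm P)
  ident : ∀ i : ℤ, IdentDistrib (fun ξ : Config => ξ.gap i) (fun ξ => ξ.gap 0) (palm P) (palm P)

/-- `Ξ 0, Ξ 1, …` evolve by the clustering dynamics: at time `t` the `i`-th point of `Ξ t` moves in
the direction `dir t i`, the directions being fair coin flips, independent of each other and
of `Ξ 0`. -/
structure IsClustering {Ω : Type*} [MeasurableSpace Ω] (μ : Measure Ω)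
    (Ξ : ℕ → Ω → Config) (dir : ℕ → ℤ → Ω → Bool) : Prop where
  measurable_init : Measurable (Ξ 0)
  measurable_dir : ∀ t i, Measurable (dir t i)
  fair : ∀ t i, μ {ω | dir t i ω = true} = 1 / 2
  indep_dir : iIndepFun (fun p : ℕ × ℤ => dir p.1 p.2) μ
  indep_init : IndepFun (Ξ 0) (fun ω (p : ℕ × ℤ) => dir p.1 p.2 ω) μ
  evolve : ∀ t, ∀ᵐ ω ∂μ, Ξ (t + 1) ω = (Ξ t ω).step (fun i => dir t i ω)

/-- Weak convergence of probability measures (all measures involved are required to be probability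
measures). -/
def WeakConv {E : Type*} [TopologicalSpace E] [MeasurableSpace E] [OpensMeasurableSpace E]
    (P : ℕ → Measure E) (Q : Measure E) : Prop :=
  ∃ (hP : ∀ t, IsProbabilityMeasure (P t)) (hQ : IsProbabilityMeasure Q),
    Tendsto (β := ProbabilityMeasure E) (fun t => ⟨P t, hP t⟩) atTop (𝓝 ⟨Q, hQ⟩)

/-- Convergence of the finite-dimensional distributions of the counting variables, over bounded Borel
sets whose boundary is almost surely not charged by the limit. -/
def FDDCounts (P : ℕ → Measure Config) (Q : Measure Config) : Prop :=
  ∀ (k : ℕ) (B : Fin k → Set ℝ), (∀ j, MeasurableSet (B j)) → (∀ j, Bornology.IsBounded (B j)) →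
    (∀ j, Q {ξ | (ξ.carrier ∩ frontier (B j)).Nonempty} = 0) →
    WeakConv (fun t => (P t).map (fun ξ (j : Fin k) => ξ.count (B j)))
      (Q.map (fun ξ (j : Fin k) => ξ.count (B j)))

/-- Convergence of the finite-dimensional distributions of the sequence of points, enumerated in
increasing order with the index `0` at the last point in `(-∞, 0]`. -/
def FDDPoints (P : ℕ → Measure Config) (Q : Measure Config) : Prop :=
  ∀ I : Finset ℤ, WeakConv (fun t => (P t).map (fun ξ (i : I) => ξ.pt i))
    (Q.map (fun ξ (i : I) => ξ.pt i))

end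

/-! The dynamics is easiest to follow from a typical point, where it becomes a random linear
recursion for the two-sided sequence of gaps. After one step the points are the occupied midpoints,
so for fixed directions `d` the new gaps `newgap g d` depend linearly on the old gaps `g`. Seen from
a typical new point, the directions are fair coins conditioned on midpoint `0` being occupied
(`palmCoins`). Palm inversion (`StationaryLaw.eq_invPalm`) and a mass transport argument
(`lintegral_tiling`) give `IsGapLaw.map_step`: one step of the stationary process is one application
of `clusterMap` to the law of its Palm gaps. Each `Ξ t` therefore has law `invPalm (clusterMap^[t]
ν)`, where `ν` is the law of the initial gaps.

Since the directions are independent and identically distributed over time, the random maps may be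
composed in reverse order without changing the law at a fixed time (`map_evol`). In this order
(`evol`) a further time step acts on the initial sequence and leaves the outer maps alone, so almost
sure convergence can be hoped for.

The contraction comes from `SqBound.clusterMap`: if linear combinations of the coordinates are
bounded in `L²` by `C` times the `ℓ²` norm of the coefficients, then after one step the same holds
with `3 / 4 * C`. This is applied to two centred sequences. Independent initial gaps minus their
mean satisfy such a bound with the variance as constant, so `evol t D (g - 1)` tends to zero and the
initial gaps are forgotten. For the lattice of unit gaps, the increment of `evol t D 1` in `t` is
the image under `t` maps of the fluctuation `newgap 1 d - 1`, which `sqBound_lattice` controls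
through a two-state Markov recursion. The increments are summable almost surely, and `limitGap`
exists and is a function of the directions alone.

It remains to see that the limit is the gap sequence of a genuine configuration. Domination of the
increments keeps the mean equal to one; an invariance argument (`limitGap_zero_pos`) excludes
vanishing gaps; Poincaré recurrence makes the positions unbounded in both directions
(`isGood_of_stationary`). Almost sure convergence of the gaps then gives convergence of the Palm
shifts and, with an observer placed by Lebesgue measure in the gap at the origin, of the stationary
processes (`weakConv_invPalm`). -/

noncomputable section

/-! ### Measurability of points, counts, shifts and steps for the vague Borel structure -/

namespace Config

theorem finite_inter_of_bounded (ξ : Config) {B : Set ℝ} (hB : Bornology.IsBounded B) :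
    (ξ.carrier ∩ B).Finite := by
  obtain ⟨a, b, h⟩ : ∃ a b, B ⊆ Icc a b := by
    obtain ⟨r, hr⟩ := hB.subset_closedBall 0
    exact ⟨-r, r, hr.trans (by simp [Real.closedBall_eq_Icc])⟩
  exact (ξ.finite_inter a b).subset (inter_subset_inter_right _ h)

/-- A continuous trapezoid approximating the indicator of `(a, b]`. -/
def trapezoid (a b : ℝ) (n : ℕ) (x : ℝ) : ℝ :=
  max 0 (min 1 (min ((n + 1) * (x - a)) (1 + (n + 1) * (b - x))))

theorem continuous_trapezoid (a b : ℝ) (n : ℕ) : Continuous (trapezoid a b n) := by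
  unfold trapezoid
  fun_prop

theorem trapezoid_eq_zero {a b : ℝ} {n : ℕ} {x : ℝ} (hx : x ∉ Icc a (b + 1)) :
    trapezoid a b n x = 0 := by
  unfold trapezoid
  refine max_eq_left ?_
  rw [mem_Icc, not_and_or, not_le, not_le] at hx
  have hn : (0 : ℝ) ≤ n := n.cast_nonneg
  rcases hx with hx | hx
  · refine (min_le_right _ _).trans ((min_le_left _ _).trans ?_)
    nlinarith
  · refine (min_le_right _ _).trans ((min_le_right _ _).trans ?_)
    nlinarith

/-- `trapezoid` as a compactly supported function. -/
def trapezoidC (a b : ℝ) (n : ℕ) : C_c(ℝ, ℝ) where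
  toFun := trapezoid a b n
  continuous_toFun := continuous_trapezoid a b n
  hasCompactSupport' := HasCompactSupport.intro isCompact_Icc (fun _ hx => trapezoid_eq_zero hx)

/-- The left ramp lies inside the interval and the right one outside, so in the limit `a` is
excluded and `b` included. At each point the values are eventually constant. -/
theorem tendsto_trapezoid (a b x : ℝ) :
    Tendsto (fun n => trapezoid a b n x) atTop (𝓝 ((Ioc a b).indicator 1 x)) := by
  have hlin : ∀ c : ℝ, 0 < c → ∀ᶠ n : ℕ in atTop, 1 ≤ ((n : ℝ) + 1) * c := fun c hc => by
    obtain ⟨N, hN⟩ := exists_nat_gt (1 / c)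
    filter_upwards [eventually_ge_atTop N] with n hn
    rw [div_lt_iff₀ hc] at hN
    have : (N : ℝ) ≤ n := by exact_mod_cast hn
    nlinarith
  refine tendsto_const_nhds.congr' ?_
  by_cases h1 : x ≤ a
  · refine Eventually.of_forall fun n => ?_
    rw [indicator_of_notMem (by simp [h1])]
    unfold trapezoid
    refine (max_eq_left ?_).symm
    refine (min_le_right _ _).trans ((min_le_left _ _).trans ?_)
    have hn : (0 : ℝ) ≤ n := n.cast_nonneg
    nlinarith
  push Not at h1
  by_cases h2 : x ≤ b
  · rw [indicator_of_mem (show x ∈ Ioc a b from ⟨h1, h2⟩)]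
    filter_upwards [hlin (x - a) (by linarith)] with n hn
    have h3 : (1 : ℝ) ≤ 1 + (n + 1) * (b - x) := by
      have : (0 : ℝ) ≤ (n + 1) * (b - x) := mul_nonneg (by positivity) (by linarith)
      linarith
    unfold trapezoid
    rw [min_eq_left (le_min hn h3)]
    simp
  · push Not at h2
    rw [indicator_of_notMem (by simp [h2])]
    filter_upwards [hlin (x - b) (by linarith)] with n hn
    unfold trapezoid
    refine (max_eq_left ?_).symm
    refine (min_le_right _ _).trans ((min_le_right _ _).trans ?_)
    nlinarith

theorem continuous_finsum (f : C_c(ℝ, ℝ)) :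
    Continuous fun ξ : Config => ∑ᶠ x ∈ ξ.carrier, f x :=
  (continuous_apply f).comp
    (continuous_induced_dom (f := fun (ξ : Config) (f : C_c(ℝ, ℝ)) => ∑ᶠ x ∈ ξ.carrier, f x))

/-- The vague topology only speaks of continuous test functions; counts are reached as pointwise
limits of trapezoid sums, which are finite sums over one fixed finite set of points. -/
theorem measurable_count_Ioc (a b : ℝ) : Measurable fun ξ : Config => ξ.count (Ioc a b) := by
  suffices h : Measurable fun ξ : Config => (ξ.count (Ioc a b) : ℝ) by
    have := Nat.measurable_floor.comp h
    simpa [Function.comp_def] using this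
  refine measurable_of_tendsto_metrizable
    (f := fun n (ξ : Config) => ∑ᶠ x ∈ ξ.carrier, trapezoidC a b n x)
    (fun n => (continuous_finsum _).measurable) ?_
  rw [tendsto_pi_nhds]
  intro ξ
  have hfin := ξ.finite_inter a (b + 1)
  have key : ∀ h : ℝ → ℝ, (∀ x, x ∉ Icc a (b + 1) → h x = 0) →
      ∑ᶠ x ∈ ξ.carrier, h x = ∑ x ∈ hfin.toFinset, h x := by
    intro h hh
    refine finsum_mem_eq_sum_of_inter_support_eq _ ?_
    ext x
    simp only [mem_inter_iff, Function.mem_support, Finite.coe_toFinset]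
    have := hh x
    tauto
  have hlim : (ξ.count (Ioc a b) : ℝ) = ∑ x ∈ hfin.toFinset, (Ioc a b).indicator 1 x := by
    classical
    rw [Finset.sum_indicator_eq_sum_filter]
    simp only [Pi.one_apply, Finset.sum_const, nsmul_eq_mul, mul_one, Nat.cast_inj]
    rw [count, ← Set.ncard_coe_finset]
    congr 1
    ext x
    simp only [mem_inter_iff, mem_Ioc, Finset.coe_filter, Finite.mem_toFinset, mem_Icc,
      mem_ofPred_eq]
    constructor
    · rintro ⟨h, h1, h2⟩
      exact ⟨⟨h, h1.le, by linarith⟩, h1, h2⟩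
    · rintro ⟨⟨h, _⟩, h1, h2⟩
      exact ⟨h, h1, h2⟩
  rw [hlim]
  have : ∀ n, ∑ᶠ x ∈ ξ.carrier, trapezoidC a b n x = ∑ x ∈ hfin.toFinset, trapezoid a b n x :=
    fun n => key _ fun x hx => trapezoid_eq_zero hx
  simp only [this]
  exact tendsto_finsetSum _ fun x _ => tendsto_trapezoid a b x

theorem count_eq_ncard (ξ : Config) (B : Set ℝ) : ξ.count B = {i | ξ.pt i ∈ B}.ncard := by
  rw [count, ← ξ.range_pt, show range ξ.pt ∩ B = ξ.pt '' {i | ξ.pt i ∈ B} by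
    ext x; constructor
    · rintro ⟨⟨i, rfl⟩, h⟩; exact ⟨i, h, rfl⟩
    · rintro ⟨i, h, rfl⟩; exact ⟨⟨i, rfl⟩, h⟩]
  exact ncard_image_of_injective _ ξ.pt_strictMono.injective

theorem finite_pt_mem (ξ : Config) {B : Set ℝ} (hB : Bornology.IsBounded B) :
    {i | ξ.pt i ∈ B}.Finite := by
  refine Finite.of_finite_image (f := ξ.pt) ?_ ξ.pt_strictMono.injective.injOn
  refine (ξ.finite_inter_of_bounded hB).subset ?_
  rintro _ ⟨i, hi, rfl⟩
  exact ⟨by rw [← ξ.range_pt]; exact mem_range_self i, hi⟩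

theorem pt_pos_iff (ξ : Config) (i : ℤ) : 0 < ξ.pt i ↔ 1 ≤ i := by
  constructor
  · intro h
    by_contra hi
    have := ξ.pt_strictMono.monotone (show i ≤ 0 by omega)
    have := ξ.pt_zero_le
    linarith
  · intro h
    exact ξ.pt_one_pos.trans_le (ξ.pt_strictMono.monotone h)

/-- The points with indices `1, …, i` are the first `i` points to the right of the origin. With its
counterpart for nonpositive indices this reads the enumeration off the counts, hence its
measurability. -/
theorem pt_le_iff_of_pos (ξ : Config) {i : ℤ} (hi : 1 ≤ i) (r : ℝ) :
    ξ.pt i ≤ r ↔ i.toNat ≤ ξ.count (Ioc 0 r) := by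
  rw [count_eq_ncard]
  have hfin := ξ.finite_pt_mem (B := Ioc 0 r) (Metric.isBounded_Ioc _ _)
  constructor
  · intro h
    have : ((Finset.Icc 1 i : Finset ℤ) : Set ℤ) ⊆ {j | ξ.pt j ∈ Ioc 0 r} := by
      intro j hj
      simp only [Finset.coe_Icc, mem_Icc] at hj
      exact ⟨(ξ.pt_pos_iff j).2 hj.1, (ξ.pt_strictMono.monotone hj.2).trans h⟩
    have h2 := ncard_le_ncard this hfin
    rw [ncard_coe_finset, Int.card_Icc] at h2
    simpa using h2
  · intro h
    by_contra hlt
    push Not at hlt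
    have : {j | ξ.pt j ∈ Ioc 0 r} ⊆ ((Finset.Ico 1 i : Finset ℤ) : Set ℤ) := by
      intro j hj
      simp only [Finset.coe_Ico, mem_Ico]
      exact ⟨(ξ.pt_pos_iff j).1 hj.1, ξ.pt_strictMono.lt_iff_lt.1 (hj.2.trans_lt hlt)⟩
    have h2 := ncard_le_ncard this (Finset.finite_toSet _)
    rw [ncard_coe_finset, Int.card_Ico] at h2
    omega

theorem lt_pt_iff_of_nonpos (ξ : Config) {i : ℤ} (hi : i ≤ 0) (r : ℝ) :
    r < ξ.pt i ↔ (1 - i).toNat ≤ ξ.count (Ioc r 0) := by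
  rw [count_eq_ncard]
  have hfin := ξ.finite_pt_mem (B := Ioc r 0) (Metric.isBounded_Ioc _ _)
  have hnp : ∀ j, ξ.pt j ≤ 0 ↔ j ≤ 0 := fun j => by
    rw [← not_lt, pt_pos_iff]; omega
  constructor
  · intro h
    have : ((Finset.Icc i 0 : Finset ℤ) : Set ℤ) ⊆ {j | ξ.pt j ∈ Ioc r 0} := by
      intro j hj
      simp only [Finset.coe_Icc, mem_Icc] at hj
      exact ⟨h.trans_le (ξ.pt_strictMono.monotone hj.1), (hnp j).2 hj.2⟩
    have h2 := ncard_le_ncard this hfin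
    rw [ncard_coe_finset, Int.card_Icc] at h2
    omega
  · intro h
    by_contra hlt
    push Not at hlt
    have : {j | ξ.pt j ∈ Ioc r 0} ⊆ ((Finset.Ioc i 0 : Finset ℤ) : Set ℤ) := by
      intro j hj
      simp only [Finset.coe_Ioc, mem_Ioc]
      exact ⟨ξ.pt_strictMono.lt_iff_lt.1 (hlt.trans_lt hj.1), (hnp j).1 hj.2⟩
    have h2 := ncard_le_ncard this (Finset.finite_toSet _)
    rw [ncard_coe_finset, Int.card_Ioc] at h2
    omega

/-- Measurability of the points of a random configuration can be tested on the counts in half-open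
intervals. -/
theorem measurable_pt_comp {α : Type*} [MeasurableSpace α] {F : α → Config}
    (hF : ∀ a b : ℝ, ∀ k : ℕ, MeasurableSet {y | k ≤ (F y).count (Ioc a b)}) (i : ℤ) :
    Measurable fun y => (F y).pt i := by
  by_cases hi : 1 ≤ i
  · refine measurable_of_Iic fun r => ?_
    have : (fun y => (F y).pt i) ⁻¹' Iic r = {y | i.toNat ≤ (F y).count (Ioc 0 r)} := by
      ext y
      exact (F y).pt_le_iff_of_pos hi r
    rw [this]
    exact hF _ _ _
  · refine measurable_of_Ioi fun r => ?_
    have : (fun y => (F y).pt i) ⁻¹' Ioi r = {y | (1 - i).toNat ≤ (F y).count (Ioc r 0)} := by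
      ext y
      exact (F y).lt_pt_iff_of_nonpos (by omega) r
    rw [this]
    exact hF _ _ _

theorem measurable_pt (i : ℤ) : Measurable fun ξ : Config => ξ.pt i :=
  measurable_pt_comp (F := fun ξ => ξ)
    (fun a b _ => measurableSet_le measurable_const (measurable_count_Ioc a b)) i

theorem measurable_gap (i : ℤ) : Measurable fun ξ : Config => ξ.gap i :=
  (measurable_pt _).sub (measurable_pt _)

/-- Strictly increasing two-sided sequences, unbounded in both directions. -/
abbrev Enum : Type :=
  {x : ℤ → ℝ // StrictMono x ∧ (∀ a, ∃ i, a < x i) ∧ ∀ a, ∃ i, x i < a}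

/-- The configuration enumerated by a sequence. -/
def ofEnum (x : Enum) : Config where
  carrier := range x.1
  finite_inter a b := by
    obtain ⟨i, hi⟩ := x.2.2.2 a
    obtain ⟨j, hj⟩ := x.2.2.1 b
    refine ((finite_Icc i j).image x.1).subset ?_
    rintro _ ⟨⟨k, rfl⟩, h1, h2⟩
    refine ⟨k, ⟨?_, ?_⟩, rfl⟩
    · exact (x.2.1.lt_iff_lt.1 (hi.trans_le h1)).le
    · exact (x.2.1.lt_iff_lt.1 (h2.trans_lt hj)).le
  exists_gt a := by
    obtain ⟨i, hi⟩ := x.2.2.1 a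
    exact ⟨_, mem_range_self i, hi⟩
  exists_lt a := by
    obtain ⟨i, hi⟩ := x.2.2.2 a
    exact ⟨_, mem_range_self i, hi⟩

/-- Near `x` only the indices between some `i` and `j` with `x i < -R` and `R < x j` can meet a test
function supported in `[-R, R]`, and by monotonicity the same window serves all nearby enumerations.
The statistic is thus locally a fixed finite sum. -/
theorem continuous_ofEnum : Continuous ofEnum := by
  refine continuous_induced_rng.2 (continuous_pi fun f => ?_)
  obtain ⟨R, hR⟩ : ∃ R : ℝ, ∀ x, R < |x| → f x = 0 := by
    obtain ⟨R, hR⟩ := f.hasCompactSupport.isCompact.isBounded.subset_closedBall 0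
    refine ⟨R, fun x hx => ?_⟩
    by_contra h
    have := hR (subset_tsupport _ h)
    simp only [mem_closedBall_zero_iff, Real.norm_eq_abs] at this
    linarith
  rw [continuous_iff_continuousAt]
  intro x
  obtain ⟨i, hi⟩ := x.2.2.2 (-R)
  obtain ⟨j, hj⟩ := x.2.2.1 R
  have hev : ∀ k, Continuous fun y : Enum => y.1 k := fun k =>
    (continuous_apply k).comp continuous_subtype_val
  have hc : Continuous fun y : Enum => ∑ k ∈ Finset.Icc i j, f (y.1 k) :=
    continuous_finsetSum _ fun k _ => f.continuous.comp (hev k)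
  refine hc.continuousAt.congr ?_
  have h1 : ∀ᶠ y : Enum in 𝓝 x, y.1 i < -R :=
    (hev i).continuousAt.eventually (Iio_mem_nhds hi)
  have h2 : ∀ᶠ y : Enum in 𝓝 x, R < y.1 j :=
    (hev j).continuousAt.eventually (Ioi_mem_nhds hj)
  filter_upwards [h1, h2] with y h1 h2
  change _ = ∑ᶠ z ∈ range y.1, f z
  rw [finsum_mem_range y.2.1.injective]
  refine (finsum_eq_sum_of_support_subset _ ?_).symm
  intro k hk
  simp only [Finset.coe_Icc, mem_Icc]
  have hk' : |y.1 k| ≤ R := by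
    by_contra h
    exact hk (hR _ (not_le.1 h))
  rw [abs_le] at hk'
  constructor
  · exact (y.2.1.lt_iff_lt.1 (h1.trans_le hk'.1)).le
  · exact (y.2.1.lt_iff_lt.1 (hk'.2.trans_lt h2)).le

/-- The enumeration of a configuration by `pt`. -/
def enum (ξ : Config) : Enum :=
  ⟨ξ.pt, ξ.pt_strictMono, fun a => by
    obtain ⟨x, hx, h⟩ := ξ.exists_gt a
    rw [← ξ.range_pt] at hx
    obtain ⟨i, rfl⟩ := hx
    exact ⟨i, h⟩, fun a => by
    obtain ⟨x, hx, h⟩ := ξ.exists_lt a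
    rw [← ξ.range_pt] at hx
    obtain ⟨i, rfl⟩ := hx
    exact ⟨i, h⟩⟩

theorem ofEnum_enum (ξ : Config) : ofEnum ξ.enum = ξ := Config.ext ξ.range_pt

/-- The map factors through the space of enumerations, whose product structure is easy, followed by
the continuous `ofEnum`. No vaguely Borel set has to be examined. -/
theorem measurable_of_pt {α : Type*} [MeasurableSpace α] {F : α → Config}
    (hF : ∀ i, Measurable fun y => (F y).pt i) : Measurable F := by
  have h : Measurable fun y => (F y).enum := (measurable_pi_iff.2 hF).subtype_mk
  have := continuous_ofEnum.measurable.comp h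
  simpa [Function.comp_def, ofEnum_enum] using this

/-- A random configuration is measurable if its points form a countable family of measurable
functions. -/
theorem measurable_of_range {α ι : Type*} [MeasurableSpace α] [Countable ι] {F : α → Config}
    (x : ι → α → ℝ) (hx : ∀ i, Measurable (x i)) (h : ∀ y, (F y).carrier = range fun i => x i y) :
    Measurable F := by
  refine measurable_of_pt (measurable_pt_comp fun a b k => ?_)
  -- The family may repeat values, as it does after merging, and need not be ordered. At least `k`
  -- points means that some `k` labels have pairwise distinct values in the interval, and there are
  -- countably many such sets of labels.
  have : {y | k ≤ (F y).count (Ioc a b)} = ⋃ s ∈ {s : Finset ι | s.card = k},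
      {y | (∀ i ∈ s, x i y ∈ Ioc a b) ∧ ∀ i ∈ s, ∀ j ∈ s, i ≠ j → x i y ≠ x j y} := by
    ext y
    simp only [mem_ofPred_eq, mem_iUnion, exists_prop]
    have hfin : ((F y).carrier ∩ Ioc a b).Finite :=
      (F y).finite_inter_of_bounded (Metric.isBounded_Ioc _ _)
    constructor
    · intro hk
      obtain ⟨t, ht, htk⟩ := exists_subset_card_eq hk
      have hch : ∀ z : t, ∃ i, x i y = z := fun z => by
        have := (ht z.2).1
        rw [h y] at this
        exact this
      choose u hu using hch
      have hinj : Function.Injective u := fun z w hzw => by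
        apply Subtype.ext
        rw [← hu z, ← hu w, hzw]
      have : Fintype t := (hfin.subset ht).fintype
      refine ⟨Finset.univ.map ⟨u, hinj⟩, ?_, ?_, ?_⟩
      · rw [Finset.card_map, Finset.card_univ, ← htk, ← Nat.card_coe_set_eq, Nat.card_eq_fintype_card]
      · intro i hi
        simp only [Finset.mem_map, Finset.mem_univ, Function.Embedding.coeFn_mk, true_and] at hi
        obtain ⟨z, rfl⟩ := hi
        rw [hu]
        exact (ht z.2).2
      · intro i hi j hj hij heq
        simp only [Finset.mem_map, Finset.mem_univ, Function.Embedding.coeFn_mk, true_and] at hi hj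
        obtain ⟨z, rfl⟩ := hi
        obtain ⟨w, rfl⟩ := hj
        rw [hu, hu] at heq
        exact hij (congrArg u (Subtype.ext heq))
    · rintro ⟨s, hs, h1, h2⟩
      have hsub : (fun i => x i y) '' s ⊆ (F y).carrier ∩ Ioc a b := by
        rintro _ ⟨i, hi, rfl⟩
        exact ⟨by rw [h y]; exact mem_range_self i, h1 i hi⟩
      have hle := ncard_le_ncard hsub hfin
      rw [InjOn.ncard_image, ncard_coe_finset, hs] at hle
      · exact hle
      · intro i hi j hj hij
        by_contra hne
        exact h2 i hi j hj hne hij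
  rw [this]
  refine MeasurableSet.biUnion (to_countable _) fun s _ => ?_
  change MeasurableSet ({y | ∀ i ∈ s, x i y ∈ Ioc a b} ∩
    {y | ∀ i ∈ s, ∀ j ∈ s, i ≠ j → x i y ≠ x j y})
  refine MeasurableSet.inter ?_ ?_
  · have : {y | ∀ i ∈ s, x i y ∈ Ioc a b} = ⋂ i ∈ s, x i ⁻¹' Ioc a b := by ext; simp
    rw [this]
    exact Finset.measurableSet_biInter _ fun i _ => hx i measurableSet_Ioc
  · have : {y | ∀ i ∈ s, ∀ j ∈ s, i ≠ j → x i y ≠ x j y} =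
        ⋂ i ∈ s, ⋂ j ∈ s, {y | i ≠ j → x i y ≠ x j y} := by ext; simp
    rw [this]
    refine Finset.measurableSet_biInter _ fun i _ => Finset.measurableSet_biInter _ fun j _ => ?_
    by_cases hij : i = j
    · simp [hij]
    · simp only [ne_eq, hij, not_false_eq_true, forall_const]
      exact (measurableSet_eq_fun (hx i) (hx j)).compl

/-- The enumeration of a configuration is determined by its normalization at the origin. -/
theorem pt_eq_of_strictMono (ξ : Config) {x : ℤ → ℝ} (hx : StrictMono x)
    (hr : range x = ξ.carrier) (h0 : x 0 ≤ 0) (h1 : 0 < x 1) : ξ.pt = x := by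
  rw [← ξ.range_pt] at hr
  have h : ∀ i, ∃ j, ξ.pt j = x i := fun i => by
    have : x i ∈ range ξ.pt := hr ▸ mem_range_self i
    exact this
  have h' : ∀ j, ∃ i, x i = ξ.pt j := fun j => by
    have : ξ.pt j ∈ range x := hr ▸ mem_range_self j
    exact this
  choose σ hσ using h
  choose τ hτ using h'
  have hσm : StrictMono σ := fun i j hij =>
    ξ.pt_strictMono.lt_iff_lt.1 (by rw [hσ, hσ]; exact hx hij)
  have hστ : ∀ j, σ (τ j) = j := fun j => ξ.pt_strictMono.injective (by rw [hσ, hτ])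
  -- An increasing surjection of `ℤ` cannot skip a value, so `σ` is a translation; the normalization
  -- at the origin then makes it the identity.
  have hsucc : ∀ i, σ (i + 1) = σ i + 1 := fun i => by
    have h2 := hσm (show i < i + 1 by omega)
    by_contra hne
    have h3 : σ i < σ (τ (σ i + 1)) := by rw [hστ]; omega
    have h4 : σ (τ (σ i + 1)) < σ (i + 1) := by rw [hστ]; omega
    rw [hσm.lt_iff_lt] at h3 h4
    omega
  have h00 : σ 0 = 0 := by
    have e0 : ¬ 1 ≤ σ 0 := by rw [← ξ.pt_pos_iff, hσ]; exact not_lt.2 h0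
    have e1 : 1 ≤ σ (0 + 1) := by rw [← ξ.pt_pos_iff, hσ]; exact h1
    rw [hsucc] at e1
    omega
  have hid : ∀ i, σ i = i := fun i => by
    induction i using Int.induction_on with
    | zero => exact h00
    | succ i ih => rw [hsucc, ih]
    | pred i ih =>
      have := hsucc (-(i : ℤ) - 1)
      rw [sub_add_cancel, ih] at this
      omega
  funext i
  rw [← hσ, hid]

theorem measurable_shift : Measurable fun p : ℝ × Config => p.2.shift p.1 := by
  refine measurable_of_range (ι := ℤ) (fun i p => p.2.pt i - p.1)
    (fun i => ((measurable_pt i).comp measurable_snd).sub measurable_fst) fun p => ?_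
  ext y
  change y + p.1 ∈ p.2.carrier ↔ _
  rw [← p.2.range_pt]
  constructor
  · rintro ⟨i, hi⟩
    exact ⟨i, by simp only [hi]; ring⟩
  · rintro ⟨i, rfl⟩
    exact ⟨i, by ring⟩

theorem measurable_step : Measurable fun p : Config × (ℤ → Bool) => p.1.step p.2 := by
  refine measurable_of_range (ι := ℤ) (fun i p => 3 / 4 * p.1.moved p.2 i) (fun i => ?_)
    fun p => ?_
  · refine Measurable.const_mul ?_ _
    have : (fun p : Config × (ℤ → Bool) => p.1.moved p.2 i) = fun p =>
        (p.1.pt i + if p.2 i = true then p.1.pt (i + 1) else p.1.pt (i - 1)) / 2 := by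
      funext p
      unfold moved
      split_ifs <;> rfl
    rw [this]
    have hm : ∀ j, Measurable fun p : Config × (ℤ → Bool) => p.1.pt j := fun j =>
      (measurable_pt j).comp measurable_fst
    refine ((hm i).add (Measurable.ite ?_ (hm _) (hm _))).div_const _
    exact ((measurable_pi_apply (X := fun _ : ℤ => Bool) i).comp measurable_snd)
      (measurableSet_singleton true)
  · change (fun x => 3 / 4 * x) '' range (p.1.moved p.2) = _
    rw [← range_comp]
    rfl

theorem measurable_count {B : Set ℝ} (hB : MeasurableSet B) (hb : Bornology.IsBounded B) :
    Measurable fun ξ : Config => ξ.count B := by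
  have h : ∀ ξ : Config, (ξ.count B : ℝ≥0∞) = ∑' i : ℤ, B.indicator 1 (ξ.pt i) := fun ξ => by
    rw [count_eq_ncard]
    have hf := ξ.finite_pt_mem hb
    rw [tsum_eq_sum (s := hf.toFinset) (fun i hi => indicator_of_notMem (by simpa using hi) _),
      Finset.sum_congr rfl (g := fun _ => 1)
        (fun i hi => indicator_of_mem (show ξ.pt i ∈ B by simpa using hi) _)]
    simp [ncard_eq_toFinset_card _ hf]
  have h2 : Measurable fun ξ : Config => (ξ.count B : ℝ≥0∞) := by
    simp only [h]
    exact Measurable.tsum fun i =>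
      (measurable_one.indicator hB).comp (measurable_pt i)
  refine measurable_to_countable' fun n => ?_
  have : (fun ξ : Config => ξ.count B) ⁻¹' {n} =
      (fun ξ : Config => (ξ.count B : ℝ≥0∞)) ⁻¹' {(n : ℝ≥0∞)} := by
    ext ξ
    simp
  rw [this]
  exact h2 (measurableSet_singleton _)

end Config


/-! ### Sequences of gaps -/

/-- The two-sided sequence seen from the index `i`. -/
def seqShift {α : Type*} (i : ℤ) (g : ℤ → α) : ℤ → α := fun j => g (j + i)

theorem seqShift_neg_seqShift {α : Type*} (i : ℤ) (g : ℤ → α) :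
    seqShift (-i) (seqShift i g) = g := by
  funext j
  simp [seqShift]

theorem measurable_seqShift {α : Type*} [MeasurableSpace α] (i : ℤ) :
    Measurable (seqShift (α := α) i) :=
  measurable_pi_iff.2 fun j => measurable_pi_apply (j + i)

theorem seqShift_seqShift {α : Type*} (i j : ℤ) (g : ℤ → α) :
    seqShift i (seqShift j g) = seqShift (i + j) g := by
  funext k
  simp [seqShift, add_assoc]

/-- The position of the `i`-th point when the point `0` is at the origin and the gaps are `g`. -/
def pos (g : ℤ → ℝ) (i : ℤ) : ℝ := ∑ j ∈ Finset.Ico 0 i, g j - ∑ j ∈ Finset.Ico i 0, g j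

@[simp]
theorem pos_zero (g : ℤ → ℝ) : pos g 0 = 0 := by simp [pos]

theorem pos_succ (g : ℤ → ℝ) (i : ℤ) : pos g (i + 1) = pos g i + g i := by
  unfold pos
  rcases le_or_gt 0 i with hi | hi
  · rw [← Finset.insert_Ico_right_eq_Ico_add_one hi, Finset.sum_insert (by simp),
      Finset.Ico_eq_empty_of_le hi, Finset.Ico_eq_empty_of_le (show 0 ≤ i + 1 by omega)]
    simp
    ring
  · rw [← Finset.insert_Ico_add_one_left_eq_Ico hi, Finset.sum_insert (by simp),
      Finset.Ico_eq_empty_of_le hi.le, Finset.Ico_eq_empty_of_le (show i + 1 ≤ 0 by omega)]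
    simp

theorem pos_one (g : ℤ → ℝ) : pos g 1 = g 0 := by simpa using pos_succ g 0

theorem int_fun_ext {f h : ℤ → ℝ} (h0 : f 0 = h 0)
    (hs : ∀ i, f (i + 1) - f i = h (i + 1) - h i) : f = h := by
  funext i
  induction i using Int.induction_on with
  | zero => exact h0
  | succ i ih => linarith [hs i]
  | pred i ih =>
    have := hs (-(i : ℤ) - 1)
    rw [sub_add_cancel] at this
    linarith

theorem pos_seqShift (g : ℤ → ℝ) (i j : ℤ) :
    pos (seqShift i g) j = pos g (j + i) - pos g i := by
  have := int_fun_ext (f := pos (seqShift i g)) (h := fun j => pos g (j + i) - pos g i) (by simp)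
    fun k => by
      rw [pos_succ, show k + 1 + i = k + i + 1 by ring, pos_succ]
      simp [seqShift]
  exact congrFun this j

theorem pos_sub (x : ℤ → ℝ) (i : ℤ) : pos (fun k => x (k + 1) - x k) i = x i - x 0 := by
  have := int_fun_ext (f := pos (fun k => x (k + 1) - x k)) (h := fun i => x i - x 0) (by simp)
    fun k => by rw [pos_succ]; ring
  exact congrFun this i

theorem measurable_pos (i : ℤ) : Measurable fun g : ℤ → ℝ => pos g i := by
  unfold pos
  fun_prop

theorem continuous_pos (i : ℤ) : Continuous fun g : ℤ → ℝ => pos g i := by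
  unfold pos
  fun_prop

/-- The gap sequences of configurations. -/
def IsGood (g : ℤ → ℝ) : Prop :=
  (∀ i, 0 < g i) ∧ (∀ a, ∃ i, a < pos g i) ∧ ∀ a, ∃ i, pos g i < a

theorem IsGood.strictMono {g : ℤ → ℝ} (h : IsGood g) : StrictMono (pos g) :=
  strictMono_int_of_lt_succ fun i => by rw [pos_succ]; linarith [h.1 i]

theorem isGood_one : IsGood 1 := by
  have h : ∀ i : ℤ, pos 1 i = i := fun i => by
    have := pos_sub (fun k => (k : ℝ)) i
    simpa [← Pi.one_def] using this
  refine ⟨fun i => by simp, fun a => ?_, fun a => ?_⟩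
  · simpa only [h] using exists_int_gt a
  · simpa only [h] using exists_int_lt a

theorem isGood_of_pos {g : ℤ → ℝ} {x : ℤ → ℝ} (hg : ∀ i, g i = x (i + 1) - x i)
    (hx : StrictMono x) (h1 : ∀ a, ∃ i, a < x i) (h2 : ∀ a, ∃ i, x i < a) : IsGood g := by
  obtain rfl : g = fun i => x (i + 1) - x i := funext hg
  refine ⟨fun i => sub_pos.2 (hx (by omega)), fun a => ?_, fun a => ?_⟩
  · obtain ⟨i, hi⟩ := h1 (a + x 0)
    exact ⟨i, by rw [pos_sub]; linarith⟩
  · obtain ⟨i, hi⟩ := h2 (a + x 0)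
    exact ⟨i, by rw [pos_sub]; linarith⟩

theorem IsGood.seqShift {g : ℤ → ℝ} (h : IsGood g) (i : ℤ) : IsGood (seqShift i g) := by
  refine isGood_of_pos (x := fun j => pos g (j + i)) (fun j => ?_)
    (fun j k hjk => h.strictMono (by omega)) (fun a => ?_) fun a => ?_
  · rw [show j + 1 + i = j + i + 1 by ring, pos_succ]
    simp [_root_.seqShift]
  · obtain ⟨j, hj⟩ := h.2.1 a
    exact ⟨j - i, by simpa using hj⟩
  · obtain ⟨j, hj⟩ := h.2.2 a
    exact ⟨j - i, by simpa using hj⟩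

theorem measurableSet_isGood : MeasurableSet {g : ℤ → ℝ | IsGood g} := by
  have : {g : ℤ → ℝ | IsGood g} = (⋂ i : ℤ, {g | 0 < g i}) ∩
      ((⋂ n : ℕ, ⋃ i : ℤ, {g | (n : ℝ) < pos g i}) ∩ ⋂ n : ℕ, ⋃ i : ℤ, {g | pos g i < -(n : ℝ)}) := by
    ext g
    simp only [IsGood, mem_ofPred_eq, mem_inter_iff, mem_iInter, mem_iUnion]
    refine and_congr_right fun _ => and_congr ?_ ?_
    · refine ⟨fun h n => h n, fun h a => ?_⟩
      obtain ⟨n, hn⟩ := exists_nat_gt a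
      obtain ⟨i, hi⟩ := h n
      exact ⟨i, hn.trans hi⟩
    · refine ⟨fun h n => h _, fun h a => ?_⟩
      obtain ⟨n, hn⟩ := exists_nat_gt (-a)
      obtain ⟨i, hi⟩ := h n
      exact ⟨i, by linarith⟩
  rw [this]
  refine (MeasurableSet.iInter fun i => measurableSet_lt measurable_const
    (measurable_pi_apply i)).inter (MeasurableSet.inter ?_ ?_)
  · exact MeasurableSet.iInter fun n => MeasurableSet.iUnion fun i =>
      measurableSet_lt measurable_const (measurable_pos i)
  · exact MeasurableSet.iInter fun n => MeasurableSet.iUnion fun i =>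
      measurableSet_lt (measurable_pos i) measurable_const

open Classical in
/-- The enumeration with a point at the origin and gaps `g`. -/
def gapEnum (g : ℤ → ℝ) : Config.Enum :=
  -- The unit lattice is a harmless default: every gap law in use is carried by good sequences.
  if h : IsGood g then ⟨pos g, h.strictMono, h.2⟩ else ⟨pos 1, isGood_one.strictMono, isGood_one.2⟩

/-- The configuration with a point at the origin and gaps `g`. -/
def conf (g : ℤ → ℝ) : Config := Config.ofEnum (gapEnum g)

theorem gapEnum_val {g : ℤ → ℝ} (h : IsGood g) : (gapEnum g).1 = pos g := by
  rw [gapEnum, dif_pos h]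

theorem carrier_conf {g : ℤ → ℝ} (h : IsGood g) : (conf g).carrier = range (pos g) := by
  rw [← gapEnum_val h]
  rfl

theorem measurable_conf : Measurable conf := by
  classical
  refine Config.measurable_of_range (ι := ℤ) (fun i g => if IsGood g then pos g i else pos 1 i)
    (fun i => Measurable.ite measurableSet_isGood (measurable_pos i) measurable_const) fun g => ?_
  change range (gapEnum g).1 = _
  unfold gapEnum
  split_ifs <;> rfl

/-! ### Passage between configurations and their gap sequences -/

namespace Config

theorem shift_shift (s r : ℝ) (ξ : Config) : (ξ.shift r).shift s = ξ.shift (s + r) := by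
  ext y
  change y + s + r ∈ ξ.carrier ↔ y + (s + r) ∈ ξ.carrier
  rw [add_assoc]

theorem carrier_shift (s : ℝ) (ξ : Config) : (ξ.shift s).carrier = range fun i => ξ.pt i - s := by
  ext y
  change y + s ∈ ξ.carrier ↔ _
  rw [← ξ.range_pt]
  constructor
  · rintro ⟨i, hi⟩
    exact ⟨i, by simp only [hi]; ring⟩
  · rintro ⟨i, rfl⟩
    exact ⟨i, by ring⟩

theorem pt_shift (ξ : Config) {s : ℝ} {i : ℤ} (h1 : ξ.pt i ≤ s) (h2 : s < ξ.pt (i + 1)) (j : ℤ) :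
    (ξ.shift s).pt j = ξ.pt (j + i) - s := by
  have := (ξ.shift s).pt_eq_of_strictMono (x := fun j => ξ.pt (j + i) - s)
    (fun j k hjk => by simpa using ξ.pt_strictMono (by omega)) ?_ (by simpa using h1)
    (by rw [add_comm]; simpa using h2)
  · rw [this]
  · rw [carrier_shift]
    ext y
    constructor
    · rintro ⟨j, rfl⟩
      exact ⟨j + i, rfl⟩
    · rintro ⟨j, rfl⟩
      exact ⟨j - i, by simp⟩

theorem pt_shift_pt (ξ : Config) (i j : ℤ) :
    (ξ.shift (ξ.pt i)).pt j = ξ.pt (j + i) - ξ.pt i :=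
  ξ.pt_shift le_rfl (ξ.pt_strictMono (by omega)) j

theorem isGood_gap (ξ : Config) : IsGood ξ.gap :=
  isGood_of_pos (fun _ => rfl) ξ.pt_strictMono ξ.enum.2.2.1 ξ.enum.2.2.2

theorem pos_gap (ξ : Config) (i : ℤ) : pos ξ.gap i = ξ.pt i - ξ.pt 0 := pos_sub ξ.pt i

theorem conf_gap {ξ : Config} (h : ξ.pt 0 = 0) : conf ξ.gap = ξ := by
  ext y
  rw [carrier_conf ξ.isGood_gap, ← ξ.range_pt, show pos ξ.gap = ξ.pt by
    funext i; rw [pos_gap, h, sub_zero]]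

theorem existsUnique_pt_mem (ξ : Config) (r : ℝ) : ∃! i, r ∈ Ico (ξ.pt i) (ξ.pt (i + 1)) := by
  have h := (ξ.shift r).pt_zero_le
  have h' := (ξ.shift r).pt_one_pos
  have hr : ∀ j, ∃ i, ξ.pt i - r = (ξ.shift r).pt j := fun j => by
    have : (ξ.shift r).pt j ∈ (ξ.shift r).carrier := by
      rw [← (ξ.shift r).range_pt]; exact mem_range_self j
    rwa [carrier_shift] at this
  obtain ⟨i, hi⟩ := hr 0
  obtain ⟨k, hk⟩ := hr 1
  obtain ⟨m, hm, hmax⟩ := Int.exists_greatest_of_bdd (P := fun j : ℤ => ξ.pt j ≤ r)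
    ⟨k, fun z hz => (ξ.pt_strictMono.lt_iff_lt.1 (by linarith)).le⟩ ⟨i, by linarith⟩
  refine ⟨m, ⟨hm, ?_⟩, fun j hj => ?_⟩
  · by_contra hlt
    have := hmax (m + 1) (not_lt.1 hlt)
    omega
  · refine le_antisymm (hmax j hj.1) ?_
    have := ξ.pt_strictMono.lt_iff_lt.1 (hm.trans_lt hj.2)
    omega

end Config

theorem pt_conf {g : ℤ → ℝ} (h : IsGood g) : (conf g).pt = pos g :=
  (conf g).pt_eq_of_strictMono h.strictMono (carrier_conf h).symm (by simp)
    (by rw [pos_one]; exact h.1 0)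

theorem conf_seqShift {g : ℤ → ℝ} (h : IsGood g) (i : ℤ) :
    conf (seqShift i g) = (conf g).shift (pos g i) := by
  have h2 : (conf g).shift (pos g i) = conf ((conf g).shift (pos g i)).gap := by
    refine (Config.conf_gap ?_).symm
    have := (conf g).pt_shift_pt i 0
    rw [pt_conf h] at this
    simpa using this
  rw [h2]
  congr 1
  funext j
  have := (conf g).pt_shift_pt i
  rw [pt_conf h] at this
  rw [Config.gap, this, this, show j + 1 + i = j + i + 1 by ring, pos_succ]
  simp [seqShift]

theorem tsum_indicator_eq_one {ι : Type*} {p : ι → Prop} {f : ι → ℝ≥0∞} (h : ∃! i, p i)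
    (h1 : ∀ i, p i → f i = 1) (h0 : ∀ i, ¬ p i → f i = 0) : ∑' i, f i = 1 := by
  obtain ⟨i, hi, hu⟩ := h
  rw [tsum_eq_single i fun j hj => h0 j fun hp => hj (hu j hp), h1 i hi]

theorem IsGood.tsum_tile {g : ℤ → ℝ} (h : IsGood g) (s : ℝ) :
    ∑' i, (Ico (pos g i) (pos g (i + 1))).indicator (1 : ℝ → ℝ≥0∞) s = 1 := by
  have := (conf g).existsUnique_pt_mem s
  rw [pt_conf h] at this
  exact tsum_indicator_eq_one this (fun i hi => indicator_of_mem hi _)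
    fun i hi => indicator_of_notMem hi _

/-! ### Mass transport -/

section MassTransport

variable {E : Type*} [MeasurableSpace E] {ρ : Measure E} {T : ℤ → E → E}
  {p : ℤ → E → ℝ}

/-- The change of base point `e ↦ T i e` together with the translation of `s` by `p i e` preserves
`ρ` times Lebesgue measure, and `hTT` and `hpT` say that the index `-i` undoes it. Mass sent and
mass received agree term by term. -/
theorem lintegral_mass_transport (hT : ∀ i, MeasurePreserving (T i) ρ ρ)
    (hTT : ∀ i e, T (-i) (T i e) = e) (hp : ∀ i, Measurable (p i))
    (hpT : ∀ i e, p (-i) (T i e) = -p i e) {a b : E × ℝ → ℝ≥0∞} (ha : Measurable a)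
    (hb : Measurable b) :
    ∑' i, ∫⁻ e, ∫⁻ s, a (e, s) * b (T i e, s - p i e) ∂volume ∂ρ =
      ∑' i, ∫⁻ e, ∫⁻ s, a (T (-i) e, s - p (-i) e) * b (e, s) ∂volume ∂ρ := by
  refine tsum_congr fun i => ?_
  have hm : Measurable fun e => ∫⁻ s, a (T (-i) e, s - p (-i) e) * b (e, s) := by
    refine Measurable.lintegral_prod_right' (f := fun q : E × ℝ =>
      a (T (-i) q.1, q.2 - p (-i) q.1) * b (q.1, q.2)) ?_
    refine (ha.comp ?_).mul hb
    exact ((hT (-i)).measurable.comp measurable_fst).prodMk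
      (measurable_snd.sub ((hp (-i)).comp measurable_fst))
  rw [← (hT i).lintegral_comp hm]
  refine lintegral_congr fun e => ?_
  conv_rhs => rw [← lintegral_sub_right_eq_self _ (p i e)]
  simp only [hTT, hpT, sub_neg_eq_add, sub_add_cancel]

/-- By `hJT`, `J` depends on the location on the line and not on the base point from which it is
described. The functions `a` and `b` are two ways of assigning each location to one base point, and
the integral does not see which is used. This serves both for stationarity and for comparing gaps
before and after a step. -/
theorem lintegral_tiling [SFinite ρ] (hT : ∀ i, MeasurePreserving (T i) ρ ρ)
    (hTT : ∀ i e, T (-i) (T i e) = e) (hp : ∀ i, Measurable (p i))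
    (hpT : ∀ i e, p (-i) (T i e) = -p i e) {a b J : E × ℝ → ℝ≥0∞} (ha : Measurable a)
    (hb : Measurable b) (hJ : Measurable J)
    (hJT : ∀ᵐ e ∂ρ, ∀ i s, J (T i e, s - p i e) = J (e, s))
    (ha1 : ∀ᵐ e ∂ρ, ∀ s, ∑' i, a (T i e, s - p i e) = 1)
    (hb1 : ∀ᵐ e ∂ρ, ∀ s, ∑' i, b (T i e, s - p i e) = 1) :
    ∫⁻ e, ∫⁻ s, a (e, s) * J (e, s) ∂volume ∂ρ = ∫⁻ e, ∫⁻ s, b (e, s) * J (e, s) ∂volume ∂ρ := by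
  have hm : ∀ {c : E × ℝ → ℝ≥0∞} (i : ℤ), Measurable c →
      Measurable fun q : E × ℝ => c (T i q.1, q.2 - p i q.1) := fun i hc =>
    hc.comp (((hT i).measurable.comp measurable_fst).prodMk
      (measurable_snd.sub ((hp i).comp measurable_fst)))
  -- `J` travels with `b`. On the left the sum over base points removes `b`, on the right it removes
  -- `a`.
  have key := lintegral_mass_transport hT hTT hp hpT ha (hb.mul hJ)
  have h1 : ∑' i, ∫⁻ e, ∫⁻ s, a (e, s) * (b * J) (T i e, s - p i e) ∂volume ∂ρ =
      ∫⁻ e, ∫⁻ s, a (e, s) * J (e, s) ∂volume ∂ρ := by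
    rw [← lintegral_tsum fun i => (Measurable.lintegral_prod_right'
      (f := fun q : E × ℝ => a (q.1, q.2) * (b * J) (T i q.1, q.2 - p i q.1))
      (ha.mul (hm i (hb.mul hJ)))).aemeasurable]
    refine lintegral_congr_ae ?_
    filter_upwards [hJT, hb1] with e hJe hbe
    have hme : ∀ i, Measurable fun s => a (e, s) * (b * J) (T i e, s - p i e) := fun i =>
      (ha.mul (hm i (hb.mul hJ))).comp measurable_prodMk_left
    rw [← lintegral_tsum fun i => (hme i).aemeasurable]
    refine lintegral_congr fun s => ?_
    rw [ENNReal.tsum_mul_left]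
    simp only [Pi.mul_apply, hJe]
    rw [ENNReal.tsum_mul_right, hbe, one_mul]
  have h2 : ∑' i, ∫⁻ e, ∫⁻ s, a (T (-i) e, s - p (-i) e) * (b * J) (e, s) ∂volume ∂ρ =
      ∫⁻ e, ∫⁻ s, b (e, s) * J (e, s) ∂volume ∂ρ := by
    rw [← lintegral_tsum fun i => (Measurable.lintegral_prod_right'
      (f := fun q : E × ℝ => a (T (-i) q.1, q.2 - p (-i) q.1) * (b * J) (q.1, q.2))
      ((hm (-i) ha).mul (hb.mul hJ))).aemeasurable]
    refine lintegral_congr_ae ?_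
    filter_upwards [ha1] with e hae
    have hme : ∀ i, Measurable fun s => a (T (-i) e, s - p (-i) e) * (b * J) (e, s) := fun i =>
      ((hm (-i) ha).mul (hb.mul hJ)).comp measurable_prodMk_left
    rw [← lintegral_tsum fun i => (hme i).aemeasurable]
    refine lintegral_congr fun s => ?_
    rw [ENNReal.tsum_mul_right, show ∑' i, a (T (-i) e, s - p (-i) e) = _ from
      (Equiv.neg ℤ).tsum_eq fun i => a (T i e, s - p i e), hae, one_mul]
    rfl
  exact h1.symm.trans (key.trans h2)

end MassTransport

/-! ### Palm calculus -/

/-- The measures on gap sequences that are laws of the gaps of a unit-intensity Palm shift. -/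
structure IsGapLaw (ν : Measure (ℤ → ℝ)) : Prop where
  isProb : IsProbabilityMeasure ν
  preserving : ∀ i, MeasurePreserving (seqShift i) ν ν
  good : ∀ᵐ g ∂ν, IsGood g
  mean : ∫⁻ g, ENNReal.ofReal (g 0) ∂ν = 1

/-- The law of the stationary point process whose Palm shift has gaps of law `ν`. -/
def invPalm (ν : Measure (ℤ → ℝ)) : Measure Config :=
  ((ν.prod volume).restrict {p | p.2 ∈ Ico 0 (p.1 0)}).map fun p => (conf p.1).shift p.2

theorem measurable_shift_conf : Measurable fun p : (ℤ → ℝ) × ℝ => (conf p.1).shift p.2 :=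
  Config.measurable_shift.comp (measurable_snd.prodMk (measurable_conf.comp measurable_fst))

theorem measurableSet_mem_Ico : MeasurableSet {p : (ℤ → ℝ) × ℝ | p.2 ∈ Ico 0 (p.1 0)} := by
  change MeasurableSet ({p : (ℤ → ℝ) × ℝ | 0 ≤ p.2} ∩ {p | p.2 < p.1 0})
  refine (measurableSet_le measurable_const measurable_snd).inter
    (measurableSet_lt measurable_snd ?_)
  fun_prop

theorem measurable_indicator_Ico {E : Type*} [MeasurableSpace E] {u v : E × ℝ → ℝ}
    (hu : Measurable u) (hv : Measurable v) :
    Measurable fun q : E × ℝ => (Ico (u q) (v q)).indicator (1 : ℝ → ℝ≥0∞) q.2 := by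
  have : (fun q : E × ℝ => (Ico (u q) (v q)).indicator (1 : ℝ → ℝ≥0∞) q.2) =
      ({q | u q ≤ q.2} ∩ {q | q.2 < v q}).indicator 1 := by
    funext q
    simp only [indicator, mem_Ico, mem_inter_iff, mem_ofPred_eq, Pi.one_apply]
  rw [this]
  exact measurable_one.indicator
    ((measurableSet_le hu measurable_snd).inter (measurableSet_lt measurable_snd hv))

theorem lintegral_invPalm (ν : Measure (ℤ → ℝ)) [SFinite ν] {f : Config → ℝ≥0∞}
    (hf : Measurable f) : ∫⁻ ξ, f ξ ∂invPalm ν =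
      ∫⁻ g, ∫⁻ s, (Ico 0 (g 0)).indicator 1 s * f ((conf g).shift s) ∂volume ∂ν := by
  rw [invPalm, lintegral_map hf measurable_shift_conf,
    ← lintegral_indicator measurableSet_mem_Ico, lintegral_prod]
  · refine lintegral_congr fun g => lintegral_congr fun s => ?_
    by_cases h : s ∈ Ico 0 (g 0)
    · rw [indicator_of_mem (show (g, s) ∈ {p : (ℤ → ℝ) × ℝ | p.2 ∈ Ico 0 (p.1 0)} from h),
        indicator_of_mem h]
      simp
    · rw [indicator_of_notMem (show (g, s) ∉ {p : (ℤ → ℝ) × ℝ | p.2 ∈ Ico 0 (p.1 0)} from h),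
        indicator_of_notMem h, zero_mul]
  · exact ((hf.comp measurable_shift_conf).indicator measurableSet_mem_Ico).aemeasurable

theorem lintegral_palm (P : Measure Config) {f : Config → ℝ≥0∞} (hf : Measurable f) :
    ∫⁻ ξ, f ξ ∂palm P = (intensity P)⁻¹ *
      ∑' i, ∫⁻ ξ, (Ioc 0 1).indicator 1 (ξ.pt i) * f (ξ.shift (ξ.pt i)) ∂P := by
  rw [palm, lintegral_smul_measure, lintegral_sum_measure, smul_eq_mul]
  congr 1
  refine tsum_congr fun i => ?_
  have hm : Measurable fun ξ : Config => ξ.shift (ξ.pt i) :=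
    Config.measurable_shift.comp ((Config.measurable_pt i).prodMk measurable_id)
  have hs : MeasurableSet {ξ : Config | ξ.pt i ∈ Ioc (0 : ℝ) 1} :=
    Config.measurable_pt i measurableSet_Ioc
  rw [lintegral_map hf hm, ← lintegral_indicator hs]
  refine lintegral_congr fun ξ => ?_
  by_cases h : ξ.pt i ∈ Ioc (0 : ℝ) 1
  · rw [indicator_of_mem (show ξ ∈ {ξ : Config | ξ.pt i ∈ Ioc (0 : ℝ) 1} from h),
      indicator_of_mem h]
    simp
  · rw [indicator_of_notMem (show ξ ∉ {ξ : Config | ξ.pt i ∈ Ioc (0 : ℝ) 1} from h),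
      indicator_of_notMem h, zero_mul]

theorem intensity_eq_tsum (P : Measure Config) :
    intensity P = ∑' i, ∫⁻ ξ, (Ioc 0 1).indicator 1 (ξ.pt i) ∂P := by
  have hm : ∀ i, Measurable fun ξ : Config => (Ioc (0 : ℝ) 1).indicator (1 : ℝ → ℝ≥0∞) (ξ.pt i) :=
    fun i => (measurable_one.indicator measurableSet_Ioc).comp (Config.measurable_pt i)
  rw [intensity, ← lintegral_tsum fun i => (hm i).aemeasurable]
  refine lintegral_congr fun ξ => ?_
  rw [Config.count_eq_ncard]
  have hf := ξ.finite_pt_mem (Metric.isBounded_Ioc (0 : ℝ) 1)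
  rw [tsum_eq_sum (s := hf.toFinset) (fun i hi => indicator_of_notMem (by simpa using hi) _),
    Finset.sum_congr rfl (g := fun _ => 1)
      (fun i hi => indicator_of_mem (show ξ.pt i ∈ Ioc (0 : ℝ) 1 by simpa using hi) _),
    ncard_eq_toFinset_card _ hf]
  simp

theorem pos_neg_seqShift (i : ℤ) (g : ℤ → ℝ) : pos (seqShift i g) (-i) = -pos g i := by
  rw [pos_seqShift]
  simp

section

variable {ν : Measure (ℤ → ℝ)}

/-- Mass transport from the point that owns the gap of the observer at `s` to each point within
distance one to the right of the observer. Seen from the receiving point, the gaps tile the line, so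
the sum over senders is one, and the observer ranges over `[-1, 0)`, of length one. -/
theorem IsGapLaw.lintegral_palm_sum (hν : IsGapLaw ν) {F : (ℤ → ℝ) → ℝ≥0∞} (hF : Measurable F) :
    ∑' i, ∫⁻ g, ∫⁻ s, (Ico 0 (g 0)).indicator 1 s *
      ((Ioc 0 1).indicator 1 (pos g i - s) * F (seqShift i g)) ∂volume ∂ν = ∫⁻ g, F g ∂ν := by
  have := hν.isProb
  have hb : Measurable fun q : (ℤ → ℝ) × ℝ => (Ioc (0 : ℝ) 1).indicator 1 (-q.2) * F q.1 :=
    ((measurable_one.indicator measurableSet_Ioc).comp measurable_snd.neg).mul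
      (hF.comp measurable_fst)
  have ha : Measurable fun q : (ℤ → ℝ) × ℝ => (Ico 0 (q.1 0)).indicator (1 : ℝ → ℝ≥0∞) q.2 :=
    measurable_indicator_Ico measurable_const (by fun_prop)
  have key := lintegral_mass_transport hν.preserving seqShift_neg_seqShift measurable_pos
    pos_neg_seqShift ha hb
  simp only [neg_sub] at key
  rw [key, ← lintegral_tsum fun i => (Measurable.lintegral_prod_right'
    (f := fun q : (ℤ → ℝ) × ℝ => (Ico 0 (seqShift (-i) q.1 0)).indicator 1 (q.2 - pos q.1 (-i)) *
      ((Ioc 0 1).indicator 1 (-q.2) * F q.1)) ?_).aemeasurable]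
  · refine lintegral_congr_ae ?_
    filter_upwards [hν.good] with g hg
    rw [← lintegral_tsum]
    · have : ∀ s, ∑' i : ℤ, (Ico 0 (seqShift (-i) g 0)).indicator 1 (s - pos g (-i)) *
          ((Ioc (0 : ℝ) 1).indicator 1 (-s) * F g) = (Ico (-1 : ℝ) 0).indicator (fun _ => F g) s := by
        intro s
        rw [ENNReal.tsum_mul_right, show ∑' i : ℤ, (Ico 0 (seqShift (-i) g 0)).indicator (1 : ℝ → ℝ≥0∞)
            (s - pos g (-i)) = _ from (Equiv.neg ℤ).tsum_eq fun i : ℤ =>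
          (Ico 0 (seqShift i g 0)).indicator (1 : ℝ → ℝ≥0∞) (s - pos g i)]
        have h1 : ∑' i : ℤ, (Ico 0 (seqShift i g 0)).indicator (1 : ℝ → ℝ≥0∞) (s - pos g i) = 1 := by
          rw [← hg.tsum_tile s]
          refine tsum_congr fun i => ?_
          simp only [indicator, mem_Ico, sub_nonneg, sub_lt_iff_lt_add, pos_succ, seqShift, zero_add,
            add_comm (pos g i), Pi.one_apply]
        rw [h1, one_mul]
        by_cases hs : s ∈ Ico (-1 : ℝ) 0
        · rw [indicator_of_mem hs, indicator_of_mem (show -s ∈ Ioc (0 : ℝ) 1 from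
            ⟨by linarith [hs.2], by linarith [hs.1]⟩)]
          simp
        · rw [indicator_of_notMem hs, indicator_of_notMem, zero_mul]
          exact fun h => hs ⟨by linarith [h.2], by linarith [h.1]⟩
      simp only [this]
      rw [lintegral_indicator measurableSet_Ico]
      simp
    · intro i
      refine Measurable.aemeasurable ?_
      refine Measurable.mul ?_ (((measurable_one.indicator measurableSet_Ioc).comp
        measurable_neg).mul measurable_const)
      exact (measurable_one.indicator measurableSet_Ico).comp (measurable_id.sub_const _)
  · refine Measurable.mul ?_ hb
    exact ha.comp (((measurable_seqShift (-i)).comp measurable_fst).prodMk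
      (measurable_snd.sub ((measurable_pos (-i)).comp measurable_fst)))

theorem IsGapLaw.lintegral_palm_invPalm_sum (hν : IsGapLaw ν) {f : Config → ℝ≥0∞}
    (hf : Measurable f) :
    ∑' i, ∫⁻ ξ, (Ioc 0 1).indicator 1 (ξ.pt i) * f (ξ.shift (ξ.pt i)) ∂invPalm ν =
      ∫⁻ g, f (conf g) ∂ν := by
  have := hν.isProb
  rw [← hν.lintegral_palm_sum (F := fun g => f (conf g)) (hf.comp measurable_conf)]
  refine tsum_congr fun i => ?_
  rw [lintegral_invPalm]
  · refine lintegral_congr_ae ?_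
    filter_upwards [hν.good] with g hg
    refine lintegral_congr fun s => ?_
    by_cases hs : s ∈ Ico 0 (g 0)
    · have h2 : ∀ j, ((conf g).shift s).pt j = pos g j - s := fun j => by
        have := (conf g).pt_shift (s := s) (i := 0)
        rw [pt_conf hg] at this
        simpa using this (by simpa using hs.1) (by rw [pos_succ]; simpa using hs.2) j
      rw [h2, Config.shift_shift, sub_add_cancel, conf_seqShift hg]
    · rw [indicator_of_notMem hs, zero_mul, zero_mul]
  · refine ((measurable_one.indicator measurableSet_Ioc).comp (Config.measurable_pt i)).mul ?_
    exact hf.comp (Config.measurable_shift.comp ((Config.measurable_pt i).prodMk measurable_id))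

theorem IsGapLaw.intensity_invPalm (hν : IsGapLaw ν) : intensity (invPalm ν) = 1 := by
  have := hν.isProb
  have h := hν.lintegral_palm_invPalm_sum (f := fun _ => 1) measurable_const
  simp only [mul_one, lintegral_const, measure_univ] at h
  rw [intensity_eq_tsum, h]

theorem IsGapLaw.palm_invPalm (hν : IsGapLaw ν) : palm (invPalm ν) = ν.map conf := by
  refine Measure.ext_of_lintegral _ fun f hf => ?_
  rw [lintegral_palm _ hf, hν.intensity_invPalm, inv_one, one_mul,
    hν.lintegral_palm_invPalm_sum hf, lintegral_map hf measurable_conf]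

/-- The total mass is the mean length of the gap at the origin, in which the observer is placed by
Lebesgue measure. -/
theorem IsGapLaw.isProbabilityMeasure_invPalm (hν : IsGapLaw ν) :
    IsProbabilityMeasure (invPalm ν) := by
  have := hν.isProb
  constructor
  have h := lintegral_invPalm ν (f := fun _ => 1) measurable_const
  simp only [lintegral_const, one_mul, mul_one] at h
  rw [h, ← hν.mean]
  refine lintegral_congr fun g => ?_
  rw [lintegral_indicator measurableSet_Ico]
  simp

/-- Translation by `r` replaces the tile `[0, g 0)` by `[r, r + g 0)`, whose translates along the
points again tile the line; `lintegral_tiling` equates the two integrals. -/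
theorem IsGapLaw.stationaryLaw_invPalm (hν : IsGapLaw ν) : StationaryLaw (invPalm ν) := by
  have := hν.isProb
  intro r
  have hr : Measurable (Config.shift r) :=
    Config.measurable_shift.comp (measurable_const.prodMk measurable_id)
  refine Measure.ext_of_lintegral _ fun f hf => ?_
  rw [lintegral_map hf hr, lintegral_invPalm ν (f := fun ξ => f (Config.shift r ξ)) (hf.comp hr),
    lintegral_invPalm ν hf]
  have ha : Measurable fun q : (ℤ → ℝ) × ℝ => (Ico 0 (q.1 0)).indicator (1 : ℝ → ℝ≥0∞) q.2 :=
    measurable_indicator_Ico measurable_const (by fun_prop)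
  have hb : Measurable fun q : (ℤ → ℝ) × ℝ => (Ico 0 (q.1 0)).indicator (1 : ℝ → ℝ≥0∞) (q.2 - r) :=
    ha.comp (measurable_fst.prodMk (measurable_snd.sub_const r))
  have hab1 : ∀ {g : ℤ → ℝ}, IsGood g → ∀ s : ℝ,
      ∑' i, (Ico 0 (seqShift i g 0)).indicator (1 : ℝ → ℝ≥0∞) (s - pos g i) = 1 := by
    intro g hg s
    rw [← hg.tsum_tile s]
    refine tsum_congr fun i => ?_
    simp only [indicator, mem_Ico, sub_nonneg, sub_lt_iff_lt_add, pos_succ, seqShift, zero_add,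
      add_comm (pos g i), Pi.one_apply]
  have key := lintegral_tiling (J := fun q => f ((conf q.1).shift q.2)) hν.preserving
    seqShift_neg_seqShift measurable_pos pos_neg_seqShift ha hb (hf.comp measurable_shift_conf)
    ?_ ?_ ?_
  · rw [key]
    refine lintegral_congr fun g => ?_
    rw [← lintegral_sub_right_eq_self _ r]
    refine lintegral_congr fun s => ?_
    rw [Config.shift_shift]
    simp
  · filter_upwards [hν.good] with g hg i s
    rw [conf_seqShift hg, Config.shift_shift, sub_add_cancel]
  · filter_upwards [hν.good] with g hg s
    exact hab1 hg s
  · filter_upwards [hν.good] with g hg s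
    rw [← hab1 hg (s - r)]
    refine tsum_congr fun i => ?_
    rw [sub_right_comm]

end

theorem measurable_gap_seq : Measurable Config.gap := measurable_pi_iff.2 Config.measurable_gap

theorem palm_ae_pt_zero (P : Measure Config) : ∀ᵐ ξ ∂palm P, ξ.pt 0 = 0 := by
  have hs : MeasurableSet {ξ : Config | ξ.pt 0 ≠ 0} :=
    (measurableSet_eq_fun (Config.measurable_pt 0) measurable_const).compl
  have : ∫⁻ ξ, {ξ : Config | ξ.pt 0 ≠ 0}.indicator 1 ξ ∂palm P = 0 := by
    rw [lintegral_palm P (measurable_one.indicator hs)]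
    have : ∀ i (ξ : Config), {ξ : Config | ξ.pt 0 ≠ 0}.indicator (1 : Config → ℝ≥0∞)
        (ξ.shift (ξ.pt i)) = 0 := fun i ξ => by
      refine indicator_of_notMem ?_ _
      simp [Config.pt_shift_pt]
    simp [this]
  rw [lintegral_indicator_one hs] at this
  exact this

/-- Palm inversion. -/
theorem StationaryLaw.eq_invPalm {P : Measure Config} [IsProbabilityMeasure P]
    (hP : StationaryLaw P) (h1 : intensity P = 1) : P = invPalm ((palm P).map Config.gap) := by
  have hsf : IsProbabilityMeasure (palm P) := by
    constructor
    have := lintegral_palm P (f := fun _ => 1) measurable_const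
    simp only [mul_one, lintegral_const, one_mul] at this
    rw [this, ← intensity_eq_tsum, h1]
    simp
  have := Measure.isProbabilityMeasure_map (μ := palm P) measurable_gap_seq.aemeasurable
  refine Measure.ext_of_lintegral _ fun f hf => ?_
  rw [lintegral_invPalm _ hf]
  have hJ : Measurable fun q : (ℤ → ℝ) × ℝ =>
      (Ico 0 (q.1 0)).indicator 1 q.2 * f ((conf q.1).shift q.2) :=
    (measurable_indicator_Ico measurable_const (by fun_prop)).mul (hf.comp measurable_shift_conf)
  rw [lintegral_map hJ.lintegral_prod_right' measurable_gap_seq]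
  have hfs : Measurable fun q : Config × ℝ => f (q.1.shift q.2) :=
    hf.comp (Config.measurable_shift.comp measurable_swap)
  have hind : ∀ i, Measurable fun q : Config × ℝ =>
      (Ico (q.1.pt i) (q.1.pt (i + 1))).indicator (1 : ℝ → ℝ≥0∞) q.2 := fun i =>
    measurable_indicator_Ico ((Config.measurable_pt i).comp measurable_fst)
      ((Config.measurable_pt (i + 1)).comp measurable_fst)
  have hone : ∀ i, Measurable fun q : Config × ℝ =>
      (Ioc (0 : ℝ) 1).indicator (1 : ℝ → ℝ≥0∞) (q.1.pt i) := fun i =>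
    (measurable_one.indicator measurableSet_Ioc).comp ((Config.measurable_pt i).comp measurable_fst)
  have htile : ∫⁻ ξ, ∫⁻ s, (Ico 0 (ξ.gap 0)).indicator 1 s * f ((conf ξ.gap).shift s) ∂volume ∂palm P =
      ∫⁻ ξ, ∫⁻ s, (Ico 0 (ξ.gap 0)).indicator 1 s * f (ξ.shift s) ∂volume ∂palm P := by
    refine lintegral_congr_ae ?_
    filter_upwards [palm_ae_pt_zero P] with ξ hξ
    rw [Config.conf_gap hξ]
  rw [htile, lintegral_palm P, h1, inv_one, one_mul]
  · have hshift : ∀ (i : ℤ) (ξ : Config), (Ioc (0 : ℝ) 1).indicator (1 : ℝ → ℝ≥0∞) (ξ.pt i) *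
        ∫⁻ s, (Ico 0 ((ξ.shift (ξ.pt i)).gap 0)).indicator 1 s * f ((ξ.shift (ξ.pt i)).shift s) =
        ∫⁻ r, (Ioc (0 : ℝ) 1).indicator (1 : ℝ → ℝ≥0∞) (ξ.pt i) *
          ((Ico (ξ.pt i) (ξ.pt (i + 1))).indicator 1 r * f (ξ.shift r)) := by
      intro i ξ
      rw [lintegral_const_mul]
      · congr 1
        rw [← lintegral_sub_right_eq_self _ (ξ.pt i)]
        refine lintegral_congr fun s => ?_
        rw [Config.shift_shift, sub_add_cancel, Config.gap, Config.pt_shift_pt, Config.pt_shift_pt]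
        simp only [indicator, mem_Ico, sub_nonneg, zero_add, sub_self, sub_zero,
          sub_lt_sub_iff_right, add_comm 1 i, Pi.one_apply]
      · exact ((hind i).mul hfs).comp measurable_prodMk_left
    simp only [hshift]
    have hsubst : ∀ i : ℤ, ∫⁻ ξ, ∫⁻ r, (Ioc (0 : ℝ) 1).indicator (1 : ℝ → ℝ≥0∞) (ξ.pt i) *
          ((Ico (ξ.pt i) (ξ.pt (i + 1))).indicator 1 r * f (ξ.shift r)) ∂volume ∂P =
        ∫⁻ r, ∫⁻ ξ, (Ioc (0 : ℝ) 1).indicator (1 : ℝ → ℝ≥0∞) (ξ.pt i) *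
          ((Ico (ξ.pt i) (ξ.pt (i + 1))).indicator 1 r * f (ξ.shift r)) ∂P := fun i =>
      lintegral_lintegral_swap ((hone i).mul ((hind i).mul hfs)).aemeasurable
    simp only [hsubst]
    have hml : ∀ i : ℤ, Measurable fun r => ∫⁻ ξ, (Ioc (0 : ℝ) 1).indicator (1 : ℝ → ℝ≥0∞) (ξ.pt i) *
        ((Ico (ξ.pt i) (ξ.pt (i + 1))).indicator 1 r * f (ξ.shift r)) ∂P := fun i =>
      Measurable.lintegral_prod_left' ((hone i).mul ((hind i).mul hfs))
    rw [← lintegral_tsum fun i => (hml i).aemeasurable]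
    -- For fixed `r` exactly one index has `r` in its gap, and seen from `r` that point has index
    -- `0`. Stationarity turns the sum into a single term, and the later integration over `r` yields
    -- the length of a unit interval.
    have hcount : ∀ r : ℝ, ∑' i : ℤ, ∫⁻ ξ, (Ioc (0 : ℝ) 1).indicator (1 : ℝ → ℝ≥0∞) (ξ.pt i) *
          ((Ico (ξ.pt i) (ξ.pt (i + 1))).indicator 1 r * f (ξ.shift r)) ∂P =
        ∫⁻ ξ, (Ioc (0 : ℝ) 1).indicator (1 : ℝ → ℝ≥0∞) (ξ.pt 0 + r) * f ξ ∂P := by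
      intro r
      have hmi : ∀ i : ℤ, Measurable fun ξ : Config =>
          (Ioc (0 : ℝ) 1).indicator (1 : ℝ → ℝ≥0∞) (ξ.pt i) *
          ((Ico (ξ.pt i) (ξ.pt (i + 1))).indicator 1 r * f (ξ.shift r)) := fun i =>
        ((hone i).mul ((hind i).mul hfs)).comp measurable_prodMk_right
      rw [← lintegral_tsum fun i => (hmi i).aemeasurable]
      have hr : Measurable (Config.shift r) :=
        Config.measurable_shift.comp (measurable_const.prodMk measurable_id)
      have hm : Measurable fun ξ : Config =>
          (Ioc (0 : ℝ) 1).indicator (1 : ℝ → ℝ≥0∞) (ξ.pt 0 + r) * f ξ :=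
        ((measurable_one.indicator measurableSet_Ioc).comp
          ((Config.measurable_pt 0).add_const r)).mul hf
      conv_rhs => rw [← hP r]
      rw [lintegral_map hm hr]
      refine lintegral_congr fun ξ => ?_
      obtain ⟨i, hi, hu⟩ := ξ.existsUnique_pt_mem r
      rw [tsum_eq_single i fun j hj => by
        rw [indicator_of_notMem (fun h => hj (hu j h)) , zero_mul, mul_zero],
        indicator_of_mem hi, ξ.pt_shift hi.1 hi.2]
      simp
    simp only [hcount]
    rw [lintegral_lintegral_swap]
    · refine lintegral_congr fun ξ => ?_
      have hmr : Measurable fun r : ℝ => (Ioc (0 : ℝ) 1).indicator (1 : ℝ → ℝ≥0∞) (ξ.pt 0 + r) :=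
        (measurable_one.indicator measurableSet_Ioc).comp (measurable_const_add _)
      rw [lintegral_mul_const _ hmr, lintegral_add_left_eq_self
        (fun r => (Ioc (0 : ℝ) 1).indicator (1 : ℝ → ℝ≥0∞) r) (ξ.pt 0),
        lintegral_indicator_one measurableSet_Ioc]
      simp
    · refine Measurable.aemeasurable ?_
      refine Measurable.mul ?_ (hf.comp measurable_snd)
      exact (measurable_one.indicator measurableSet_Ioc).comp
        (((Config.measurable_pt 0).comp measurable_snd).add measurable_fst)
  · refine Measurable.lintegral_prod_right' (f := fun q : Config × ℝ =>
      (Ico 0 (q.1.gap 0)).indicator 1 q.2 * f (q.1.shift q.2)) ?_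
    exact (measurable_indicator_Ico measurable_const
      ((Config.measurable_gap 0).comp measurable_fst)).mul hfs


/-! ### Occupied midpoints -/

/-- The midpoint of the `i`-th gap receives a point. -/
def Occ (d : ℤ → Bool) (i : ℤ) : Prop := d i = true ∨ d (i + 1) = false

/-- The first occupied midpoint to the right of the `i`-th one. -/
def nxt (d : ℤ → Bool) (i : ℤ) : ℤ := if d (i + 1) = false ∧ d (i + 2) = true then i + 2 else i + 1

/-- The first occupied midpoint to the left of the `i`-th one. -/
def prv (d : ℤ → Bool) (i : ℤ) : ℤ := if d (i - 1) = false ∧ d i = true then i - 2 else i - 1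

/-- Two adjacent midpoints cannot both be empty, because the point between them lands on one of
them. Hence the next occupied midpoint is at most two places away. -/
theorem occ_nxt (d : ℤ → Bool) (i : ℤ) : Occ d (nxt d i) := by
  unfold Occ nxt
  split_ifs with h
  · exact Or.inl h.2
  · rw [show i + 1 + 1 = i + 2 by ring]
    cases h1 : d (i + 1) <;> cases h2 : d (i + 2) <;> simp_all

theorem occ_prv (d : ℤ → Bool) (i : ℤ) : Occ d (prv d i) := by
  unfold Occ prv
  split_ifs with h
  · rw [show i - 2 + 1 = i - 1 by ring]
    exact Or.inr h.1
  · rw [show i - 1 + 1 = i by ring]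
    cases h1 : d (i - 1) <;> cases h2 : d i <;> simp_all

theorem nxt_prv {d : ℤ → Bool} {i : ℤ} (h : Occ d i) : nxt d (prv d i) = i := by
  unfold prv
  split_ifs with h1
  · rw [nxt, if_pos]
    · ring
    · rw [show i - 2 + 1 = i - 1 by ring, show i - 2 + 2 = i by ring]
      exact h1
  · rw [nxt, if_neg]
    · ring
    · rw [show i - 1 + 1 = i by ring, show i - 1 + 2 = i + 1 by ring]
      rintro ⟨h2, h3⟩
      rcases h with h | h <;> simp_all

theorem prv_nxt {d : ℤ → Bool} {i : ℤ} (h : Occ d i) : prv d (nxt d i) = i := by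
  unfold nxt
  split_ifs with h1
  · rw [prv, if_pos]
    · ring
    · rw [show i + 2 - 1 = i + 1 by ring]
      exact h1
  · rw [prv, if_neg]
    · ring
    · rw [show i + 1 - 1 = i by ring]
      rintro ⟨h2, h3⟩
      rcases h with h | h <;> simp_all

theorem lt_nxt (d : ℤ → Bool) (i : ℤ) : i < nxt d i := by
  unfold nxt; split_ifs <;> omega

theorem nxt_le (d : ℤ → Bool) (i : ℤ) : nxt d i ≤ i + 2 := by
  unfold nxt; split_ifs <;> omega

theorem occ_seqShift (d : ℤ → Bool) (n i : ℤ) : Occ (seqShift n d) i ↔ Occ d (i + n) := by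
  unfold Occ seqShift
  rw [show i + 1 + n = i + n + 1 by ring]

theorem nxt_seqShift (d : ℤ → Bool) (n i : ℤ) : nxt (seqShift n d) i = nxt d (i + n) - n := by
  unfold nxt seqShift
  rw [show i + 1 + n = i + n + 1 by ring, show i + 2 + n = i + n + 2 by ring]
  split_ifs <;> ring

theorem prv_seqShift (d : ℤ → Bool) (n i : ℤ) : prv (seqShift n d) i = prv d (i + n) - n := by
  unfold prv seqShift
  rw [show i - 1 + n = i + n - 1 by ring]
  split_ifs <;> ring

theorem measurableSet_coin (i : ℤ) (b : Bool) : MeasurableSet {d : ℤ → Bool | d i = b} :=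
  measurable_pi_apply (X := fun _ : ℤ => Bool) i (measurableSet_singleton b)

theorem measurableSet_occ (i : ℤ) : MeasurableSet {d : ℤ → Bool | Occ d i} :=
  (measurableSet_coin i true).union (measurableSet_coin (i + 1) false)

theorem measurable_nxt (i : ℤ) : Measurable fun d : ℤ → Bool => nxt d i :=
  Measurable.ite ((measurableSet_coin (i + 1) false).inter (measurableSet_coin (i + 2) true))
    measurable_const measurable_const

theorem measurable_prv (i : ℤ) : Measurable fun d : ℤ → Bool => prv d i :=
  Measurable.ite ((measurableSet_coin (i - 1) false).inter (measurableSet_coin i true))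
    measurable_const measurable_const

/-- The enumeration of the occupied midpoints, if the midpoint `0` is occupied. -/
def idx (d : ℤ → Bool) : ℤ → ℤ
  | .ofNat n => (nxt d)^[n] 0
  | .negSucc n => (prv d)^[n + 1] 0

@[simp]
theorem idx_zero (d : ℤ → Bool) : idx d 0 = 0 := rfl

theorem idx_natCast (d : ℤ → Bool) (n : ℕ) : idx d n = (nxt d)^[n] 0 := rfl

theorem idx_neg_natCast (d : ℤ → Bool) (n : ℕ) : idx d (-n) = (prv d)^[n] 0 := by
  cases n <;> rfl

theorem occ_idx {d : ℤ → Bool} (h : Occ d 0) (k : ℤ) : Occ d (idx d k) := by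
  obtain ⟨n, rfl | rfl⟩ := k.eq_nat_or_neg
  · rw [idx_natCast]
    cases n with
    | zero => exact h
    | succ n => rw [Function.iterate_succ_apply']; exact occ_nxt _ _
  · rw [idx_neg_natCast]
    cases n with
    | zero => exact h
    | succ n => rw [Function.iterate_succ_apply']; exact occ_prv _ _

theorem idx_succ {d : ℤ → Bool} (h : Occ d 0) (k : ℤ) : idx d (k + 1) = nxt d (idx d k) := by
  obtain ⟨n, rfl | rfl⟩ := k.eq_nat_or_neg
  · rw [show (n : ℤ) + 1 = ((n + 1 : ℕ) : ℤ) by push_cast; rfl, idx_natCast, idx_natCast,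
      Function.iterate_succ_apply']
  · cases n with
    | zero => rfl
    | succ n =>
      have h2 : idx d (-((n + 1 : ℕ) : ℤ)) = prv d (idx d (-(n : ℤ))) := by
        rw [idx_neg_natCast, idx_neg_natCast, Function.iterate_succ_apply']
      rw [h2, nxt_prv (occ_idx h _)]
      congr 1
      push_cast
      ring

theorem idx_strictMono {d : ℤ → Bool} (h : Occ d 0) : StrictMono (idx d) :=
  strictMono_int_of_lt_succ fun k => by rw [idx_succ h]; exact lt_nxt _ _

/-- The enumeration is unbounded in both directions and skips nothing occupied: a step of two is
taken only over an empty midpoint. -/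
theorem exists_idx_eq {d : ℤ → Bool} (h : Occ d 0) {j : ℤ} (hj : Occ d j) : ∃ k, idx d k = j := by
  have hm := idx_strictMono h
  have hub : ∀ n : ℕ, (n : ℤ) ≤ idx d n := fun n => by
    induction n with
    | zero => simp
    | succ n ih =>
      have := hm (show (n : ℤ) < (n + 1 : ℕ) by push_cast; omega)
      push_cast at *
      omega
  have hlb : ∀ n : ℕ, idx d (-(n : ℤ)) ≤ -n := fun n => by
    induction n with
    | zero => simp
    | succ n ih =>
      have := hm (show (-((n + 1 : ℕ) : ℤ)) < -(n : ℤ) by push_cast; omega)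
      push_cast at *
      omega
  obtain ⟨m, hm1, hmax⟩ := Int.exists_greatest_of_bdd (P := fun k : ℤ => idx d k ≤ j)
    ⟨(j.toNat + 1 : ℕ), fun z hz => by
      by_contra hlt
      have h1 := hm (not_le.1 hlt)
      have h2 := hub (j.toNat + 1)
      push_cast at h1 h2
      omega⟩
    ⟨-((-j).toNat : ℤ), by have := hlb (-j).toNat; omega⟩
  refine ⟨m, ?_⟩
  have h1 : j < idx d (m + 1) := by
    by_contra hlt
    have := hmax (m + 1) (not_lt.1 hlt)
    omega
  rw [idx_succ h] at h1
  by_contra hne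
  have h2 := nxt_le d (idx d m)
  have h3 : j = idx d m + 1 := by omega
  unfold nxt at h1
  split_ifs at h1 with h4
  · rw [h3] at hj
    unfold Occ at hj
    rw [show idx d m + 1 + 1 = idx d m + 2 by ring] at hj
    rcases hj with hj | hj <;> simp_all
  · omega

theorem measurable_idx (k : ℤ) : Measurable fun d : ℤ → Bool => idx d k := by
  have hc : ∀ {F : (ℤ → Bool) → ℤ → ℤ}, (∀ i, Measurable fun d => F d i) → ∀ n : ℕ,
      Measurable fun d => (F d)^[n] 0 := by
    intro F hF n
    induction n with
    | zero => exact measurable_const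
    | succ n ih =>
      simp only [Function.iterate_succ_apply']
      exact (measurable_from_prod_countable_left (f := fun p : (ℤ → Bool) × ℤ => F p.1 p.2) hF).comp
        (measurable_id.prodMk ih)
  obtain ⟨n, rfl | rfl⟩ := k.eq_nat_or_neg
  · simp only [idx_natCast]
    exact hc measurable_nxt n
  · simp only [idx_neg_natCast]
    exact hc measurable_prv n

theorem idx_seqShift {d : ℤ → Bool} (h : Occ d 0) (k : ℤ) :
    idx (seqShift (nxt d 0) d) k = idx d (k + 1) - nxt d 0 := by
  have h' : Occ (seqShift (nxt d 0) d) 0 := by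
    rw [occ_seqShift, zero_add]
    exact occ_nxt _ _
  induction k using Int.induction_on with
  | zero => rw [idx_succ h]; simp
  | succ k ih => rw [idx_succ h', ih, nxt_seqShift, idx_succ h (k + 1)]; simp
  | pred k ih =>
    have e1 : prv (seqShift (nxt d 0) d) (idx (seqShift (nxt d 0) d) (-k)) =
        idx (seqShift (nxt d 0) d) (-k - 1) := by
      conv_lhs => rw [show -(k : ℤ) = -k - 1 + 1 by ring, idx_succ h']
      exact prv_nxt (occ_idx h' _)
    have e2 : prv d (idx d (-k + 1)) = idx d (-k - 1 + 1) := by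
      conv_lhs => rw [show -(k : ℤ) + 1 = -k - 1 + 1 + 1 by ring, idx_succ h]
      exact prv_nxt (occ_idx h _)
    rw [← e1, ih, prv_seqShift, sub_add_cancel, e2]

/-! ### The action of one step on gaps -/

/-- The midpoint of the `i`-th gap. -/
def mid (g : ℤ → ℝ) (i : ℤ) : ℝ := (pos g i + pos g (i + 1)) / 2

theorem mid_succ (g : ℤ → ℝ) (i : ℤ) : mid g (i + 1) = mid g i + (g i + g (i + 1)) / 2 := by
  unfold mid
  rw [pos_succ g (i + 1), pos_succ g i]
  ring

theorem mid_sub (g : ℤ → ℝ) {m n : ℤ} (h : m ≤ n) : mid g n - mid g m =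
    (∑ j ∈ Finset.Ico m n, g j + ∑ j ∈ Finset.Ico m n, g (j + 1)) / 2 := by
  induction n, h using Int.leInduction with
  | base => simp
  | succ n hn ih =>
    rw [← Finset.insert_Ico_right_eq_Ico_add_one hn, Finset.sum_insert (by simp),
      Finset.sum_insert (by simp), mid_succ]
    linarith

theorem mid_seqShift (g : ℤ → ℝ) (n i : ℤ) :
    mid (seqShift n g) i = mid g (i + n) - pos g n := by
  unfold mid
  rw [pos_seqShift, pos_seqShift, show i + 1 + n = i + n + 1 by ring]
  ring

theorem measurable_mid (i : ℤ) : Measurable fun g : ℤ → ℝ => mid g i :=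
  ((measurable_pos i).add (measurable_pos (i + 1))).div_const 2

theorem measurable_mid_comp {α : Type*} [MeasurableSpace α] {u : α → ℤ → ℝ} {v : α → ℤ}
    (hu : Measurable u) (hv : Measurable v) : Measurable fun a => mid (u a) (v a) := by
  have h0 : Measurable fun p : (ℤ → ℝ) × ℤ => mid p.1 p.2 :=
    measurable_from_prod_countable_left fun i => measurable_mid i
  have h := h0.comp (hu.prodMk hv)
  simp only [Function.comp_def] at h
  exact h

theorem continuous_mid (i : ℤ) : Continuous fun g : ℤ → ℝ => mid g i :=
  ((continuous_pos i).add (continuous_pos (i + 1))).div_const 2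

/-- The gaps after one step. -/
def newgap (g : ℤ → ℝ) (d : ℤ → Bool) (k : ℤ) : ℝ :=
  3 / 4 * (mid g (idx d (k + 1)) - mid g (idx d k))

theorem measurable_newgap : Measurable fun p : (ℤ → ℝ) × (ℤ → Bool) => newgap p.1 p.2 := by
  refine measurable_pi_iff.2 fun k => ?_
  have h : ∀ k, Measurable fun p : (ℤ → ℝ) × (ℤ → Bool) => mid p.1 (idx p.2 k) := fun k =>
    measurable_mid_comp measurable_fst ((measurable_idx k).comp measurable_snd)
  simp only [newgap]
  exact ((h (k + 1)).sub (h k)).const_mul _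

theorem continuous_newgap (d : ℤ → Bool) : Continuous fun g : ℤ → ℝ => newgap g d :=
  continuous_pi fun _ => ((continuous_mid _).sub (continuous_mid _)).const_mul _

theorem pos_add (g h : ℤ → ℝ) (i : ℤ) : pos (g + h) i = pos g i + pos h i := by
  simp only [pos, Pi.add_apply, Finset.sum_add_distrib]
  ring

theorem pos_smul (c : ℝ) (g : ℤ → ℝ) (i : ℤ) : pos (c • g) i = c * pos g i := by
  simp only [pos, Pi.smul_apply, smul_eq_mul, ← Finset.mul_sum]
  ring

/-- Linearity for fixed directions is what allows centred sequences and differences of evolutions to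
be followed by the same random maps. -/
theorem newgap_add (g h : ℤ → ℝ) (d : ℤ → Bool) : newgap (g + h) d = newgap g d + newgap h d := by
  funext k
  simp only [newgap, mid, pos_add, Pi.add_apply]
  ring

theorem newgap_smul (c : ℝ) (g : ℤ → ℝ) (d : ℤ → Bool) : newgap (c • g) d = c • newgap g d := by
  funext k
  simp only [newgap, mid, pos_smul, Pi.smul_apply, smul_eq_mul]
  ring

theorem pos_newgap (g : ℤ → ℝ) (d : ℤ → Bool) (k : ℤ) :
    pos (newgap g d) k = 3 / 4 * (mid g (idx d k) - mid g 0) := by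
  have h : newgap g d = (3 / 4 : ℝ) • fun k => mid g (idx d (k + 1)) - mid g (idx d k) := by
    funext k
    simp [newgap]
  rw [h, pos_smul, pos_sub (fun k => mid g (idx d k)), idx_zero]

/-- Passing to the next new point is a shift of the old gaps and coins by the random amount `nxt d
0`; stationarity of the new gaps is derived from this. -/
theorem seqShift_newgap (g : ℤ → ℝ) {d : ℤ → Bool} (h : Occ d 0) :
    seqShift 1 (newgap g d) = newgap (seqShift (nxt d 0) g) (seqShift (nxt d 0) d) := by
  funext k
  simp only [seqShift, newgap]
  change _ = 3 / 4 * (mid (seqShift (nxt d 0) g) (idx (seqShift (nxt d 0) d) (k + 1)) -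
    mid (seqShift (nxt d 0) g) (idx (seqShift (nxt d 0) d) k))
  rw [idx_seqShift h, idx_seqShift h, mid_seqShift, mid_seqShift]
  simp

theorem IsGood.mid_strictMono {g : ℤ → ℝ} (hg : IsGood g) : StrictMono (mid g) :=
  strictMono_int_of_lt_succ fun i => by
    rw [mid_succ]
    linarith [hg.1 i, hg.1 (i + 1)]

theorem IsGood.pos_le_mid {g : ℤ → ℝ} (hg : IsGood g) (i : ℤ) : pos g i ≤ mid g i := by
  have := pos_succ g i
  have := hg.1 i
  unfold mid
  linarith

theorem IsGood.mid_le_pos {g : ℤ → ℝ} (hg : IsGood g) (i : ℤ) : mid g i ≤ pos g (i + 1) := by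
  have := pos_succ g i
  have := hg.1 i
  unfold mid
  linarith

theorem exists_le_idx {d : ℤ → Bool} (h : Occ d 0) (i : ℤ) : ∃ k, i ≤ idx d k := by
  obtain ⟨k, hk⟩ := exists_idx_eq h (occ_nxt d i)
  exact ⟨k, by rw [hk]; exact (lt_nxt d i).le⟩

theorem exists_idx_le {d : ℤ → Bool} (h : Occ d 0) (i : ℤ) : ∃ k, idx d k ≤ i := by
  obtain ⟨k, hk⟩ := exists_idx_eq h (occ_prv d i)
  refine ⟨k, ?_⟩
  rw [hk, prv]
  split_ifs <;> omega

theorem IsGood.newgap {g : ℤ → ℝ} (hg : IsGood g) {d : ℤ → Bool} (h : Occ d 0) :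
    IsGood (newgap g d) := by
  refine isGood_of_pos (x := fun k => 3 / 4 * mid g (idx d k))
    (fun k => by rw [_root_.newgap]; ring) (fun i j hij => ?_) (fun a => ?_) fun a => ?_
  · have := hg.mid_strictMono (idx_strictMono h hij)
    dsimp only
    linarith
  · obtain ⟨i, hi⟩ := hg.2.1 (4 / 3 * a)
    obtain ⟨k, hk⟩ := exists_le_idx h i
    have := hg.mid_strictMono.monotone hk
    have := hg.pos_le_mid i
    exact ⟨k, by linarith⟩
  · obtain ⟨i, hi⟩ := hg.2.2 (4 / 3 * a)
    obtain ⟨k, hk⟩ := exists_idx_le h (i - 1)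
    have := hg.mid_strictMono.monotone hk
    have := hg.mid_le_pos (i - 1)
    rw [sub_add_cancel] at this
    exact ⟨k, by linarith⟩

theorem moved_conf {g : ℤ → ℝ} (hg : IsGood g) (d : ℤ → Bool) (i : ℤ) :
    (conf g).moved d i = if d i = true then mid g i else mid g (i - 1) := by
  unfold Config.moved mid
  rw [pt_conf hg]
  split_ifs with h
  · rfl
  · rw [sub_add_cancel, add_comm]

theorem range_moved_conf {g : ℤ → ℝ} (hg : IsGood g) (d : ℤ → Bool) :
    range ((conf g).moved d) = mid g '' {i | Occ d i} := by
  ext x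
  constructor
  · rintro ⟨i, rfl⟩
    rw [moved_conf hg]
    split_ifs with h
    · exact ⟨i, Or.inl h, rfl⟩
    · refine ⟨i - 1, Or.inr ?_, rfl⟩
      rw [sub_add_cancel]
      simpa using h
  · rintro ⟨i, h | h, rfl⟩
    · exact ⟨i, by rw [moved_conf hg, if_pos h]⟩
    · refine ⟨i + 1, ?_⟩
      rw [moved_conf hg, if_neg (by simp [h])]
      simp

theorem image_idx {d : ℤ → Bool} (h : Occ d 0) : range (idx d) = {i | Occ d i} := by
  ext i
  constructor
  · rintro ⟨k, rfl⟩
    exact occ_idx h k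
  · exact fun hi => exists_idx_eq h hi

/-- The step applied to the configuration with gaps `g` seen from `s`. -/
def stepFrom (g : ℤ → ℝ) (d : ℤ → Bool) (s : ℝ) : Config :=
  (((conf g).moveMerge d).shift s).scale (3 / 4) (by norm_num)

theorem carrier_stepFrom (g : ℤ → ℝ) (d : ℤ → Bool) (s : ℝ) :
    (stepFrom g d s).carrier = range fun i => 3 / 4 * ((conf g).moved d i - s) := by
  change (fun x => 3 / 4 * x) '' {y | y + s ∈ range ((conf g).moved d)} = _
  ext x
  constructor
  · rintro ⟨y, ⟨i, hi⟩, rfl⟩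
    exact ⟨i, by simp [hi]⟩
  · rintro ⟨i, rfl⟩
    exact ⟨(conf g).moved d i - s, ⟨i, by ring⟩, rfl⟩

/-- The new gaps are normalized to have the occupied midpoint `0` at the origin, whence the offset;
the factor `3 / 4` is the rescaling. -/
theorem conf_newgap_shift {g : ℤ → ℝ} (hg : IsGood g) {d : ℤ → Bool} (h : Occ d 0) (s : ℝ) :
    (conf (newgap g d)).shift (3 / 4 * (s - mid g 0)) = stepFrom g d s := by
  apply Config.ext
  rw [Config.carrier_shift, carrier_stepFrom, pt_conf (hg.newgap h)]
  have h1 : (range fun i => pos (newgap g d) i - 3 / 4 * (s - mid g 0)) =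
      (fun x => 3 / 4 * (x - s)) '' (mid g '' {i | Occ d i}) := by
    rw [← image_idx h, ← range_comp, ← range_comp]
    congr 1
    funext i
    simp only [Function.comp_apply, pos_newgap]
    ring
  rw [h1, ← range_moved_conf hg, ← range_comp]
  rfl

/-- For an observer in the gap at the origin the points keep their indices, so each coin stays
attached to its point. -/
theorem step_conf_shift {g : ℤ → ℝ} (hg : IsGood g) (d : ℤ → Bool) {s : ℝ} (hs : s ∈ Ico 0 (g 0)) :
    ((conf g).shift s).step d = stepFrom g d s := by
  have hpt : ∀ j, ((conf g).shift s).pt j = (conf g).pt j - s := fun j => by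
    have := (conf g).pt_shift (s := s) (i := 0)
    rw [pt_conf hg] at this ⊢
    simpa using this (by simpa using hs.1) (by rw [pos_succ]; simpa using hs.2) j
  apply Config.ext
  rw [carrier_stepFrom]
  change (fun x => 3 / 4 * x) '' range (((conf g).shift s).moved d) = _
  rw [← range_comp]
  congr 1
  funext i
  simp only [Function.comp_apply, Config.moved, hpt]
  ring

/-- The outcome seen from a fixed location is independent of the base point: this is the invariance
needed in `lintegral_tiling`. -/
theorem stepFrom_seqShift {g : ℤ → ℝ} (hg : IsGood g) (d : ℤ → Bool) (s : ℝ) (i : ℤ) :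
    stepFrom (seqShift i g) (seqShift i d) (s - pos g i) = stepFrom g d s := by
  apply Config.ext
  rw [carrier_stepFrom, carrier_stepFrom]
  have : ∀ j, (conf (seqShift i g)).moved (seqShift i d) j = (conf g).moved d (j + i) - pos g i := by
    intro j
    rw [moved_conf (hg.seqShift i), moved_conf hg, mid_seqShift, mid_seqShift]
    simp only [seqShift]
    rw [show j - 1 + i = j + i - 1 by ring]
    by_cases hd : d (j + i) = true <;> simp [hd]
  ext x
  constructor
  · rintro ⟨j, rfl⟩
    exact ⟨j + i, by simp [this]⟩
  · rintro ⟨j, rfl⟩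
    exact ⟨j - i, by simp [this]⟩

theorem measurable_stepFrom :
    Measurable fun q : ((ℤ → ℝ) × (ℤ → Bool)) × ℝ => stepFrom q.1.1 q.1.2 q.2 := by
  refine Config.measurable_of_range (ι := ℤ)
    (fun i q => 3 / 4 * ((conf q.1.1).moved q.1.2 i - q.2)) (fun i => ?_)
    fun q => carrier_stepFrom _ _ _
  refine (Measurable.sub ?_ measurable_snd).const_mul _
  have : (fun q : ((ℤ → ℝ) × (ℤ → Bool)) × ℝ => (conf q.1.1).moved q.1.2 i) = fun q =>
      ((conf q.1.1).pt i +
        if q.1.2 i = true then (conf q.1.1).pt (i + 1) else (conf q.1.1).pt (i - 1)) / 2 := by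
    funext q
    unfold Config.moved
    split_ifs <;> rfl
  rw [this]
  have hm : ∀ j, Measurable fun q : ((ℤ → ℝ) × (ℤ → Bool)) × ℝ => (conf q.1.1).pt j := fun j =>
    (Config.measurable_pt j).comp (measurable_conf.comp (measurable_fst.comp measurable_fst))
  refine ((hm i).add (Measurable.ite ?_ (hm _) (hm _))).div_const _
  exact (measurable_snd.comp measurable_fst) (measurableSet_coin i true)


/-! ### Coins -/

/-- A fair coin. -/
def coin : Measure Bool := (2⁻¹ : ℝ≥0∞) • (Measure.dirac true + Measure.dirac false)

instance : IsProbabilityMeasure coin := by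
  constructor
  simp only [coin, Measure.smul_apply, Measure.add_apply, measure_univ, smul_eq_mul]
  rw [one_add_one_eq_two]
  exact ENNReal.inv_mul_cancel (by simp) (by simp)

theorem coin_map_not : coin.map not = coin := by
  rw [coin, Measure.map_smul, Measure.map_add _ _ measurable_from_top, Measure.map_dirac,
    Measure.map_dirac, add_comm]
  rfl

theorem eq_coin {P : Measure Bool} [IsProbabilityMeasure P] (h : P {true} = 1 / 2) : P = coin := by
  have hf : P {false} = 1 / 2 := by
    have h1 := prob_compl_eq_one_sub (μ := P) (measurableSet_singleton true)
    rw [h, show ({true} : Set Bool)ᶜ = {false} by ext b; cases b <;> simp] at h1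
    rw [h1]
    simp
  refine Measure.ext_of_singleton fun b => ?_
  cases b
  · simp [hf, coin]
  · simp [h, coin]

/-- Independent fair coins indexed by the integers. -/
def coins : Measure (ℤ → Bool) := Measure.infinitePi fun _ => coin

instance : IsProbabilityMeasure coins := inferInstanceAs (IsProbabilityMeasure (Measure.infinitePi _))

theorem infinitePi_const_preserving {ι X : Type*} [MeasurableSpace X] (m : Measure X)
    [IsProbabilityMeasure m] (e : ι ≃ ι) :
    MeasurePreserving (fun x : ι → X => fun i => x (e i)) (Measure.infinitePi fun _ => m)
      (Measure.infinitePi fun _ => m) := by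
  have hm : Measurable (fun x : ι → X => fun i => x (e i)) :=
    measurable_pi_iff.2 fun i => measurable_pi_apply (e i)
  refine ⟨hm, ?_⟩
  have := Measure.infinitePi_map_piCongrLeft (fun _ : ι => m) e.symm
  convert this using 2
  funext x i
  have h2 := MeasurableEquiv.piCongrLeft_apply_apply (β := fun _ => X) e.symm x (e i)
  rw [e.symm_apply_apply] at h2
  exact h2.symm

theorem infinitePi_seqShift_preserving {X : Type*} [MeasurableSpace X] (m : Measure X)
    [IsProbabilityMeasure m] (i : ℤ) : MeasurePreserving (seqShift i)
      (Measure.infinitePi fun _ => m) (Measure.infinitePi fun _ => m) :=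
  infinitePi_const_preserving m (Equiv.addRight i)

theorem coins_seqShift (i : ℤ) : MeasurePreserving (seqShift i) coins coins :=
  infinitePi_seqShift_preserving coin i

/-- Turning over the coin with index `i`. -/
def flipAt (i : ℤ) (d : ℤ → Bool) : ℤ → Bool := fun j => if j = i then !d j else d j

theorem flipAt_flipAt (i : ℤ) (d : ℤ → Bool) : flipAt i (flipAt i d) = d := by
  funext j
  simp only [flipAt]
  split_ifs <;> simp

theorem coins_flip (i : ℤ) : MeasurePreserving (flipAt i) coins coins := by
  have hf : ∀ j : ℤ, Measurable (fun b : Bool => if j = i then !b else b) := fun _ =>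
    measurable_from_top
  refine ⟨measurable_pi_iff.2 fun j => (hf j).comp (measurable_pi_apply j), ?_⟩
  refine (Measure.infinitePi_map_pi (fun _ : ℤ => coin) hf).trans ?_
  unfold coins
  congr 1
  funext j
  split_ifs
  · exact coin_map_not
  · exact Measure.map_id

/-- Turning over coin `i` preserves the measure, leaves `H` alone and exchanges the two outcomes, so
each carries half of the integral. -/
theorem lintegral_coin_flip {i : ℤ} (b : Bool) {H : (ℤ → Bool) → ℝ≥0∞} (hH : Measurable H)
    (hflip : ∀ d, H (flipAt i d) = H d) :
    ∫⁻ d, (if d i = b then H d else 0) ∂coins = 2⁻¹ * ∫⁻ d, H d ∂coins := by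
  have hm : ∀ b, Measurable fun d : ℤ → Bool => if d i = b then H d else 0 := fun b =>
    Measurable.ite (measurableSet_coin i b) hH measurable_const
  have h1 : ∫⁻ d, (if d i = b then H d else 0) ∂coins = ∫⁻ d, (if d i = !b then H d else 0) ∂coins := by
    rw [← (coins_flip i).lintegral_comp (hm b)]
    refine lintegral_congr fun d => ?_
    rw [hflip]
    have : flipAt i d i = !d i := by simp [flipAt]
    rw [this]
    cases b <;> cases d i <;> rfl
  have h2 : ∫⁻ d, H d ∂coins = ∫⁻ d, (if d i = b then H d else 0) ∂coins +
      ∫⁻ d, (if d i = !b then H d else 0) ∂coins := by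
    rw [← lintegral_add_left (hm b)]
    refine lintegral_congr fun d => ?_
    cases b <;> cases d i <;> simp
  rw [h2, ← h1, ← two_mul, ← mul_assoc, ENNReal.inv_mul_cancel (by simp) (by simp), one_mul]

theorem coins_false_true (i : ℤ) : coins {d | d i = false ∧ d (i + 1) = true} = 4⁻¹ := by
  have hs : MeasurableSet {d : ℤ → Bool | d i = false ∧ d (i + 1) = true} :=
    (measurableSet_coin i false).inter (measurableSet_coin (i + 1) true)
  have h1 := lintegral_coin_flip (i := i) false
    (H := fun d => if d (i + 1) = true then 1 else 0)
    (Measurable.ite (measurableSet_coin (i + 1) true) measurable_const measurable_const)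
    fun d => by simp [flipAt]
  have h2 := lintegral_coin_flip (i := i + 1) true (H := fun _ => 1) measurable_const fun _ => rfl
  rw [h2] at h1
  rw [← lintegral_indicator_one hs]
  have h3 : ∀ d : ℤ → Bool, {d : ℤ → Bool | d i = false ∧ d (i + 1) = true}.indicator
      (1 : (ℤ → Bool) → ℝ≥0∞) d = if d i = false then (if d (i + 1) = true then 1 else 0) else 0 := by
    intro d
    simp only [indicator, mem_ofPred_eq, Pi.one_apply]
    split_ifs <;> simp_all
  simp only [h3]
  rw [h1]
  simp only [lintegral_const, measure_univ, mul_one]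
  rw [← ENNReal.mul_inv (by simp) (by simp)]
  norm_num

/-- A midpoint stays empty exactly when both neighbouring points move away from it, with probability
`1 / 4`. The complement `3 / 4` is the intensity after merging. -/
theorem coins_occ : coins {d | Occ d 0} = 3 / 4 := by
  have h : {d : ℤ → Bool | Occ d 0} = {d | d 0 = false ∧ d (0 + 1) = true}ᶜ := by
    ext d
    simp only [Occ, mem_ofPred_eq, mem_compl_iff, zero_add]
    cases d 0 <;> cases d 1 <;> simp
  have hs : MeasurableSet {d : ℤ → Bool | d 0 = false ∧ d (0 + 1) = true} :=
    (measurableSet_coin 0 false).inter (measurableSet_coin (0 + 1) true)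
  rw [h, prob_compl_eq_one_sub hs, coins_false_true,
    ← ENNReal.toReal_eq_toReal_iff' (by simp) (ENNReal.div_ne_top (by simp) (by simp)),
    ENNReal.toReal_sub_of_le (by simp) (by simp)]
  simp only [ENNReal.toReal_one, ENNReal.toReal_inv, ENNReal.toReal_div, ENNReal.toReal_ofNat]
  norm_num

/-- The coins seen from a typical occupied midpoint. -/
def palmCoins : Measure (ℤ → Bool) := (4 / 3 : ℝ≥0∞) • coins.restrict {d | Occ d 0}

theorem four_thirds_mul : (4 / 3 : ℝ≥0∞) * (3 / 4) = 1 := by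
  rw [← ENNReal.toReal_eq_toReal_iff' (ENNReal.mul_ne_top (ENNReal.div_ne_top (by simp) (by simp))
    (ENNReal.div_ne_top (by simp) (by simp))) (by simp)]
  simp

instance : IsProbabilityMeasure palmCoins := by
  constructor
  rw [palmCoins, Measure.smul_apply, Measure.restrict_apply_univ, coins_occ, smul_eq_mul,
    four_thirds_mul]

theorem palmCoins_ae_occ : ∀ᵐ d ∂palmCoins, Occ d 0 :=
  Measure.ae_smul_measure (ae_restrict_mem (measurableSet_occ 0)) _

theorem lintegral_palmCoins (F : (ℤ → Bool) → ℝ≥0∞) : ∫⁻ d, F d ∂palmCoins =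
    4 / 3 * ∫⁻ d, {d | Occ d 0}.indicator F d ∂coins := by
  rw [palmCoins, lintegral_smul_measure, lintegral_indicator (measurableSet_occ 0), smul_eq_mul]

/-- If midpoint `1` is empty then point `1` has moved left, so midpoint `0` is automatically
occupied; the probability is `1 / 4` times the density `4 / 3`. -/
theorem palmCoins_nxt_eq_two : palmCoins {d | nxt d 0 = 2} = 3⁻¹ := by
  have hs : MeasurableSet {d : ℤ → Bool | nxt d 0 = 2} :=
    measurable_nxt 0 (measurableSet_singleton 2)
  rw [palmCoins, Measure.smul_apply, Measure.restrict_apply hs]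
  have : {d : ℤ → Bool | nxt d 0 = 2} ∩ {d | Occ d 0} = {d | d 1 = false ∧ d (1 + 1) = true} := by
    ext d
    simp only [nxt, Occ, mem_inter_iff, mem_ofPred_eq, zero_add]
    norm_num
    tauto
  rw [this, coins_false_true, smul_eq_mul,
    ← ENNReal.toReal_eq_toReal_iff' (ENNReal.mul_ne_top (ENNReal.div_ne_top (by simp) (by simp))
    (by simp)) (by simp)]
  simp
  norm_num

/-! ### The action of one step on laws of gap sequences -/

/-- The law of the gaps after one step, seen from a typical point. -/
def clusterMap (ν : Measure (ℤ → ℝ)) : Measure (ℤ → ℝ) :=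
  (ν.prod palmCoins).map fun p => newgap p.1 p.2

theorem measurePreserving_seqShift_of_one {ν : Measure (ℤ → ℝ)}
    (h : MeasurePreserving (seqShift 1) ν ν) (i : ℤ) : MeasurePreserving (seqShift i) ν ν := by
  have hnat : ∀ n : ℕ, MeasurePreserving (seqShift (n : ℤ)) ν ν := fun n => by
    induction n with
    | zero =>
      convert MeasurePreserving.id ν
      funext g j
      simp [seqShift]
    | succ n ih =>
      convert h.comp ih
      funext g j
      simp only [Function.comp_apply, seqShift_seqShift]
      congr 1
      push_cast
      ring
  obtain ⟨n, rfl | rfl⟩ := i.eq_nat_or_neg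
  · exact hnat n
  · refine ⟨measurable_seqShift _, ?_⟩
    conv_lhs => rw [← (hnat n).map_eq, Measure.map_map (measurable_seqShift _) (measurable_seqShift _)]
    convert Measure.map_id
    funext g
    exact seqShift_neg_seqShift _ g

/-- The joint shift of gaps and coins. -/
def pairShift (i : ℤ) (e : (ℤ → ℝ) × (ℤ → Bool)) : (ℤ → ℝ) × (ℤ → Bool) :=
  Prod.map (seqShift i) (seqShift i) e

section

variable {ν : Measure (ℤ → ℝ)}

instance [IsProbabilityMeasure ν] : IsProbabilityMeasure (clusterMap ν) :=
  Measure.isProbabilityMeasure_map measurable_newgap.aemeasurable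

theorem pairShift_preserving [IsProbabilityMeasure ν]
    (hν : ∀ i, MeasurePreserving (seqShift i) ν ν) (i : ℤ) :
    MeasurePreserving (pairShift i) (ν.prod coins) (ν.prod coins) :=
  (hν i).prod (coins_seqShift i)

theorem lintegral_clusterMap {F : (ℤ → ℝ) → ℝ≥0∞} (hF : Measurable F) :
    ∫⁻ g, F g ∂clusterMap ν =
      4 / 3 * ∫⁻ e, {d | Occ d 0}.indicator (fun d => F (newgap e.1 d)) e.2 ∂ν.prod coins := by
  have hm : Measurable fun e : (ℤ → ℝ) × (ℤ → Bool) =>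
      {d | Occ d 0}.indicator (fun d => F (newgap e.1 d)) e.2 :=
    (hF.comp measurable_newgap).indicator (measurable_snd (measurableSet_occ 0))
  have hm' : Measurable fun e : (ℤ → ℝ) × (ℤ → Bool) => F (newgap e.1 e.2) :=
    hF.comp measurable_newgap
  rw [clusterMap, lintegral_map hF measurable_newgap, lintegral_prod _ hm'.aemeasurable,
    lintegral_prod _ hm.aemeasurable,
    ← lintegral_const_mul _ hm.lintegral_prod_right']
  refine lintegral_congr fun g => ?_
  rw [lintegral_palmCoins]

/-- Moving from an occupied midpoint to the next one is a bijection with inverse `prv`. Once split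
by its length `n`, which is `1` or `2`, it is a deterministic joint shift of gaps and coins, and
that preserves `ν.prod coins`. -/
theorem clusterMap_preserving [IsProbabilityMeasure ν]
    (hν : ∀ i, MeasurePreserving (seqShift i) ν ν) (i : ℤ) :
    MeasurePreserving (seqShift i) (clusterMap ν) (clusterMap ν) := by
  refine measurePreserving_seqShift_of_one ⟨measurable_seqShift 1, ?_⟩ i
  refine Measure.ext_of_lintegral _ fun F hF => ?_
  rw [lintegral_map hF (measurable_seqShift 1), lintegral_clusterMap hF,
    lintegral_clusterMap (F := fun g => F (seqShift 1 g)) (hF.comp (measurable_seqShift 1))]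
  congr 1
  set A : ℤ → Set (ℤ → Bool) := fun n => {d | Occ d 0} ∩ {d | nxt d 0 = n} with hA
  set B : ℤ → Set (ℤ → Bool) := fun n => {d | Occ d 0} ∩ {d | prv d 0 = -n} with hB
  have hAm : ∀ n, MeasurableSet (A n) := fun n =>
    (measurableSet_occ 0).inter (measurable_nxt 0 (measurableSet_singleton n))
  have hBm : ∀ n, MeasurableSet (B n) := fun n =>
    (measurableSet_occ 0).inter (measurable_prv 0 (measurableSet_singleton (-n)))
  have hFm := hF.comp measurable_newgap
  have hFA : ∀ n, Measurable fun e : (ℤ → ℝ) × (ℤ → Bool) => (A n).indicator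
      (fun d => F (newgap (seqShift n e.1) (seqShift n d))) e.2 := fun n =>
    (hFm.comp ((measurable_seqShift n).prodMap (measurable_seqShift n))).indicator
      (measurable_snd (hAm n))
  have hFB : ∀ n, Measurable fun e : (ℤ → ℝ) × (ℤ → Bool) => (B n).indicator
      (fun d => F (newgap e.1 d)) e.2 := fun n => hFm.indicator (measurable_snd (hBm n))
  -- The shift by `n` matches departures of length `n` with arrivals of length `n`.
  have hAB : ∀ (n : ℤ) (d : ℤ → Bool), d ∈ A n ↔ seqShift n d ∈ B n := by
    intro n d
    simp only [hA, hB, mem_inter_iff, mem_ofPred_eq, occ_seqShift, prv_seqShift, zero_add]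
    constructor
    · rintro ⟨h1, rfl⟩
      exact ⟨occ_nxt _ _, by rw [prv_nxt h1]; ring⟩
    · rintro ⟨h1, h2⟩
      have h3 : prv d n = 0 := by omega
      rw [← h3]
      exact ⟨occ_prv _ _, nxt_prv h1⟩
  have hL : ∀ e : (ℤ → ℝ) × (ℤ → Bool),
      {d | Occ d 0}.indicator (fun d => F (seqShift 1 (newgap e.1 d))) e.2 =
      (A 1).indicator (fun d => F (newgap (seqShift 1 e.1) (seqShift 1 d))) e.2 +
      (A 2).indicator (fun d => F (newgap (seqShift 2 e.1) (seqShift 2 d))) e.2 := by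
    rintro ⟨g, d⟩
    by_cases h : Occ d 0
    · rw [indicator_of_mem (show d ∈ {d | Occ d 0} from h), seqShift_newgap g h]
      have h2 : nxt d 0 = 1 ∨ nxt d 0 = 2 := by unfold nxt; split_ifs <;> simp
      rcases h2 with h2 | h2
      · rw [indicator_of_mem (show d ∈ A 1 from ⟨h, h2⟩),
          indicator_of_notMem (fun hd : d ∈ A 2 => by have := hd.2; simp_all), add_zero, h2]
      · rw [indicator_of_mem (show d ∈ A 2 from ⟨h, h2⟩),
          indicator_of_notMem (fun hd : d ∈ A 1 => by have := hd.2; simp_all), zero_add, h2]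
    · rw [indicator_of_notMem (show d ∉ {d | Occ d 0} from h),
        indicator_of_notMem (fun hd : d ∈ A 1 => h hd.1),
        indicator_of_notMem (fun hd : d ∈ A 2 => h hd.1), add_zero]
  have hR : ∀ e : (ℤ → ℝ) × (ℤ → Bool),
      {d | Occ d 0}.indicator (fun d => F (newgap e.1 d)) e.2 =
      (B 1).indicator (fun d => F (newgap e.1 d)) e.2 +
      (B 2).indicator (fun d => F (newgap e.1 d)) e.2 := by
    rintro ⟨g, d⟩
    by_cases h : Occ d 0
    · rw [indicator_of_mem (show d ∈ {d | Occ d 0} from h)]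
      have h2 : prv d 0 = -1 ∨ prv d 0 = -2 := by unfold prv; split_ifs <;> simp
      rcases h2 with h2 | h2
      · rw [indicator_of_mem (show d ∈ B 1 from ⟨h, h2⟩),
          indicator_of_notMem (fun hd : d ∈ B 2 => by have := hd.2; simp_all), add_zero]
      · rw [indicator_of_mem (show d ∈ B 2 from ⟨h, h2⟩),
          indicator_of_notMem (fun hd : d ∈ B 1 => by have := hd.2; simp_all), zero_add]
    · rw [indicator_of_notMem (show d ∉ {d | Occ d 0} from h),
        indicator_of_notMem (fun hd : d ∈ B 1 => h hd.1),
        indicator_of_notMem (fun hd : d ∈ B 2 => h hd.1), add_zero]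
  have hn : ∀ n, ∫⁻ e, (A n).indicator
        (fun d => F (newgap (seqShift n e.1) (seqShift n d))) e.2 ∂ν.prod coins =
      ∫⁻ e, (B n).indicator (fun d => F (newgap e.1 d)) e.2 ∂ν.prod coins := by
    intro n
    rw [← (pairShift_preserving hν n).lintegral_comp (hFB n)]
    refine lintegral_congr fun e => ?_
    by_cases h : e.2 ∈ A n
    · rw [indicator_of_mem h,
        indicator_of_mem (show (pairShift n e).2 ∈ B n from (hAB n e.2).1 h)]
      rfl
    · rw [indicator_of_notMem h, indicator_of_notMem
        (show (pairShift n e).2 ∉ B n from fun h2 => h ((hAB n e.2).2 h2))]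
  simp only [hL, hR]
  rw [lintegral_add_left (hFA 1), lintegral_add_left (hFB 1), hn, hn]

theorem newgap_zero (g : ℤ → ℝ) (d : ℤ → Bool) : newgap g d 0 =
    3 / 8 * (g 0 + g 1) + {d | nxt d 0 = 2}.indicator (fun _ => 3 / 8 * (g 1 + g 2)) d := by
  have h1 : idx d (0 + 1) = nxt d 0 := rfl
  have h2 : nxt d 0 = 1 ∨ nxt d 0 = 2 := by unfold nxt; split_ifs <;> simp
  have e1 : mid g 1 = mid g 0 + (g 0 + g 1) / 2 := by simpa using mid_succ g 0
  have e2 : mid g 2 = mid g 1 + (g 1 + g 2) / 2 := by simpa using mid_succ g 1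
  rw [newgap, h1, idx_zero]
  rcases h2 with h2 | h2
  · rw [indicator_of_notMem (by simp [h2]), h2, e1]
    ring
  · rw [indicator_of_mem (by simpa using h2), h2, e2, e1]
    ring

/-- A new gap spans one midpoint distance, or two with probability `1 / 3`. Each contributes `3 / 4`
of the mean after rescaling, and `(1 + 1 / 3) * (3 / 4) = 1`. -/
theorem lintegral_clusterMap_zero (hν : ∀ i, MeasurePreserving (seqShift i) ν ν)
    (h0 : ∀ᵐ g ∂ν, ∀ i, 0 ≤ g i) :
    ∫⁻ g, ENNReal.ofReal (g 0) ∂clusterMap ν = ∫⁻ g, ENNReal.ofReal (g 0) ∂ν := by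
  have hm : ∀ i : ℤ, ∫⁻ g, ENNReal.ofReal (g i) ∂ν = ∫⁻ g, ENNReal.ofReal (g 0) ∂ν := by
    intro i
    rw [← (hν i).lintegral_comp (f := fun g : ℤ → ℝ => ENNReal.ofReal (g 0)) (by fun_prop)]
    simp [seqShift]
  have hsum : ∀ i j : ℤ, ∫⁻ g, ENNReal.ofReal (3 / 8 * (g i + g j)) ∂ν =
      3 / 4 * ∫⁻ g, ENNReal.ofReal (g 0) ∂ν := by
    intro i j
    have : ∀ᵐ g ∂ν, ENNReal.ofReal (3 / 8 * (g i + g j)) =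
        ENNReal.ofReal (3 / 8) * (ENNReal.ofReal (g i) + ENNReal.ofReal (g j)) := by
      filter_upwards [h0] with g hg
      rw [ENNReal.ofReal_mul (by norm_num), ENNReal.ofReal_add (hg i) (hg j)]
    rw [lintegral_congr_ae this, lintegral_const_mul _ (by fun_prop),
      lintegral_add_left (by fun_prop), hm i, hm j, ← two_mul, ← mul_assoc]
    congr 1
    rw [show (2 : ℝ≥0∞) = ENNReal.ofReal 2 by simp, ← ENNReal.ofReal_mul (by norm_num),
      show (3 / 4 : ℝ≥0∞) = ENNReal.ofReal (3 / 4) by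
        rw [ENNReal.ofReal_div_of_pos (by norm_num)]; simp]
    norm_num
  have hs : MeasurableSet {d : ℤ → Bool | nxt d 0 = 2} :=
    measurable_nxt 0 (measurableSet_singleton 2)
  have hF : Measurable fun g : ℤ → ℝ => ENNReal.ofReal (g 0) := by fun_prop
  have hF' : Measurable fun e : (ℤ → ℝ) × (ℤ → Bool) => ENNReal.ofReal (newgap e.1 e.2 0) :=
    hF.comp measurable_newgap
  rw [clusterMap, lintegral_map hF measurable_newgap, lintegral_prod _ hF'.aemeasurable]
  have key : ∀ᵐ g ∂ν, ∫⁻ d, ENNReal.ofReal (newgap g d 0) ∂palmCoins =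
      ENNReal.ofReal (3 / 8 * (g 0 + g 1)) + 3⁻¹ * ENNReal.ofReal (3 / 8 * (g 1 + g 2)) := by
    filter_upwards [h0] with g hg
    have hg0 := hg 0
    have hg1 := hg 1
    have hg2 := hg 2
    have : ∀ d, ENNReal.ofReal (newgap g d 0) = ENNReal.ofReal (3 / 8 * (g 0 + g 1)) +
        {d | nxt d 0 = 2}.indicator (fun _ => ENNReal.ofReal (3 / 8 * (g 1 + g 2))) d := by
      intro d
      rw [newgap_zero, ENNReal.ofReal_add (by positivity)
        (indicator_nonneg (fun _ _ => by positivity) _)]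
      congr 1
      by_cases hd : d ∈ {d : ℤ → Bool | nxt d 0 = 2}
      · rw [indicator_of_mem hd, indicator_of_mem hd]
      · rw [indicator_of_notMem hd, indicator_of_notMem hd, ENNReal.ofReal_zero]
    simp only [this]
    rw [lintegral_add_left measurable_const, lintegral_indicator_const hs, palmCoins_nxt_eq_two,
      lintegral_const, measure_univ, mul_one, mul_comm (3⁻¹ : ℝ≥0∞)]
  rw [lintegral_congr_ae key, lintegral_add_left (by fun_prop),
    lintegral_const_mul _ (by fun_prop), hsum, hsum, ← mul_assoc, ← add_mul]
  have : (3 / 4 + 3⁻¹ * (3 / 4) : ℝ≥0∞) = 1 := by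
    have e1 : (3 / 4 : ℝ≥0∞) = ENNReal.ofReal (3 / 4) := by
      rw [ENNReal.ofReal_div_of_pos (by norm_num)]; simp
    have e2 : (3⁻¹ : ℝ≥0∞) = ENNReal.ofReal 3⁻¹ := by
      rw [ENNReal.ofReal_inv_of_pos (by norm_num)]; simp
    rw [e1, e2, ← ENNReal.ofReal_mul (by norm_num), ← ENNReal.ofReal_add (by norm_num) (by norm_num)]
    norm_num
  rw [this, one_mul]

end

theorem ae_clusterMap {ν : Measure (ℤ → ℝ)} [IsProbabilityMeasure ν] {p q : (ℤ → ℝ) → Prop}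
    (hp : ∀ᵐ g ∂ν, p g) (hq : MeasurableSet {g | q g})
    (h : ∀ g d, p g → Occ d 0 → q (newgap g d)) : ∀ᵐ g ∂clusterMap ν, q g := by
  rw [clusterMap, ae_map_iff measurable_newgap.aemeasurable hq]
  have h1 : ∀ᵐ e ∂ν.prod palmCoins, p e.1 := Measure.quasiMeasurePreserving_fst.ae hp
  have h2 : ∀ᵐ e ∂ν.prod palmCoins, Occ e.2 0 :=
    Measure.quasiMeasurePreserving_snd.ae palmCoins_ae_occ
  filter_upwards [h1, h2] with e h1 h2 using h _ _ h1 h2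

theorem IsGapLaw.clusterMap {ν : Measure (ℤ → ℝ)} (hν : IsGapLaw ν) : IsGapLaw (clusterMap ν) := by
  have := hν.isProb
  refine ⟨inferInstance, clusterMap_preserving hν.preserving,
    ae_clusterMap hν.good measurableSet_isGood fun g d hg hd => hg.newgap hd, ?_⟩
  rw [lintegral_clusterMap_zero hν.preserving, hν.mean]
  filter_upwards [hν.good] with g hg i using (hg.1 i).le

/-! ### One step of the stationary process as one step of its Palm gaps -/

theorem existsUnique_occ_mem {g : ℤ → ℝ} (hg : IsGood g) (d : ℤ → Bool) (s : ℝ) :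
    ∃! i, Occ d i ∧ s ∈ Ico (mid g i) (mid g (nxt d i)) := by
  have hgm : IsGood fun i => mid g (i + 1) - mid g i :=
    isGood_of_pos (fun _ => rfl) hg.mid_strictMono
      (fun a => by obtain ⟨i, hi⟩ := hg.2.1 a; exact ⟨i, hi.trans_le (hg.pos_le_mid i)⟩)
      fun a => by
        obtain ⟨i, hi⟩ := hg.2.2 a
        have := hg.mid_le_pos (i - 1)
        rw [sub_add_cancel] at this
        exact ⟨i - 1, this.trans_lt hi⟩
  obtain ⟨m, hm, -⟩ := (conf fun i => mid g (i + 1) - mid g i).existsUnique_pt_mem (s - mid g 0)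
  rw [pt_conf hgm, pos_sub, pos_sub] at hm
  have hm1 : mid g m ≤ s := by linarith [hm.1]
  have hm2 : s < mid g (m + 1) := by linarith [hm.2]
  have hmono := hg.mid_strictMono
  -- With `s` between midpoints `m` and `m + 1`, the tile containing it begins at `m`, or at `m - 1`
  -- when midpoint `m` is empty, since a tile covers at most two midpoint distances.
  have huniq : ∀ i, Occ d i → s ∈ Ico (mid g i) (mid g (nxt d i)) →
      i = m ∨ i = m - 1 ∧ d m = false ∧ d (m + 1) = true := by
    intro i _ hi
    have h1 : i < m + 1 := hmono.lt_iff_lt.1 (hi.1.trans_lt hm2)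
    have h2 : m < nxt d i := hmono.lt_iff_lt.1 (hm1.trans_lt hi.2)
    unfold nxt at h2
    split_ifs at h2 with h3
    · by_cases h4 : i = m
      · exact Or.inl h4
      · obtain rfl : i = m - 1 := by omega
        rw [sub_add_cancel, show m - 1 + 2 = m + 1 by ring] at h3
        exact Or.inr ⟨rfl, h3⟩
    · exact Or.inl (by omega)
  by_cases hd : d m = false ∧ d (m + 1) = true
  · refine ⟨m - 1, ⟨Or.inr (by rw [sub_add_cancel]; exact hd.1),
      (hmono.monotone (by omega)).trans hm1, ?_⟩, fun i hi => ?_⟩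
    · rw [nxt, if_pos (by rw [sub_add_cancel, show m - 1 + 2 = m + 1 by ring]; exact hd),
        show m - 1 + 2 = m + 1 by ring]
      exact hm2
    · rcases huniq i hi.1 hi.2 with h | h
      · rw [h] at hi
        rcases hi.1 with h2 | h2 <;> simp_all
      · exact h.1
  · refine ⟨m, ⟨?_, hm1, hm2.trans_le (hmono.monotone (lt_nxt d m))⟩, fun i hi => ?_⟩
    · unfold Occ
      cases h1 : d m <;> cases h2 : d (m + 1) <;> simp_all
    · rcases huniq i hi.1 hi.2 with h | h
      · exact h
      · exact absurd h.2 hd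

/-- The factor `4 / 3` from conditioning on an occupied midpoint cancels the Jacobian `3 / 4` of the
rescaling. -/
theorem lintegral_three_quarters {G : ℝ → ℝ≥0∞} (hG : Measurable G) (c : ℝ) :
    4 / 3 * ∫⁻ u, G u = ∫⁻ s, G (3 / 4 * (s - c)) := by
  have h := lintegral_sub_right_eq_self (μ := volume) (fun s : ℝ => G (3 / 4 * s)) c
  rw [h]
  conv_lhs => rw [← Real.smul_map_volume_mul_left (a := 3 / 4) (by norm_num)]
  rw [lintegral_smul_measure, lintegral_map hG (measurable_const_mul _), smul_eq_mul, ← mul_assoc]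
  have : (4 / 3 : ℝ≥0∞) * ENNReal.ofReal |(3 / 4 : ℝ)| = 1 := by
    rw [abs_of_pos (by norm_num), ENNReal.ofReal_div_of_pos (by norm_num)]
    simpa using four_thirds_mul
  rw [this, one_mul]

theorem newgap_zero_eq (g : ℤ → ℝ) (d : ℤ → Bool) :
    newgap g d 0 = 3 / 4 * (mid g (nxt d 0) - mid g 0) := by
  have h1 : idx d (0 + 1) = nxt d 0 := rfl
  rw [newgap, h1, idx_zero]

/-- The indicator of the part of the line between the midpoint `0`, if occupied, and the next
occupied midpoint. -/
def occTile (q : ((ℤ → ℝ) × (ℤ → Bool)) × ℝ) : ℝ≥0∞ :=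
  {d | Occ d 0}.indicator
    (fun d => (Ico (mid q.1.1 0) (mid q.1.1 (nxt d 0))).indicator (1 : ℝ → ℝ≥0∞) q.2) q.1.2

theorem measurable_occTile : Measurable occTile := by
  have hmn : Measurable fun q : ((ℤ → ℝ) × (ℤ → Bool)) × ℝ => mid q.1.1 (nxt q.1.2 0) :=
    measurable_mid_comp (measurable_fst.comp measurable_fst)
      ((measurable_nxt 0).comp (measurable_snd.comp measurable_fst))
  have hm0 : Measurable fun q : ((ℤ → ℝ) × (ℤ → Bool)) × ℝ => mid q.1.1 0 :=
    (measurable_mid 0).comp (measurable_fst.comp measurable_fst)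
  exact Measurable.indicator (f := fun q : ((ℤ → ℝ) × (ℤ → Bool)) × ℝ =>
      (Ico (mid q.1.1 0) (mid q.1.1 (nxt q.1.2 0))).indicator (1 : ℝ → ℝ≥0∞) q.2)
      (measurable_indicator_Ico hm0 hmn)
      ((measurable_snd.comp measurable_fst) (measurableSet_occ 0))

theorem tsum_occTile {e : (ℤ → ℝ) × (ℤ → Bool)} (hg : IsGood e.1) (s : ℝ) :
    ∑' i, occTile (pairShift i e, s - pos e.1 i) = 1 := by
  have hval : ∀ i, occTile (pairShift i e, s - pos e.1 i) =
      {d | Occ d i}.indicator (fun d => (Ico (mid e.1 i) (mid e.1 (nxt d i))).indicator 1 s)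
        e.2 := by
    intro i
    unfold occTile
    have hiff : (pairShift i e).2 ∈ {d | Occ d 0} ↔ e.2 ∈ {d | Occ d i} := by
      simp only [pairShift, Prod.map_snd, mem_ofPred_eq, occ_seqShift, zero_add]
    by_cases hd : e.2 ∈ {d | Occ d i}
    · rw [indicator_of_mem hd, indicator_of_mem (hiff.2 hd)]
      simp only [pairShift, Prod.map_fst, Prod.map_snd, indicator, nxt_seqShift, mid_seqShift,
        zero_add, mem_Ico, sub_add_cancel, sub_le_sub_iff_right, sub_lt_sub_iff_right,
        Pi.one_apply]
    · rw [indicator_of_notMem hd, indicator_of_notMem fun h => hd (hiff.1 h)]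
  simp only [hval]
  refine tsum_indicator_eq_one (existsUnique_occ_mem hg e.2 s) (fun i hi => ?_) fun i hi => ?_
  · rw [indicator_of_mem (show e.2 ∈ {d | Occ d i} from hi.1), indicator_of_mem hi.2]
    rfl
  · by_cases hd : Occ e.2 i
    · rw [indicator_of_mem (show e.2 ∈ {d | Occ d i} from hd),
        indicator_of_notMem fun h => hi ⟨hd, h⟩]
    · rw [indicator_of_notMem (show e.2 ∉ {d | Occ d i} from hd)]

section

variable {ν : Measure (ℤ → ℝ)}

theorem IsGapLaw.lintegral_step (hν : IsGapLaw ν) {f : Config → ℝ≥0∞} (hf : Measurable f) :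
    ∫⁻ ξ, ∫⁻ d, f (ξ.step d) ∂coins ∂invPalm ν =
      ∫⁻ e, ∫⁻ s, (Ico 0 (e.1 0)).indicator 1 s * f (stepFrom e.1 e.2 s) ∂volume ∂ν.prod coins := by
  have := hν.isProb
  have hfs : Measurable fun p : Config × (ℤ → Bool) => f (p.1.step p.2) :=
    hf.comp Config.measurable_step
  have hm : Measurable fun q : ((ℤ → ℝ) × (ℤ → Bool)) × ℝ =>
      (Ico 0 (q.1.1 0)).indicator (1 : ℝ → ℝ≥0∞) q.2 * f (stepFrom q.1.1 q.1.2 q.2) :=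
    (measurable_indicator_Ico measurable_const (by fun_prop)).mul (hf.comp measurable_stepFrom)
  rw [lintegral_invPalm ν hfs.lintegral_prod_right',
    lintegral_prod _ hm.lintegral_prod_right'.aemeasurable]
  refine lintegral_congr_ae ?_
  filter_upwards [hν.good] with g hg
  have hm1 : Measurable fun q : (ℤ → Bool) × ℝ =>
      (Ico 0 (g 0)).indicator (1 : ℝ → ℝ≥0∞) q.2 * f (stepFrom g q.1 q.2) :=
    hm.comp ((measurable_const.prodMk measurable_fst).prodMk measurable_snd)
  rw [lintegral_lintegral_swap hm1.aemeasurable]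
  refine lintegral_congr fun s => ?_
  by_cases hs : s ∈ Ico 0 (g 0)
  · simp only [indicator_of_mem hs, step_conf_shift hg _ hs, Pi.one_apply, one_mul]
  · simp only [indicator_of_notMem hs, zero_mul, lintegral_const]

/-- An observer placed in the new gap at the origin is, in the old coordinates, an observer between
midpoint `0`, if occupied, and the next occupied midpoint. The integrand is then the one in
`IsGapLaw.lintegral_step`, with another tile. -/
theorem IsGapLaw.lintegral_invPalm_clusterMap (hν : IsGapLaw ν) {f : Config → ℝ≥0∞}
    (hf : Measurable f) : ∫⁻ ξ, f ξ ∂invPalm (_root_.clusterMap ν) =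
      ∫⁻ e, ∫⁻ s, occTile (e, s) * f (stepFrom e.1 e.2 s) ∂volume ∂ν.prod coins := by
  have := hν.isProb
  have hF : Measurable fun g : ℤ → ℝ =>
      ∫⁻ s, (Ico 0 (g 0)).indicator 1 s * f ((conf g).shift s) := by
    refine Measurable.lintegral_prod_right' (f := fun q : (ℤ → ℝ) × ℝ =>
      (Ico 0 (q.1 0)).indicator 1 q.2 * f ((conf q.1).shift q.2)) ?_
    exact (measurable_indicator_Ico measurable_const (by fun_prop)).mul
      (hf.comp measurable_shift_conf)
  have hFn : Measurable fun e : (ℤ → ℝ) × (ℤ → Bool) => {d | Occ d 0}.indicator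
      (fun d => ∫⁻ s, (Ico 0 (newgap e.1 d 0)).indicator 1 s *
        f ((conf (newgap e.1 d)).shift s)) e.2 :=
    (hF.comp measurable_newgap).indicator (measurable_snd (measurableSet_occ 0))
  rw [lintegral_invPalm _ hf, lintegral_clusterMap hF, ← lintegral_const_mul _ hFn]
  have hgood : ∀ᵐ e ∂ν.prod coins, IsGood e.1 := Measure.quasiMeasurePreserving_fst.ae hν.good
  refine lintegral_congr_ae ?_
  filter_upwards [hgood] with e hg
  by_cases hd : Occ e.2 0
  · rw [indicator_of_mem (show e.2 ∈ {d | Occ d 0} from hd)]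
    have hG : Measurable fun s => (Ico 0 (newgap e.1 e.2 0)).indicator (1 : ℝ → ℝ≥0∞) s *
        f ((conf (newgap e.1 e.2)).shift s) :=
      (measurable_one.indicator measurableSet_Ico).mul
        (hf.comp (measurable_shift_conf.comp (measurable_const.prodMk measurable_id)))
    rw [lintegral_three_quarters hG (mid e.1 0)]
    refine lintegral_congr fun s => ?_
    rw [occTile, indicator_of_mem (show e.2 ∈ {d | Occ d 0} from hd), conf_newgap_shift hg hd,
      newgap_zero_eq]
    congr 1
    have h34 : (0 : ℝ) < 3 / 4 := by norm_num
    simp only [indicator, mem_Ico, Pi.one_apply, mul_lt_mul_iff_right₀ h34,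
      mul_nonneg_iff_of_pos_left h34, sub_nonneg, sub_lt_sub_iff_right]
  · rw [indicator_of_notMem (show e.2 ∉ {d | Occ d 0} from hd), mul_zero]
    simp only [occTile, indicator_of_notMem (show e.2 ∉ {d | Occ d 0} from hd), zero_mul,
      lintegral_const]

/-- One step of the dynamics in terms of the Palm shift. -/
theorem IsGapLaw.map_step (hν : IsGapLaw ν) :
    ((invPalm ν).prod coins).map (fun p => p.1.step p.2) = invPalm (_root_.clusterMap ν) := by
  have := hν.isProb
  have := hν.isProbabilityMeasure_invPalm
  refine Measure.ext_of_lintegral _ fun f hf => ?_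
  have hfs : Measurable fun p : Config × (ℤ → Bool) => f (p.1.step p.2) :=
    hf.comp Config.measurable_step
  rw [lintegral_map hf Config.measurable_step, lintegral_prod _ hfs.aemeasurable,
    hν.lintegral_step hf, hν.lintegral_invPalm_clusterMap hf]
  have ha : Measurable fun q : ((ℤ → ℝ) × (ℤ → Bool)) × ℝ =>
      (Ico 0 (q.1.1 0)).indicator (1 : ℝ → ℝ≥0∞) q.2 :=
    measurable_indicator_Ico measurable_const (by fun_prop)
  -- The same function of the location is integrated over the tile between consecutive points and
  -- over the tile between consecutive occupied midpoints.
  refine lintegral_tiling (ρ := ν.prod coins) (T := pairShift) (p := fun i e => pos e.1 i)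
    (pairShift_preserving hν.preserving)
    (fun i e => Prod.ext (seqShift_neg_seqShift i e.1) (seqShift_neg_seqShift i e.2))
    (fun i => (measurable_pos i).comp measurable_fst) (fun i e => pos_neg_seqShift i e.1)
    ha measurable_occTile (hf.comp measurable_stepFrom) ?_ ?_ ?_
  · filter_upwards [Measure.quasiMeasurePreserving_fst.ae hν.good] with e hg i s
    exact congrArg f (stepFrom_seqShift hg e.2 s i)
  · filter_upwards [Measure.quasiMeasurePreserving_fst.ae hν.good] with e hg s
    rw [← hg.tsum_tile s]
    refine tsum_congr fun i => ?_
    simp only [pairShift, Prod.map_fst, indicator, mem_Ico, sub_nonneg, sub_lt_iff_lt_add, pos_succ,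
      seqShift, zero_add, add_comm (pos e.1 i), Pi.one_apply]
  · filter_upwards [Measure.quasiMeasurePreserving_fst.ae hν.good] with e hg s
    exact tsum_occTile hg s

end


/-! ### Quadratic bounds -/

/-- Linear combinations of the coordinates are bounded in `L²` by the `ℓ²` norm of the
coefficients. -/
def SqBound (C : ℝ) (ν : Measure (ℤ → ℝ)) : Prop :=
  -- The coordinates are labelled by an arbitrary type because the contraction argument uses pairs
  -- of a new gap and an old gap inside it.
  ∀ (ι : Type) (s : Finset ι) (J : ι → ℤ) (a : ι → ℝ), InjOn J s →
    ∫⁻ g, ENNReal.ofReal ((∑ x ∈ s, a x * g (J x)) ^ 2) ∂ν ≤ ENNReal.ofReal (C * ∑ x ∈ s, a x ^ 2)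

theorem SqBound.single {C : ℝ} {ν : Measure (ℤ → ℝ)} (h : SqBound C ν) (k : ℤ) :
    ∫⁻ g, ENNReal.ofReal (g k ^ 2) ∂ν ≤ ENNReal.ofReal C := by
  simpa using h Unit {()} (fun _ => k) (fun _ => 1) (by simp)

theorem pos_one_seq (i : ℤ) : pos 1 i = i := by
  have := pos_sub (fun k => (k : ℝ)) i
  simpa [← Pi.one_def] using this

theorem newgap_one (d : ℤ → Bool) (k : ℤ) :
    newgap 1 d k = 3 / 4 * ((idx d (k + 1) : ℝ) - idx d k) := by
  simp only [newgap, mid, pos_one_seq]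
  push_cast
  ring

theorem seqShift_one (i : ℤ) : seqShift i (1 : ℤ → ℝ) = 1 := rfl

theorem dirac_preserving (c : ℝ) (i : ℤ) : MeasurePreserving (seqShift i)
    (Measure.dirac (fun _ : ℤ => c)) (Measure.dirac fun _ : ℤ => c) := by
  refine ⟨measurable_seqShift i, ?_⟩
  rw [Measure.map_dirac' (measurable_seqShift i)]
  rfl

/-- Conservation of the mean, applied to the deterministic unit gaps and carried to index `k` by
stationarity. -/
theorem lintegral_newgap_one (k : ℤ) :
    ∫⁻ d, ENNReal.ofReal (newgap 1 d k) ∂palmCoins = 1 := by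
  have hinv := clusterMap_preserving (dirac_preserving 1)
  have h0 := lintegral_clusterMap_zero (dirac_preserving 1) (by
    rw [ae_dirac_eq]
    exact fun i => zero_le_one)
  have hk : ∫⁻ g, ENNReal.ofReal (g k) ∂clusterMap (Measure.dirac fun _ : ℤ => (1 : ℝ)) =
      ∫⁻ g, ENNReal.ofReal (g 0) ∂clusterMap (Measure.dirac fun _ : ℤ => (1 : ℝ)) := by
    rw [← (hinv k).lintegral_comp (f := fun g : ℤ → ℝ => ENNReal.ofReal (g 0)) (by fun_prop)]
    simp [seqShift]
  rw [h0, lintegral_dirac' _ (by fun_prop), clusterMap,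
    lintegral_map (by fun_prop) measurable_newgap] at hk
  have hm : Measurable fun e : (ℤ → ℝ) × (ℤ → Bool) => ENNReal.ofReal (newgap e.1 e.2 k) :=
    ENNReal.measurable_ofReal.comp ((measurable_pi_apply k).comp measurable_newgap)
  rw [lintegral_prod _ hm.aemeasurable, lintegral_dirac' _ hm.lintegral_prod_right'] at hk
  simp only [ENNReal.ofReal_one] at hk
  exact hk

theorem newgap_eq_sum (g : ℤ → ℝ) {d : ℤ → Bool} (h : Occ d 0) (k : ℤ) : newgap g d k =
    3 / 8 * (∑ j ∈ Finset.Ico (idx d k) (idx d (k + 1)), g j +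
      ∑ j ∈ Finset.Ico (idx d k) (idx d (k + 1)), g (j + 1)) := by
  rw [newgap, mid_sub g ((idx_strictMono h).monotone (by omega))]
  ring

/-- The quadratic bound contracts under the dynamics. -/
theorem SqBound.clusterMap {C : ℝ} (hC : 0 ≤ C) {ν : Measure (ℤ → ℝ)} [IsProbabilityMeasure ν]
    (hν : SqBound C ν) : SqBound (3 / 4 * C) (clusterMap ν) := by
  intro ι s J a hJ
  have hF : Measurable fun g : ℤ → ℝ => ENNReal.ofReal ((∑ x ∈ s, a x * g (J x)) ^ 2) := by
    fun_prop
  have hF' : Measurable fun e : (ℤ → ℝ) × (ℤ → Bool) =>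
      ENNReal.ofReal ((∑ x ∈ s, a x * newgap e.1 e.2 (J x)) ^ 2) := hF.comp measurable_newgap
  rw [_root_.clusterMap, lintegral_map hF measurable_newgap, lintegral_prod_symm _ hF'.aemeasurable]
  have key : ∀ᵐ d ∂palmCoins,
      ∫⁻ g, ENNReal.ofReal ((∑ x ∈ s, a x * newgap g d (J x)) ^ 2) ∂ν ≤
        ∑ x ∈ s, ENNReal.ofReal (3 / 4 * C * a x ^ 2) * ENNReal.ofReal (newgap 1 d (J x)) := by
    filter_upwards [palmCoins_ae_occ] with d hd
    have hmono := idx_strictMono hd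
    -- The blocks of old indices belonging to different new gaps are disjoint, so the pairs in `t`
    -- label distinct old gaps and the bound for `ν` applies to them.
    set t : Finset (Σ _ : ι, ℤ) := s.sigma fun x => Finset.Ico (idx d (J x)) (idx d (J x + 1)) with ht
    have hinj : InjOn (fun y : Σ _ : ι, ℤ => y.2) (t : Set (Σ _ : ι, ℤ)) := by
      rintro ⟨x, j⟩ hx ⟨x', j'⟩ hx' hjj
      simp only at hjj
      subst hjj
      simp only [ht, Finset.coe_sigma, mem_sigma_iff, Finset.mem_coe, Finset.mem_Ico] at hx hx'
      have h1 : J x < J x' + 1 := hmono.lt_iff_lt.1 (hx.2.1.trans_lt hx'.2.2)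
      have h2 : J x' < J x + 1 := hmono.lt_iff_lt.1 (hx'.2.1.trans_lt hx.2.2)
      have h3 : x = x' := hJ hx.1 hx'.1 (by omega)
      rw [h3]
    have hinj2 : InjOn (fun y : Σ _ : ι, ℤ => y.2 + 1) (t : Set (Σ _ : ι, ℤ)) := fun y hy y' hy' h =>
      hinj hy hy' (by simpa using h)
    -- A block has `4 / 3 * newgap 1 d (J x)` elements. With `9 / 32` from the pointwise estimate
    -- and two sums this gives `9 / 32 * 2 * (4 / 3) = 3 / 4`, times a lattice gap whose mean is
    -- one.
    have hsq : ∑ y ∈ t, a y.1 ^ 2 = 4 / 3 * ∑ x ∈ s, a x ^ 2 * newgap 1 d (J x) := by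
      rw [ht, Finset.sum_sigma, Finset.mul_sum]
      refine Finset.sum_congr rfl fun x _ => ?_
      have hle : idx d (J x) ≤ idx d (J x + 1) := hmono.monotone (by omega)
      have h1 : (((idx d (J x + 1) - idx d (J x)).toNat : ℕ) : ℝ) =
          (idx d (J x + 1) : ℝ) - idx d (J x) := by
        rw [← Int.cast_natCast, Int.toNat_of_nonneg (by omega)]
        push_cast
        rfl
      dsimp only
      rw [Finset.sum_const, Int.card_Ico, nsmul_eq_mul, h1, newgap_one]
      ring
    have hA := hν _ t (fun y => y.2) (fun y => a y.1) hinj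
    have hB := hν _ t (fun y => y.2 + 1) (fun y => a y.1) hinj2
    -- Here `9 / 32` is `2 * (3 / 8) ^ 2`, from `(u + v) ^ 2 ≤ 2 * (u ^ 2 + v ^ 2)`.
    have hpt : ∀ g : ℤ → ℝ, ENNReal.ofReal ((∑ x ∈ s, a x * newgap g d (J x)) ^ 2) ≤
        ENNReal.ofReal (9 / 32) * (ENNReal.ofReal ((∑ y ∈ t, a y.1 * g y.2) ^ 2) +
          ENNReal.ofReal ((∑ y ∈ t, a y.1 * g (y.2 + 1)) ^ 2)) := by
      intro g
      rw [← ENNReal.ofReal_add (sq_nonneg _) (sq_nonneg _), ← ENNReal.ofReal_mul (by norm_num)]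
      refine ENNReal.ofReal_le_ofReal ?_
      have : ∑ x ∈ s, a x * newgap g d (J x) =
          3 / 8 * (∑ y ∈ t, a y.1 * g y.2 + ∑ y ∈ t, a y.1 * g (y.2 + 1)) := by
        rw [ht, Finset.sum_sigma, Finset.sum_sigma, ← Finset.sum_add_distrib, Finset.mul_sum]
        refine Finset.sum_congr rfl fun x _ => ?_
        dsimp only
        rw [newgap_eq_sum g hd, ← Finset.mul_sum, ← Finset.mul_sum]
        ring
      rw [this]
      nlinarith [sq_nonneg (∑ y ∈ t, a y.1 * g y.2 - ∑ y ∈ t, a y.1 * g (y.2 + 1))]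
    refine (lintegral_mono hpt).trans ?_
    rw [lintegral_const_mul _ (by fun_prop), lintegral_add_left (by fun_prop)]
    refine (mul_le_mul_right (add_le_add hA hB) _).trans ?_
    have hnn : 0 ≤ C * ∑ y ∈ t, a y.1 ^ 2 := mul_nonneg hC (Finset.sum_nonneg fun _ _ => sq_nonneg _)
    have hg0 : ∀ k, 0 ≤ newgap 1 d k := fun k => ((isGood_one.newgap hd).1 k).le
    rw [← ENNReal.ofReal_add hnn hnn, ← ENNReal.ofReal_mul (by norm_num)]
    simp_rw [← ENNReal.ofReal_mul (mul_nonneg (mul_nonneg (by norm_num : (0 : ℝ) ≤ 3 / 4) hC)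
      (sq_nonneg _))]
    rw [← ENNReal.ofReal_sum_of_nonneg fun x _ =>
      mul_nonneg (mul_nonneg (mul_nonneg (by norm_num) hC) (sq_nonneg _)) (hg0 _), hsq]
    refine ENNReal.ofReal_le_ofReal (le_of_eq ?_)
    rw [Finset.mul_sum, Finset.mul_sum, ← Finset.sum_add_distrib, Finset.mul_sum]
    refine Finset.sum_congr rfl fun x _ => ?_
    ring
  refine (lintegral_mono_ae key).trans ?_
  have hm1 : ∀ k, Measurable fun d : ℤ → Bool => ENNReal.ofReal (newgap 1 d k) := fun k =>
    ENNReal.measurable_ofReal.comp ((measurable_pi_apply k).comp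
      (measurable_newgap.comp (measurable_const.prodMk measurable_id)))
  rw [lintegral_finsetSum _ fun x _ => (hm1 (J x)).const_mul _]
  simp_rw [lintegral_const_mul _ (hm1 _), lintegral_newgap_one, mul_one]
  rw [← ENNReal.ofReal_sum_of_nonneg fun x _ =>
    mul_nonneg (mul_nonneg (by norm_num) hC) (sq_nonneg _), Finset.mul_sum]

/-- Independent identically distributed centred variables satisfy a quadratic bound. -/
theorem sqBound_of_iIndepFun {Ω : Type*} [MeasurableSpace Ω] {μ : Measure Ω}
    [IsProbabilityMeasure μ] {X : ℤ → Ω → ℝ} (hm : ∀ i, Measurable (X i)) (hX : iIndepFun X μ)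
    (hid : ∀ i, IdentDistrib (X i) (X 0) μ μ) (h2 : MemLp (X 0) 2 μ) (h1 : ∫ ω, X 0 ω ∂μ = 1) :
    SqBound (variance (X 0) μ) (μ.map fun ω i => X i ω - 1) := by
  intro ι s J a hJ
  have hmeas : Measurable fun ω i => X i ω - 1 := measurable_pi_iff.2 fun i => (hm i).sub_const 1
  rw [lintegral_map (by fun_prop) hmeas]
  have hL2 : ∀ i, MemLp (X i) 2 μ := fun i => (hid i).memLp_iff.2 h2
  have hY2 : ∀ x, MemLp (fun ω => a x * (X (J x) ω - 1)) 2 μ := fun x =>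
    ((hL2 _).sub (memLp_const 1)).const_mul (a x)
  have hmean : ∀ i, ∫ ω, X i ω ∂μ = 1 := fun i => (hid i).integral_eq.trans h1
  have hvar : variance (∑ x ∈ s, fun ω => a x * (X (J x) ω - 1)) μ =
      variance (X 0) μ * ∑ x ∈ s, a x ^ 2 := by
    rw [IndepFun.variance_sum (fun x _ => hY2 x)]
    · rw [Finset.mul_sum]
      refine Finset.sum_congr rfl fun x _ => ?_
      rw [variance_const_mul, variance_sub_const (hL2 _).aestronglyMeasurable, (hid _).variance_eq,
        mul_comm]
    · intro x hx y hy hxy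
      have : IndepFun (X (J x)) (X (J y)) μ := hX.indepFun fun h => hxy (hJ hx hy h)
      exact this.comp (φ := fun z => a x * (z - 1)) (ψ := fun z => a y * (z - 1))
        (by fun_prop) (by fun_prop)
  have hzero : ∫ ω, (∑ x ∈ s, fun ω => a x * (X (J x) ω - 1)) ω ∂μ = 0 := by
    simp only [Finset.sum_apply]
    rw [integral_finsetSum _ fun x _ => (hY2 x).integrable one_le_two]
    refine Finset.sum_eq_zero fun x _ => ?_
    rw [integral_const_mul, integral_sub ((hL2 _).integrable one_le_two) (integrable_const 1), hmean]
    simp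
  have hS2 : MemLp (∑ x ∈ s, fun ω => a x * (X (J x) ω - 1)) 2 μ := memLp_finsetSum' _ fun x _ => hY2 x
  rw [variance_of_integral_eq_zero hS2.aestronglyMeasurable.aemeasurable hzero] at hvar
  rw [← hvar, ofReal_integral_eq_lintegral_ofReal hS2.integrable_sq
    (Eventually.of_forall fun _ => sq_nonneg _)]
  refine lintegral_mono fun ω => ?_
  simp

/-! ### Fluctuations of the number of merged points -/

/-- A linear combination of the centred distances between consecutive occupied midpoints. -/
def fluct : ℕ → (ℕ → ℝ) → (ℤ → Bool) → ℝ
  | 0, _, _ => 0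
  | N + 1, a, d =>
    if d 1 = false ∧ d 2 = true then a 0 / 2 + fluct N (fun k => a (k + 1)) (seqShift 2 d)
    else -(a 0) / 4 + fluct N (fun k => a (k + 1)) (seqShift 1 d)

/-- A new gap of the unit lattice is `3 / 4` or `3 / 2`, which gives the deviations `-1 / 4` and `1
/ 2` from the mean. -/
theorem fluct_eq (N : ℕ) (a : ℕ → ℝ) {d : ℤ → Bool} (h : Occ d 0) :
    ∑ k ∈ Finset.range N, a k * (newgap 1 d k - 1) = fluct N a d := by
  induction N generalizing a d with
  | zero => simp [fluct]
  | succ N ih =>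
    have h' : Occ (seqShift (nxt d 0) d) 0 := by
      rw [occ_seqShift, zero_add]
      exact occ_nxt _ _
    have hs : ∀ k : ℕ, newgap 1 d ((k + 1 : ℕ) : ℤ) = newgap 1 (seqShift (nxt d 0) d) k := fun k => by
      have := congrFun (seqShift_newgap 1 h) k
      rw [seqShift_one] at this
      rw [← this]
      simp [seqShift]
    have h0 : newgap 1 d 0 = 3 / 4 * (nxt d 0 : ℝ) := by
      rw [newgap_one, idx_zero]
      have : idx d (0 + 1) = nxt d 0 := rfl
      rw [this]
      simp
    rw [Finset.sum_range_succ']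
    simp only [hs]
    rw [ih (fun k => a (k + 1)) h']
    simp only [Nat.cast_zero, h0, fluct, nxt, zero_add]
    split_ifs
    · push_cast
      ring
    · push_cast
      ring

theorem seqShift_flipAt (n j : ℤ) (d : ℤ → Bool) :
    seqShift n (flipAt j d) = flipAt (j - n) (seqShift n d) := by
  funext k
  simp only [seqShift, flipAt]
  congr 1
  exact propext ⟨fun h => by omega, fun h => by omega⟩

/-- Only coins with positive index enter. After a shift by one the former coin `1` becomes
irrelevant, which makes the recursion Markovian. -/
theorem fluct_flipAt (N : ℕ) (a : ℕ → ℝ) {j : ℤ} (hj : j ≤ 0) (d : ℤ → Bool) :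
    fluct N a (flipAt j d) = fluct N a d := by
  induction N generalizing a j d with
  | zero => rfl
  | succ N ih =>
    have h1 : flipAt j d 1 = d 1 := if_neg (by omega)
    have h2 : flipAt j d 2 = d 2 := if_neg (by omega)
    simp only [fluct, h1, h2, seqShift_flipAt]
    rw [ih _ (by omega), ih _ (by omega)]

theorem measurable_fluct (N : ℕ) (a : ℕ → ℝ) : Measurable (fluct N a) := by
  induction N generalizing a with
  | zero => exact measurable_const
  | succ N ih =>
    refine Measurable.ite ((measurableSet_coin 1 false).inter (measurableSet_coin 2 true)) ?_ ?_
    · exact ((ih _).comp (measurable_seqShift 2)).const_add _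
    · exact ((ih _).comp (measurable_seqShift 1)).const_add _

theorem abs_fluct_le (N : ℕ) (a : ℕ → ℝ) (d : ℤ → Bool) :
    |fluct N a d| ≤ ∑ k ∈ Finset.range N, |a k| := by
  induction N generalizing a d with
  | zero => simp [fluct]
  | succ N ih =>
    rw [Finset.sum_range_succ', fluct]
    have h0 := abs_nonneg (a 0)
    split_ifs
    · refine (abs_add_le _ _).trans ?_
      have := ih (fun k => a (k + 1)) (seqShift 2 d)
      rw [abs_div, abs_of_pos (show (0 : ℝ) < 2 by norm_num)]
      linarith
    · refine (abs_add_le _ _).trans ?_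
      have := ih (fun k => a (k + 1)) (seqShift 1 d)
      rw [abs_div, abs_neg, abs_of_pos (show (0 : ℝ) < 4 by norm_num)]
      linarith

/-- The part of the expectation of `F` where the coin `1` shows `b`. -/
def condMean (b : Bool) (F : (ℤ → Bool) → ℝ) : ℝ := ∫ d, (if d 1 = b then F d else 0) ∂coins

theorem integrable_ite_coin {F : (ℤ → Bool) → ℝ} (hF : Integrable F coins) (b : Bool) :
    Integrable (fun d => if d 1 = b then F d else 0) coins := by
  have h : (fun d : ℤ → Bool => if d 1 = b then F d else 0) =
      {d : ℤ → Bool | d 1 = b}.indicator F := by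
    funext d
    by_cases hd : d 1 = b
    · rw [if_pos hd, indicator_of_mem (show d ∈ {d : ℤ → Bool | d 1 = b} from hd)]
    · rw [if_neg hd, indicator_of_notMem (show d ∉ {d : ℤ → Bool | d 1 = b} from hd)]
  rw [h]
  exact hF.indicator (measurableSet_coin 1 b)

theorem condMean_add {b : Bool} {F G : (ℤ → Bool) → ℝ} (hF : Integrable F coins)
    (hG : Integrable G coins) : condMean b (fun d => F d + G d) = condMean b F + condMean b G := by
  unfold condMean
  rw [← integral_add (integrable_ite_coin hF b) (integrable_ite_coin hG b)]
  congr 1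
  funext d
  split_ifs <;> simp

theorem condMean_const_mul (b : Bool) (c : ℝ) (F : (ℤ → Bool) → ℝ) :
    condMean b (fun d => c * F d) = c * condMean b F := by
  unfold condMean
  rw [← integral_const_mul]
  congr 1
  funext d
  split_ifs <;> simp

theorem integral_eq_condMean {F : (ℤ → Bool) → ℝ} (hF : Integrable F coins) :
    ∫ d, F d ∂coins = condMean true F + condMean false F := by
  unfold condMean
  rw [← integral_add (integrable_ite_coin hF true) (integrable_ite_coin hF false)]
  congr 1
  funext d
  cases d 1 <;> simp

theorem flipAt_measurableEmbedding (i : ℤ) : MeasurableEmbedding (flipAt i) :=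
  (MeasurableEquiv.ofInvolutive (flipAt i) (flipAt_flipAt i)
    (coins_flip i).measurable).measurableEmbedding

/-- The coin `1` is independent of what follows. -/
theorem condMean_seqShift (b : Bool) {F : (ℤ → Bool) → ℝ} (hF : Integrable F coins)
    (hflip : ∀ d, F (flipAt 0 d) = F d) :
    condMean b (fun d => F (seqShift 1 d)) = (∫ d, F d ∂coins) / 2 := by
  have hF1 : Integrable (fun d => F (seqShift 1 d)) coins :=
    (coins_seqShift 1).integrable_comp_of_integrable hF
  have h1 : ∫ d, F (seqShift 1 d) ∂coins = ∫ d, F d ∂coins := by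
    conv_rhs => rw [← (coins_seqShift 1).map_eq]
    rw [integral_map (measurable_seqShift 1).aemeasurable]
    rw [(coins_seqShift 1).map_eq]
    exact hF.aestronglyMeasurable
  have h2 : condMean true (fun d => F (seqShift 1 d)) = condMean false fun d => F (seqShift 1 d) := by
    unfold condMean
    rw [← (coins_flip 1).integral_comp (flipAt_measurableEmbedding 1)]
    congr 1
    funext d
    have e1 : flipAt 1 d 1 = !d 1 := if_pos rfl
    dsimp only
    rw [e1, seqShift_flipAt, sub_self, hflip]
    cases d 1 <;> simp
  rw [← h1, integral_eq_condMean hF1]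
  cases b <;> linarith

theorem condMean_one (b : Bool) : condMean b (fun _ => 1) = 1 / 2 := by
  have := condMean_seqShift b (F := fun _ => 1) (integrable_const 1) fun _ => rfl
  simpa using this

/-- The conditional expectation of `fluct` given the first coin, up to a constant. -/
def driftSum : ℕ → (ℕ → ℝ) → ℝ
  | 0, _ => 0
  | N + 1, a => a 0 + driftSum N (fun k => a (k + 1)) / 4

theorem integrable_of_abs_le {F : (ℤ → Bool) → ℝ} (hF : Measurable F) {C : ℝ}
    (h : ∀ d, |F d| ≤ C) : Integrable F coins :=
  Integrable.of_bound hF.aestronglyMeasurable C (Eventually.of_forall h)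

theorem integrable_fluct (N : ℕ) (a : ℕ → ℝ) : Integrable (fluct N a) coins :=
  integrable_of_abs_le (measurable_fluct N a) (abs_fluct_le N a)

theorem integrable_fluct_sq (N : ℕ) (a : ℕ → ℝ) : Integrable (fun d => fluct N a d ^ 2) coins :=
  integrable_of_abs_le ((measurable_fluct N a).pow_const 2)
    (C := (∑ k ∈ Finset.range N, |a k|) ^ 2) fun d => by
      rw [abs_pow]
      exact pow_le_pow_left₀ (abs_nonneg _) (abs_fluct_le N a d) 2

theorem condMean_const_add (b : Bool) (c : ℝ) (N : ℕ) (a : ℕ → ℝ) :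
    condMean b (fun d => c + fluct N a d) = c / 2 + condMean b (fluct N a) := by
  rw [condMean_add (integrable_const c) (integrable_fluct N a)]
  have := condMean_const_mul b c fun _ => 1
  rw [condMean_one] at this
  simp only [mul_one] at this
  rw [this]
  ring

theorem condMean_const_add_sq (b : Bool) (c : ℝ) (N : ℕ) (a : ℕ → ℝ) :
    condMean b (fun d => (c + fluct N a d) ^ 2) =
      c ^ 2 / 2 + 2 * c * condMean b (fluct N a) + condMean b fun d => fluct N a d ^ 2 := by
  have h : (fun d => (c + fluct N a d) ^ 2) =
      fun d => (c ^ 2 * 1 + 2 * c * fluct N a d) + fluct N a d ^ 2 := by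
    funext d
    ring
  have i1 : Integrable (fun _ : ℤ → Bool => c ^ 2 * 1) coins := integrable_const _
  have i2 : Integrable (fun d => 2 * c * fluct N a d) coins := (integrable_fluct N a).const_mul _
  have i3 : Integrable (fun d => c ^ 2 * 1 + 2 * c * fluct N a d) coins := i1.add i2
  rw [h, condMean_add i3 (integrable_fluct_sq N a), condMean_add i1 i2,
    condMean_const_mul, condMean_const_mul, condMean_one]
  ring

theorem condMean_congr {b : Bool} {F G : (ℤ → Bool) → ℝ} (h : ∀ d, d 1 = b → F d = G d) :
    condMean b F = condMean b G := by
  unfold condMean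
  congr 1
  funext d
  split_ifs with hd
  · exact h d hd
  · rfl

/-- The one-step recursion for functionals of `fluct`. -/
theorem condMean_fluct_succ (φ : ℝ → ℝ) (hφ : Continuous φ) (N : ℕ) (a : ℕ → ℝ) :
    condMean true (fun d => φ (fluct (N + 1) a d)) =
      (condMean true (fun d => φ (-(a 0) / 4 + fluct N (fun k => a (k + 1)) d)) +
        condMean false fun d => φ (-(a 0) / 4 + fluct N (fun k => a (k + 1)) d)) / 2 ∧
    condMean false (fun d => φ (fluct (N + 1) a d)) =
      (condMean false (fun d => φ (-(a 0) / 4 + fluct N (fun k => a (k + 1)) d)) +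
        (condMean true (fun d => φ (a 0 / 2 + fluct N (fun k => a (k + 1)) d)) +
          condMean false fun d => φ (a 0 / 2 + fluct N (fun k => a (k + 1)) d)) / 2) / 2 := by
  set Z := fluct N (fun k => a (k + 1)) with hZ
  have hint : ∀ c, Integrable (fun d => φ (c + Z d)) coins := by
    intro c
    obtain ⟨C, hC⟩ := (isCompact_Icc (a := c - ∑ k ∈ Finset.range N, |a (k + 1)|)
      (b := c + ∑ k ∈ Finset.range N, |a (k + 1)|)).exists_bound_of_continuousOn hφ.continuousOn
    refine integrable_of_abs_le (C := C)
      (hφ.measurable.comp ((measurable_fluct _ _).const_add c)) fun d => hC _ ?_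
    have := abs_le.1 (abs_fluct_le N (fun k => a (k + 1)) d)
    exact ⟨by linarith [this.1], by linarith [this.2]⟩
  have hflip : ∀ c d, φ (c + Z (flipAt 0 d)) = φ (c + Z d) := fun c d => by
    rw [hZ, fluct_flipAt _ _ le_rfl]
  have hstep : ∀ b c, condMean b (fun d => φ (c + Z (seqShift 1 d))) =
      (condMean true (fun d => φ (c + Z d)) + condMean false fun d => φ (c + Z d)) / 2 := by
    intro b c
    rw [condMean_seqShift b (F := fun d => φ (c + Z d)) (hint c) (hflip c),
      integral_eq_condMean (hint c)]
  -- If coin `1` is `true`, the step has length one and coin `2` is fresh. If coin `1` is `false`,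
  -- the value of coin `2` decides: `false` gives a step of length one and the chain stays in state
  -- `false`; `true` gives a step of length two, after which coin `3` is fresh.
  constructor
  · rw [← hstep true]
    refine condMean_congr fun d hd => ?_
    rw [fluct, if_neg (by simp [hd])]
  · have hi1 := integrable_ite_coin (hint (-(a 0) / 4)) false
    have hi2 : Integrable (fun d => if d 1 = true then φ (a 0 / 2 + Z (seqShift 1 d)) else 0) coins :=
      integrable_ite_coin (F := fun d => φ (a 0 / 2 + Z (seqShift 1 d)))
        ((coins_seqShift 1).integrable_comp_of_integrable (hint (a 0 / 2))) true
    have h := condMean_seqShift false (F := fun d =>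
      (if d 1 = false then φ (-(a 0) / 4 + Z d) else 0) +
        if d 1 = true then φ (a 0 / 2 + Z (seqShift 1 d)) else 0) (hi1.add hi2) fun d => by
        have e1 : flipAt 0 d 1 = d 1 := if_neg (by norm_num)
        rw [e1, hflip, seqShift_flipAt]
        rw [hZ, fluct_flipAt _ _ (by norm_num)]
    rw [integral_add hi1 hi2] at h
    have h3 := hstep true (a 0 / 2)
    change _ = (condMean false _ + condMean true (fun d => φ (a 0 / 2 + Z (seqShift 1 d)))) / 2 at h
    rw [h3] at h
    rw [← h]
    refine condMean_congr fun d hd => ?_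
    have e1 : seqShift 1 d 1 = d 2 := by simp [seqShift]
    rw [fluct, e1, seqShift_seqShift]
    cases h2 : d 2
    · simp [hZ]
    · simp [hd, hZ]

/-- The influence of the first coin on the mean deviation of later gaps decays by a factor `1 / 4`
per gap, with opposite signs in the two states; `driftSum` collects these weights. -/
theorem condMean_fluct (N : ℕ) (a : ℕ → ℝ) :
    condMean true (fluct N a) = -driftSum N a / 8 ∧ condMean false (fluct N a) = driftSum N a / 16 := by
  induction N generalizing a with
  | zero => simp [fluct, driftSum, condMean]
  | succ N ih =>
    obtain ⟨h1, h2⟩ := condMean_fluct_succ (fun x => x) continuous_id N a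
    obtain ⟨e1, e2⟩ := ih fun k => a (k + 1)
    simp only [condMean_const_add, e1, e2] at h1 h2
    constructor
    · rw [show condMean true (fluct (N + 1) a) = _ from h1, driftSum]
      ring
    · rw [show condMean false (fluct (N + 1) a) = _ from h2, driftSum]
      ring

/-- The subtracted square strengthens the claim so that the induction closes: it absorbs the
products of `a 0` with the mean of the remaining sum. -/
theorem condMean_fluct_sq_le (N : ℕ) (a : ℕ → ℝ) (b : Bool) :
    condMean b (fun d => fluct N a d ^ 2) ≤
      (2 * ∑ k ∈ Finset.range N, a k ^ 2 - driftSum N a ^ 2) / 2 := by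
  induction N generalizing a b with
  | zero => simp [fluct, driftSum, condMean]
  | succ N ih =>
    obtain ⟨h1, h2⟩ := condMean_fluct_succ (fun x => x ^ 2) (continuous_pow 2) N a
    obtain ⟨e1, e2⟩ := condMean_fluct N fun k => a (k + 1)
    simp only [condMean_const_add_sq, e1, e2] at h1 h2
    have i1 := ih (fun k => a (k + 1)) true
    have i2 := ih (fun k => a (k + 1)) false
    rw [Finset.sum_range_succ', driftSum]
    set p := driftSum N fun k => a (k + 1)
    have q1 := sq_nonneg (a 0 - p)
    have q2 := sq_nonneg (a 0)
    have q3 := sq_nonneg p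
    cases b
    · rw [h2]
      nlinarith
    · rw [h1]
      nlinarith

theorem measurable_newgap_one : Measurable fun d : ℤ → Bool => newgap 1 d := by
  have h1 : Measurable fun d : ℤ → Bool => ((1 : ℤ → ℝ), d) := measurable_const.prodMk measurable_id
  have h := measurable_newgap.comp h1
  simp only [Function.comp_def] at h
  exact h

theorem clusterMap_dirac_one :
    clusterMap (Measure.dirac fun _ : ℤ => (1 : ℝ)) = palmCoins.map fun d => newgap 1 d := by
  rw [clusterMap, Measure.dirac_prod, Measure.map_map measurable_newgap measurable_prodMk_left]
  simp only [Function.comp_def, Pi.one_def]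

theorem lintegral_newgap_one_shift {f : (ℤ → ℝ) → ℝ≥0∞} (hf : Measurable f) (m : ℤ) :
    ∫⁻ d, f (newgap 1 d) ∂palmCoins = ∫⁻ d, f (seqShift m (newgap 1 d)) ∂palmCoins := by
  have hf' : Measurable fun g => f (seqShift m g) := hf.comp (measurable_seqShift m)
  rw [← lintegral_map hf measurable_newgap_one, ← lintegral_map hf' measurable_newgap_one,
    ← clusterMap_dirac_one]
  exact ((clusterMap_preserving (dirac_preserving 1) m).lintegral_comp hf).symm

/-- The law of the centred gaps after one step from the integer lattice satisfies a quadratic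
bound. -/
theorem sqBound_lattice : SqBound (8 / 3) (palmCoins.map fun d => newgap 1 d - 1) := by
  intro ι s J a hJ
  -- `fluct` handles the indices `0, …, N - 1`. Stationarity of the new lattice gaps permits a
  -- translation by `m` that brings the finitely many indices `J x` into this range.
  obtain ⟨m, hm⟩ : ∃ m : ℕ, ∀ x ∈ s, 0 ≤ J x + m := by
    refine ⟨∑ x ∈ s, (J x).natAbs, fun x hx => ?_⟩
    have := Finset.single_le_sum (f := fun x => (J x).natAbs) (fun _ _ => Nat.zero_le _) hx
    omega
  obtain ⟨N, hN⟩ : ∃ N : ℕ, ∀ x ∈ s, J x + m < N := by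
    refine ⟨∑ x ∈ s, (J x + m).natAbs + 1, fun x hx => ?_⟩
    have := Finset.single_le_sum (f := fun x => (J x + m).natAbs) (fun _ _ => Nat.zero_le _) hx
    omega
  set u : ι → ℕ := fun x => (J x + m).toNat with hu
  have hu' : ∀ x ∈ s, (u x : ℤ) = J x + m := fun x hx => Int.toNat_of_nonneg (hm x hx)
  have huN : ∀ x ∈ s, u x ∈ Finset.range N := fun x hx => by
    rw [Finset.mem_range]
    have := hu' x hx
    have := hN x hx
    omega
  set b : ℕ → ℝ := fun k => ∑ x ∈ s, if u x = k then a x else 0 with hb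
  have hsum : ∀ y : ℕ → ℝ, ∑ k ∈ Finset.range N, b k * y k = ∑ x ∈ s, a x * y (u x) := by
    intro y
    simp only [hb, Finset.sum_mul]
    rw [Finset.sum_comm]
    refine Finset.sum_congr rfl fun x hx => ?_
    rw [Finset.sum_eq_single_of_mem (u x) (huN x hx)]
    · simp
    · intro k _ hk
      rw [if_neg (Ne.symm hk), zero_mul]
  have hbu : ∀ x ∈ s, b (u x) = a x := by
    intro x hx
    simp only [hb]
    rw [Finset.sum_eq_single_of_mem x hx]
    · simp
    · intro x' hx' hne
      refine if_neg fun h => hne (hJ hx' hx ?_)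
      have h1 := hu' x hx
      have h2 := hu' x' hx'
      rw [h] at h2
      omega
  have hsq : ∑ k ∈ Finset.range N, b k ^ 2 = ∑ x ∈ s, a x ^ 2 := by
    simp only [sq]
    rw [hsum b]
    exact Finset.sum_congr rfl fun x hx => by rw [hbu x hx]
  have hG : Measurable fun g : ℤ → ℝ => ENNReal.ofReal ((∑ x ∈ s, a x * (g (J x) - 1)) ^ 2) := by
    fun_prop
  have hsub : Measurable fun d : ℤ → Bool => newgap 1 d - 1 := measurable_newgap_one.sub_const 1
  rw [lintegral_map (by fun_prop) hsub]
  simp only [Pi.sub_apply, Pi.one_apply]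
  have h2 : ∫⁻ d, ENNReal.ofReal ((∑ x ∈ s, a x * (newgap 1 d (J x) - 1)) ^ 2) ∂palmCoins =
      ∫⁻ d, ENNReal.ofReal (fluct N b d ^ 2) ∂palmCoins := by
    rw [lintegral_newgap_one_shift hG m]
    refine lintegral_congr_ae ?_
    filter_upwards [palmCoins_ae_occ] with d hd
    rw [← fluct_eq N b hd, hsum fun k => newgap 1 d k - 1]
    congr 2
    refine Finset.sum_congr rfl fun x hx => ?_
    rw [hu' x hx, seqShift]
  rw [h2, lintegral_palmCoins]
  -- Each of the two states contributes at most the sum of squares, and the density `4 / 3` of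
  -- `palmCoins` turns the resulting `2` into `8 / 3`.
  have h3 : ∫⁻ d, {d | Occ d 0}.indicator (fun d => ENNReal.ofReal (fluct N b d ^ 2)) d ∂coins ≤
      ENNReal.ofReal (2 * ∑ x ∈ s, a x ^ 2) := by
    refine (lintegral_mono (indicator_le_self _ _)).trans ?_
    rw [← ofReal_integral_eq_lintegral_ofReal (integrable_fluct_sq N b)
      (Eventually.of_forall fun _ => sq_nonneg _), integral_eq_condMean (integrable_fluct_sq N b)]
    refine ENNReal.ofReal_le_ofReal ?_
    have e1 := condMean_fluct_sq_le N b true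
    have e2 := condMean_fluct_sq_le N b false
    rw [hsq] at e1 e2
    nlinarith [sq_nonneg (driftSum N b)]
  refine (mul_le_mul_right h3 _).trans (le_of_eq ?_)
  have e43 : (4 / 3 : ℝ≥0∞) = ENNReal.ofReal (4 / 3) := by
    rw [ENNReal.ofReal_div_of_pos (by norm_num)]
    simp
  rw [e43, ← ENNReal.ofReal_mul (by norm_num)]
  congr 1
  ring


/-! ### Sequences of independent choices -/

section Split

variable {X : Type*} [MeasurableSpace X] (m : Measure X) [IsProbabilityMeasure m]

/-- Prepend a term to a sequence. -/
def seqCons (p : X × (ℕ → X)) (n : ℕ) : X := Nat.casesOn n p.1 p.2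

theorem measurable_seqCons : Measurable (seqCons : X × (ℕ → X) → ℕ → X) := by
  refine measurable_pi_iff.2 fun n => ?_
  cases n with
  | zero => exact measurable_fst
  | succ n => exact (measurable_pi_apply n).comp measurable_snd

theorem map_seqCons :
    (m.prod (Measure.infinitePi fun _ : ℕ => m)).map seqCons = Measure.infinitePi fun _ : ℕ => m := by
  classical
  refine Measure.eq_infinitePi _ fun s t ht => ?_
  obtain ⟨N, hN⟩ : ∃ N, s ⊆ Finset.range (N + 1) := by
    obtain ⟨N, hN⟩ := s.exists_nat_subset_range
    exact ⟨N, hN.trans (Finset.range_mono (by omega))⟩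
  set t' : ℕ → Set X := fun i => if i ∈ s then t i else univ with ht'
  have hmt : ∀ i, MeasurableSet (t' i) := fun i => by
    simp only [ht']
    split_ifs
    exacts [ht i, MeasurableSet.univ]
  have h1 : (s : Set ℕ).pi t = ((Finset.range (N + 1) : Finset ℕ) : Set ℕ).pi t' := by
    ext x
    simp only [Set.mem_pi, Finset.mem_coe, ht']
    refine ⟨fun h i _ => ?_, fun h i hi => ?_⟩
    · split_ifs with hi
      exacts [h i hi, mem_univ _]
    · simpa [hi] using h i (hN hi)
  have h2 : ∏ i ∈ s, m (t i) = ∏ i ∈ Finset.range (N + 1), m (t' i) := by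
    rw [← Finset.prod_subset hN]
    · exact Finset.prod_congr rfl fun i hi => by simp [ht', hi]
    · intro i _ hi
      simp [ht', hi]
  rw [h1, h2, Measure.map_apply measurable_seqCons
    (MeasurableSet.pi (Finset.countable_toSet _) fun i _ => hmt i)]
  have h3 : seqCons ⁻¹' (((Finset.range (N + 1) : Finset ℕ) : Set ℕ).pi t') =
      t' 0 ×ˢ ((Finset.range N : Finset ℕ) : Set ℕ).pi fun i => t' (i + 1) := by
    ext ⟨x, y⟩
    simp only [mem_preimage, Set.mem_pi, Finset.mem_coe, Finset.mem_range, mem_prod]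
    refine ⟨fun h => ⟨h 0 (by omega), fun i hi => h (i + 1) (by omega)⟩, fun h i hi => ?_⟩
    cases i with
    | zero => exact h.1
    | succ i => exact h.2 i (by omega)
  rw [h3, Measure.prod_prod, Measure.infinitePi_pi _ fun i _ => hmt _, Finset.prod_range_succ',
    mul_comm]

theorem measurePreserving_uncons : MeasurePreserving (fun D : ℕ → X => (D 0, fun n => D (n + 1)))
    (Measure.infinitePi fun _ : ℕ => m) (m.prod (Measure.infinitePi fun _ : ℕ => m)) := by
  have hm : Measurable fun D : ℕ → X => (D 0, fun n => D (n + 1)) := by fun_prop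
  refine ⟨hm, ?_⟩
  conv_lhs => rw [← map_seqCons m, Measure.map_map hm measurable_seqCons]
  exact Measure.map_id

theorem measurePreserving_tail : MeasurePreserving (fun (D : ℕ → X) n => D (n + 1))
    (Measure.infinitePi fun _ : ℕ => m) (Measure.infinitePi fun _ : ℕ => m) :=
  measurePreserving_snd.comp (measurePreserving_uncons m)

end Split

/-- The law of an independent sequence of directions seen from typical points. -/
def choices : Measure (ℕ → ℤ → Bool) := Measure.infinitePi fun _ => palmCoins

instance : IsProbabilityMeasure choices :=
  inferInstanceAs (IsProbabilityMeasure (Measure.infinitePi _))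

theorem choices_tail (t : ℕ) :
    MeasurePreserving (fun (D : ℕ → ℤ → Bool) n => D (n + t)) choices choices := by
  induction t with
  | zero => exact MeasurePreserving.id _
  | succ t ih =>
    exact ih.comp (measurePreserving_tail palmCoins)

theorem choices_eval (t : ℕ) : MeasurePreserving (fun D : ℕ → ℤ → Bool => D t) choices palmCoins :=
  measurePreserving_eval_infinitePi _ t

/-! ### Iterating the dynamics -/

/-- The gaps obtained from `g` when the directions `D (t - 1)`, …, `D 0` are used one after the
other. -/
def evol : ℕ → (ℕ → ℤ → Bool) → (ℤ → ℝ) → ℤ → ℝ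
  | 0, _, g => g
  | t + 1, D, g => newgap (evol t (fun n => D (n + 1)) g) (D 0)

/-- In reverse order the additional direction acts first, on the initial gaps, and the remaining
maps are unchanged. Successive values thus differ by the image of a single increment. -/
theorem evol_succ' (t : ℕ) (D : ℕ → ℤ → Bool) (g : ℤ → ℝ) :
    evol (t + 1) D g = evol t D (newgap g (D t)) := by
  induction t generalizing D with
  | zero => rfl
  | succ t ih => rw [evol, ih, evol]

theorem evol_add (t : ℕ) (D : ℕ → ℤ → Bool) (g h : ℤ → ℝ) :
    evol t D (g + h) = evol t D g + evol t D h := by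
  induction t generalizing D with
  | zero => rfl
  | succ t ih => rw [evol, ih, newgap_add, ← evol, ← evol]

theorem evol_smul (t : ℕ) (D : ℕ → ℤ → Bool) (c : ℝ) (g : ℤ → ℝ) :
    evol t D (c • g) = c • evol t D g := by
  induction t generalizing D with
  | zero => rfl
  | succ t ih => rw [evol, ih, newgap_smul, ← evol]

theorem evol_sub (t : ℕ) (D : ℕ → ℤ → Bool) (g h : ℤ → ℝ) :
    evol t D (g - h) = evol t D g - evol t D h := by
  have := evol_add t D (g - h) h
  rw [sub_add_cancel] at this
  rw [this, add_sub_cancel_right]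

theorem measurable_evol (t : ℕ) :
    Measurable fun p : (ℕ → ℤ → Bool) × (ℤ → ℝ) => evol t p.1 p.2 := by
  induction t with
  | zero => exact measurable_snd
  | succ t ih =>
    have h0 : Measurable fun p : (ℕ → ℤ → Bool) × (ℤ → ℝ) => ((fun n => p.1 (n + 1)), p.2) := by
      fun_prop
    have h1 : Measurable fun p : (ℕ → ℤ → Bool) × (ℤ → ℝ) =>
        (evol t (fun n => p.1 (n + 1)) p.2, p.1 0) :=
      (ih.comp h0).prodMk (by fun_prop)
    have h2 := measurable_newgap.comp h1
    simp only [Function.comp_def] at h2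
    simpa only [evol] using h2

theorem measurable_evol_comp {α : Type*} [MeasurableSpace α] (t : ℕ) {u : α → ℕ → ℤ → Bool}
    {v : α → ℤ → ℝ} (hu : Measurable u) (hv : Measurable v) :
    Measurable fun a => evol t (u a) (v a) := by
  have h := (measurable_evol t).comp (hu.prodMk hv)
  simp only [Function.comp_def] at h
  exact h

theorem isProbabilityMeasure_iterate {ν : Measure (ℤ → ℝ)} [IsProbabilityMeasure ν] (t : ℕ) :
    IsProbabilityMeasure (clusterMap^[t] ν) := by
  induction t with
  | zero => assumption
  | succ t ih =>
    rw [Function.iterate_succ_apply']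
    infer_instance

/-- The law of the evolved gaps. -/
theorem map_evol {E : Type*} [MeasurableSpace E] (ρ : Measure E) [IsProbabilityMeasure ρ]
    {h : (ℕ → ℤ → Bool) → E → ℤ → ℝ}
    (hh : Measurable fun p : (ℕ → ℤ → Bool) × E => h p.1 p.2) (t : ℕ) :
    (choices.prod ρ).map (fun p => evol t p.1 (h (fun n => p.1 (n + t)) p.2)) =
      clusterMap^[t] ((choices.prod ρ).map fun p => h p.1 p.2) := by
  induction t with
  | zero => rfl
  | succ t ih =>
    have hm : Measurable fun p : (ℕ → ℤ → Bool) × E =>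
        evol t p.1 (h (fun n => p.1 (n + t)) p.2) := by
      have h1 : Measurable fun p : (ℕ → ℤ → Bool) × E => ((fun n => p.1 (n + t)), p.2) := by fun_prop
      have h2 := hh.comp h1
      simp only [Function.comp_def] at h2
      exact measurable_evol_comp t measurable_fst h2
    -- The direction applied last is split off; the others again form an independent sequence, to
    -- which the induction hypothesis applies. The initial sequence may depend on directions from
    -- time `t` on, since those are not used by the `t` maps.
    have hsplit : MeasurePreserving
        (fun p : (ℕ → ℤ → Bool) × E => (((fun n => p.1 (n + 1)), p.2), p.1 0))
        (choices.prod ρ) ((choices.prod ρ).prod palmCoins) := by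
      have e1 : MeasurePreserving (Prod.map (fun D : ℕ → ℤ → Bool => (D 0, fun n => D (n + 1))) id)
          (choices.prod ρ) ((palmCoins.prod choices).prod ρ) :=
        (measurePreserving_uncons palmCoins).prod (MeasurePreserving.id ρ)
      have e2 := measurePreserving_prodAssoc palmCoins choices ρ
      have e3 : MeasurePreserving Prod.swap (palmCoins.prod (choices.prod ρ))
        ((choices.prod ρ).prod palmCoins) := Measure.measurePreserving_swap
      exact e3.comp (e2.comp e1)
    rw [Function.iterate_succ_apply', ← ih, clusterMap]
    conv_rhs => rw [← Measure.map_id (μ := palmCoins)]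
    rw [Measure.map_prod_map _ _ hm measurable_id, ← hsplit.map_eq,
      Measure.map_map (hm.prodMap measurable_id) hsplit.measurable,
      Measure.map_map measurable_newgap ((hm.prodMap measurable_id).comp hsplit.measurable)]
    congr 1

theorem SqBound.iterate {C : ℝ} (hC : 0 ≤ C) {ν : Measure (ℤ → ℝ)} [IsProbabilityMeasure ν]
    (hν : SqBound C ν) (t : ℕ) : SqBound (C * (3 / 4) ^ t) (_root_.clusterMap^[t] ν) := by
  induction t with
  | zero => simpa using hν
  | succ t ih =>
    have := isProbabilityMeasure_iterate (ν := ν) t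
    rw [Function.iterate_succ_apply', pow_succ, ← mul_assoc, mul_comm]
    exact ih.clusterMap (by positivity)

theorem IsGapLaw.iterate {ν : Measure (ℤ → ℝ)} (hν : IsGapLaw ν) (t : ℕ) :
    IsGapLaw (_root_.clusterMap^[t] ν) := by
  induction t with
  | zero => exact hν
  | succ t ih =>
    rw [Function.iterate_succ_apply']
    exact ih.clusterMap

theorem isGapLaw_dirac_one : IsGapLaw (Measure.dirac 1) where
  isProb := inferInstance
  preserving := dirac_preserving 1
  good := by
    rw [ae_dirac_iff measurableSet_isGood]
    exact isGood_one
  mean := by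
    rw [lintegral_dirac' _ (by fun_prop)]
    simp

theorem nonneg_newgap {g : ℤ → ℝ} (hg : ∀ i, 0 ≤ g i) {d : ℤ → Bool} (h : Occ d 0) (k : ℤ) :
    0 ≤ newgap g d k := by
  rw [newgap_eq_sum g h]
  have h1 := Finset.sum_nonneg fun j (_ : j ∈ Finset.Ico (idx d k) (idx d (k + 1))) => hg j
  have h2 := Finset.sum_nonneg fun j (_ : j ∈ Finset.Ico (idx d k) (idx d (k + 1))) => hg (j + 1)
  positivity

/-- For stationary nonnegative sequences the mean is constant along the dynamics. -/
theorem lintegral_iterate_zero {ν : Measure (ℤ → ℝ)} [IsProbabilityMeasure ν]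
    (hν : ∀ i, MeasurePreserving (seqShift i) ν ν) (h0 : ∀ᵐ g ∂ν, ∀ i, 0 ≤ g i) (t : ℕ) :
    ∫⁻ g, ENNReal.ofReal (g 0) ∂clusterMap^[t] ν = ∫⁻ g, ENNReal.ofReal (g 0) ∂ν := by
  have key : (∀ i, MeasurePreserving (seqShift i) (clusterMap^[t] ν) (clusterMap^[t] ν)) ∧
      (∀ᵐ g ∂clusterMap^[t] ν, ∀ i, 0 ≤ g i) ∧
      ∫⁻ g, ENNReal.ofReal (g 0) ∂clusterMap^[t] ν = ∫⁻ g, ENNReal.ofReal (g 0) ∂ν := by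
    induction t with
    | zero => exact ⟨hν, h0, rfl⟩
    | succ t ih =>
      have := isProbabilityMeasure_iterate (ν := ν) t
      rw [Function.iterate_succ_apply']
      refine ⟨clusterMap_preserving ih.1, ae_clusterMap ih.2.1 ?_ fun g d hg hd => nonneg_newgap hg hd,
        (lintegral_clusterMap_zero ih.1 ih.2.1).trans ih.2.2⟩
      simp only [ofPred_forall]
      exact MeasurableSet.iInter fun i => measurableSet_le measurable_const (measurable_pi_apply i)
  exact key.2.2

/-! ### Geometric decay -/

theorem lintegral_enorm_le_of_sq {α : Type*} [MeasurableSpace α] {μ : Measure α}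
    [IsProbabilityMeasure μ] {u : α → ℝ} (hu : Measurable u) {C : ℝ} (hC : 0 ≤ C) {t : ℕ}
    (h : ∫⁻ a, ENNReal.ofReal (u a ^ 2) ∂μ ≤ ENNReal.ofReal (C * (3 / 4) ^ t)) :
    ∫⁻ a, ‖u a‖ₑ ∂μ ≤ ENNReal.ofReal ((1 + C) * (9 / 10) ^ t) := by
  -- Any ratio between `3 / 4` and `1` would do in `|u| ≤ r + u ^ 2 / r`; here `(3 / 4) / (9 / 10) =
  -- 5 / 6 ≤ 9 / 10`.
  set r : ℝ := (9 / 10) ^ t with hr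
  have hr0 : 0 < r := by positivity
  have hpt : ∀ a, ‖u a‖ₑ ≤ ENNReal.ofReal r + ENNReal.ofReal r⁻¹ * ENNReal.ofReal (u a ^ 2) := by
    intro a
    rw [← ENNReal.ofReal_mul (by positivity), ← ENNReal.ofReal_add (by positivity) (by positivity),
      Real.enorm_eq_ofReal_abs]
    refine ENNReal.ofReal_le_ofReal ?_
    have h1 : |u a| * r ≤ r * r + u a ^ 2 := by
      rw [← sq_abs (u a)]
      nlinarith [sq_nonneg (|u a| - r), abs_nonneg (u a)]
    have h2 : |u a| = |u a| * r * r⁻¹ := by field_simp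
    rw [h2]
    calc |u a| * r * r⁻¹ ≤ (r * r + u a ^ 2) * r⁻¹ := by gcongr
      _ = r + r⁻¹ * u a ^ 2 := by field_simp
  refine (lintegral_mono hpt).trans ?_
  rw [lintegral_add_left measurable_const, lintegral_const, measure_univ, mul_one,
    lintegral_const_mul _ (by fun_prop)]
  refine (add_le_add le_rfl (mul_le_mul_right h _)).trans ?_
  rw [← ENNReal.ofReal_mul (by positivity), ← ENNReal.ofReal_add (by positivity) (by positivity)]
  refine ENNReal.ofReal_le_ofReal ?_
  have h3 : r⁻¹ * (C * (3 / 4) ^ t) = C * (5 / 6) ^ t := by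
    rw [hr, ← inv_pow, mul_left_comm, ← mul_pow]
    norm_num
  have h4 : ((5 : ℝ) / 6) ^ t ≤ r := pow_le_pow_left₀ (by norm_num) (by norm_num) t
  rw [h3]
  nlinarith

theorem tsum_lintegral_enorm_ne_top {α : Type*} [MeasurableSpace α] {μ : Measure α}
    [IsProbabilityMeasure μ] {u : ℕ → α → ℝ} (hu : ∀ t, Measurable (u t)) {C : ℝ} (hC : 0 ≤ C)
    (h : ∀ t, ∫⁻ a, ENNReal.ofReal (u t a ^ 2) ∂μ ≤ ENNReal.ofReal (C * (3 / 4) ^ t)) :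
    ∫⁻ a, ∑' t, ‖u t a‖ₑ ∂μ ≠ ∞ := by
  have hm : ∀ t, AEMeasurable (fun a => ‖u t a‖ₑ) μ := fun t => (hu t).enorm.aemeasurable
  rw [lintegral_tsum hm]
  refine ((ENNReal.tsum_le_tsum fun t => lintegral_enorm_le_of_sq (hu t) hC (h t)).trans_lt ?_).ne
  have hs : Summable fun t : ℕ => (1 + C) * (9 / 10 : ℝ) ^ t :=
    (summable_geometric_of_lt_one (by norm_num) (by norm_num)).mul_left _
  rw [← ENNReal.ofReal_tsum_of_nonneg (fun t => by positivity) hs]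
  exact ENNReal.ofReal_lt_top

theorem ae_summable_of_sq {α : Type*} [MeasurableSpace α] {μ : Measure α}
    [IsProbabilityMeasure μ] {u : ℕ → α → ℝ} (hu : ∀ t, Measurable (u t)) {C : ℝ} (hC : 0 ≤ C)
    (h : ∀ t, ∫⁻ a, ENNReal.ofReal (u t a ^ 2) ∂μ ≤ ENNReal.ofReal (C * (3 / 4) ^ t)) :
    ∀ᵐ a ∂μ, Summable fun t => u t a := by
  have hm : Measurable fun a => ∑' t, ‖u t a‖ₑ := Measurable.tsum fun t => (hu t).enorm
  filter_upwards [ae_lt_top hm (tsum_lintegral_enorm_ne_top hu hC h)] with a ha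
  refine Summable.of_norm ?_
  have := ENNReal.summable_toReal ha.ne
  simpa using this


/-! ### The limiting gaps -/

theorem map_evol_choices {h : (ℕ → ℤ → Bool) → ℤ → ℝ} (hh : Measurable h) (t : ℕ) :
    choices.map (fun D => evol t D (h fun n => D (n + t))) = clusterMap^[t] (choices.map h) := by
  have e : ∀ F : (ℕ → ℤ → Bool) → ℤ → ℝ, Measurable F →
      (choices.prod (Measure.dirac ())).map (fun p => F p.1) = choices.map F := by
    intro F hF
    have := Measure.map_map (μ := choices.prod (Measure.dirac ())) hF measurable_fst
    rw [Measure.map_fst_prod, measure_univ, one_smul] at this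
    exact this.symm
  have h1 := map_evol (Measure.dirac ()) (h := fun D _ => h D) (hh.comp measurable_fst) t
  have h2 : Measurable fun D : ℕ → ℤ → Bool => fun n => D (n + t) := by fun_prop
  rwa [e h hh, e (fun D => evol t D (h fun n => D (n + t)))
    (measurable_evol_comp t measurable_id (hh.comp h2))] at h1

theorem lintegral_sq_evol {E : Type*} [MeasurableSpace E] {ρ : Measure E} [IsProbabilityMeasure ρ]
    {h : (ℕ → ℤ → Bool) → E → ℤ → ℝ}
    (hh : Measurable fun p : (ℕ → ℤ → Bool) × E => h p.1 p.2) {C : ℝ} (hC : 0 ≤ C)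
    (hs : SqBound C ((choices.prod ρ).map fun p => h p.1 p.2)) (t : ℕ) (k : ℤ) :
    ∫⁻ p, ENNReal.ofReal (evol t p.1 (h (fun n => p.1 (n + t)) p.2) k ^ 2) ∂(choices.prod ρ) ≤
      ENNReal.ofReal (C * (3 / 4) ^ t) := by
  have h1 : Measurable fun p : (ℕ → ℤ → Bool) × E => ((fun n => p.1 (n + t)), p.2) := by fun_prop
  have h2 := hh.comp h1
  simp only [Function.comp_def] at h2
  have : IsProbabilityMeasure ((choices.prod ρ).map fun p => h p.1 p.2) :=
    Measure.isProbabilityMeasure_map hh.aemeasurable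
  have h3 := (hs.iterate hC t).single k
  rw [← map_evol ρ hh t, lintegral_map (by fun_prop) (measurable_evol_comp t measurable_fst h2)] at h3
  exact h3

/-- The increments of the gaps started from the integer lattice. -/
def incr (t : ℕ) (D : ℕ → ℤ → Bool) (k : ℤ) : ℝ := evol (t + 1) D 1 k - evol t D 1 k

theorem measurable_evol_one (t : ℕ) : Measurable fun D : ℕ → ℤ → Bool => evol t D 1 :=
  measurable_evol_comp t measurable_id measurable_const

theorem measurable_incr (t : ℕ) (k : ℤ) : Measurable fun D => incr t D k :=
  (measurable_pi_iff.1 (measurable_evol_one (t + 1)) k).sub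
    (measurable_pi_iff.1 (measurable_evol_one t) k)

/-- By linearity the increment is the image under `t` maps of the centred sequence `newgap 1 (D t) -
1`, so `sqBound_lattice` contracts `t` times. -/
theorem lintegral_sq_incr (t : ℕ) (k : ℤ) :
    ∫⁻ D, ENNReal.ofReal (incr t D k ^ 2) ∂choices ≤ ENNReal.ofReal (8 / 3 * (3 / 4) ^ t) := by
  have hd : Measurable fun d : ℤ → Bool => newgap 1 d - 1 := measurable_newgap_one.sub_const 1
  have hh : Measurable fun D : ℕ → ℤ → Bool => newgap 1 (D 0) - 1 := hd.comp (measurable_pi_apply 0)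
  have h1 : choices.map (fun D => newgap 1 (D 0) - 1) = palmCoins.map fun d => newgap 1 d - 1 := by
    rw [← (choices_eval 0).map_eq, Measure.map_map hd (choices_eval 0).measurable]
    rfl
  have hb : SqBound (8 / 3) (choices.map fun D => newgap 1 (D 0) - 1) := by
    rw [h1]
    exact sqBound_lattice
  have : IsProbabilityMeasure (choices.map fun D => newgap 1 (D 0) - 1) :=
    Measure.isProbabilityMeasure_map hh.aemeasurable
  have h3 := (hb.iterate (by norm_num) t).single k
  have h4 : ∀ D : ℕ → ℤ → Bool, evol t D (newgap 1 (D (0 + t)) - 1) = fun k => incr t D k := by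
    intro D
    rw [evol_sub, zero_add, ← evol_succ']
    rfl
  rw [← map_evol_choices hh t] at h3
  simp only [h4] at h3
  rwa [lintegral_map (by fun_prop) (measurable_pi_iff.2 fun k => measurable_incr t k)] at h3

theorem evol_one_eq_sum (t : ℕ) (D : ℕ → ℤ → Bool) (k : ℤ) :
    evol t D 1 k = 1 + ∑ s ∈ Finset.range t, incr s D k := by
  simp only [incr]
  rw [Finset.sum_range_sub (fun s => evol s D 1 k)]
  simp [evol]

theorem exists_limitGap : ∃ G : (ℕ → ℤ → Bool) → ℤ → ℝ, Measurable G ∧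
    ∀ᵐ D ∂choices, Tendsto (fun t => evol t D 1) atTop (𝓝 (G D)) := by
  refine measurable_limit_of_tendsto_metrizable_ae (fun t => (measurable_evol_one t).aemeasurable) ?_
  have : ∀ᵐ D ∂choices, ∀ k, Summable fun t => incr t D k := ae_all_iff.2 fun k =>
    ae_summable_of_sq (fun t => measurable_incr t k) (by norm_num) fun t => lintegral_sq_incr t k
  filter_upwards [this] with D hD
  refine ⟨fun k => 1 + ∑' t, incr t D k, tendsto_pi_nhds.2 fun k => ?_⟩
  simp only [evol_one_eq_sum]
  exact (hD k).hasSum.tendsto_sum_nat.const_add 1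

/-- The almost sure limit of the gaps, started from the integer lattice. -/
def limitGap : (ℕ → ℤ → Bool) → ℤ → ℝ := exists_limitGap.choose

theorem measurable_limitGap : Measurable limitGap := exists_limitGap.choose_spec.1

theorem tendsto_limitGap : ∀ᵐ D ∂choices, Tendsto (fun t => evol t D 1) atTop (𝓝 (limitGap D)) :=
  exists_limitGap.choose_spec.2

/-- The limit does not depend on the initial gaps. -/
theorem tendsto_evol {ν : Measure (ℤ → ℝ)} [IsProbabilityMeasure ν] {C : ℝ} (hC : 0 ≤ C)
    (hs : SqBound C (ν.map fun g => g - 1)) :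
    ∀ᵐ p ∂choices.prod ν, Tendsto (fun t => evol t p.1 p.2) atTop (𝓝 (limitGap p.1)) := by
  have hh : Measurable fun p : (ℕ → ℤ → Bool) × (ℤ → ℝ) => p.2 - 1 := measurable_snd.sub_const 1
  have hlaw : (choices.prod ν).map (fun p => p.2 - 1) = ν.map fun g => g - 1 := by
    have hm : Measurable fun g : ℤ → ℝ => g - 1 := measurable_id.sub_const 1
    have := Measure.map_map (μ := choices.prod ν) hm measurable_snd
    rw [Measure.map_snd_prod, measure_univ, one_smul] at this
    exact this.symm
  rw [← hlaw] at hs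
  have h1 := lintegral_sq_evol (h := fun _ g => g - 1) hh hC hs
  have hmeas : ∀ t k, Measurable fun p : (ℕ → ℤ → Bool) × (ℤ → ℝ) => evol t p.1 (p.2 - 1) k :=
    fun t k => measurable_pi_iff.1 (measurable_evol_comp t measurable_fst hh) k
  have h2 : ∀ᵐ p ∂choices.prod ν, ∀ k, Summable fun t => evol t p.1 (p.2 - 1) k :=
    ae_all_iff.2 fun k => ae_summable_of_sq (fun t => hmeas t k) hC fun t => h1 t k
  have h3 : ∀ᵐ p ∂choices.prod ν, Tendsto (fun t => evol t p.1 1) atTop (𝓝 (limitGap p.1)) :=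
    Measure.quasiMeasurePreserving_fst.ae tendsto_limitGap
  filter_upwards [h2, h3] with p hp2 hp3
  -- The centred initial gaps die out; what is left is the evolution of the unit lattice, which does
  -- not involve `p.2`.
  have h4 : Tendsto (fun t => evol t p.1 (p.2 - 1)) atTop (𝓝 0) :=
    tendsto_pi_nhds.2 fun k => (hp2 k).tendsto_atTop_zero
  have h5 := h4.add hp3
  simpa [← evol_add] using h5

/-- The law of the limiting gaps. -/
def limitLaw : Measure (ℤ → ℝ) := choices.map limitGap

instance : IsProbabilityMeasure limitLaw :=
  Measure.isProbabilityMeasure_map measurable_limitGap.aemeasurable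

theorem map_evol_one (t : ℕ) :
    choices.map (fun D => evol t D 1) = clusterMap^[t] (Measure.dirac 1) := by
  have := map_evol_choices (h := fun _ => 1) measurable_const t
  rwa [Measure.map_const, measure_univ, one_smul] at this

theorem isGapLaw_evol_one (t : ℕ) : IsGapLaw (choices.map fun D => evol t D 1) := by
  rw [map_evol_one]
  exact isGapLaw_dirac_one.iterate t

theorem isGood_evol_one : ∀ᵐ D ∂choices, ∀ t, IsGood (evol t D 1) :=
  ae_all_iff.2 fun t =>
    (ae_map_iff (measurable_evol_one t).aemeasurable measurableSet_isGood).1 (isGapLaw_evol_one t).good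

theorem limitLaw_preserving (i : ℤ) : MeasurePreserving (seqShift i) limitLaw limitLaw := by
  refine ⟨measurable_seqShift i, ?_⟩
  refine ext_of_forall_lintegral_eq_of_IsFiniteMeasure fun f => ?_
  have hf : Measurable fun g : ℤ → ℝ => (f g : ℝ≥0∞) := f.continuous.measurable.coe_nnreal_ennreal
  have hf' : Measurable fun g : ℤ → ℝ => (f (seqShift i g) : ℝ≥0∞) := hf.comp (measurable_seqShift i)
  rw [lintegral_map hf (measurable_seqShift i), limitLaw, lintegral_map hf' measurable_limitGap,
    lintegral_map hf measurable_limitGap]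
  have hcont : Continuous (seqShift i : (ℤ → ℝ) → ℤ → ℝ) :=
    continuous_pi fun j => continuous_apply (j + i)
  have key : ∀ φ : (ℤ → ℝ) → ℤ → ℝ, Continuous φ →
      Tendsto (fun t => ∫⁻ D, (f (φ (evol t D 1)) : ℝ≥0∞) ∂choices) atTop
        (𝓝 (∫⁻ D, (f (φ (limitGap D)) : ℝ≥0∞) ∂choices)) := by
    intro φ hφ
    obtain ⟨c, hc⟩ : ∃ c : NNReal, ∀ g, f g ≤ c := ⟨_, fun g => f.apply_le_nndist_zero g⟩
    refine tendsto_lintegral_of_dominated_convergence (fun _ => (c : ℝ≥0∞)) (fun t => ?_)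
      (fun t => Eventually.of_forall fun D => ENNReal.coe_le_coe.2 (hc _)) (by simp) ?_
    · exact (hf.comp hφ.measurable).comp (measurable_evol_one t)
    · filter_upwards [tendsto_limitGap] with D hD
      exact (ENNReal.continuous_coe.comp (f.continuous.comp hφ)).continuousAt.tendsto.comp hD
  refine tendsto_nhds_unique (key _ hcont) ?_
  have : ∀ t, ∫⁻ D, (f (seqShift i (evol t D 1)) : ℝ≥0∞) ∂choices =
      ∫⁻ D, (f (evol t D 1) : ℝ≥0∞) ∂choices := by
    intro t
    rw [← lintegral_map hf' (measurable_evol_one t), ← lintegral_map hf (measurable_evol_one t)]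
    exact ((isGapLaw_evol_one t).preserving i).lintegral_comp hf
  simp only [this]
  exact key id continuous_id

/-- Integrals over events of the leftmost gap converge. -/
theorem tendsto_setLIntegral_evol_one (E : ℕ → Set (ℕ → ℤ → Bool)) {F : Set (ℕ → ℤ → Bool)}
    (hE : ∀ t, E t =ᵐ[choices] F) :
    Tendsto (fun t => ∫⁻ D in E t, ENNReal.ofReal (evol t D 1 0) ∂choices) atTop
      (𝓝 (∫⁻ D in F, ENNReal.ofReal (limitGap D 0) ∂choices)) := by
  simp only [Measure.restrict_congr_set (hE _)]
  -- The sum of the absolute increments is integrable and dominates all times at once, so no mean is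
  -- lost in the limit.
  refine tendsto_lintegral_of_dominated_convergence (fun D => 1 + ∑' t, ‖incr t D 0‖ₑ)
    (fun t => ENNReal.measurable_ofReal.comp (measurable_pi_iff.1 (measurable_evol_one t) 0))
    (fun t => Eventually.of_forall fun D => ?_) ?_ ?_
  · dsimp only
    rw [evol_one_eq_sum]
    refine (ENNReal.ofReal_add_le).trans ?_
    rw [ENNReal.ofReal_one]
    gcongr
    refine (Real.ofReal_le_enorm _).trans ((enorm_sum_le _ _).trans (ENNReal.sum_le_tsum _))
  · refine ((setLIntegral_le_lintegral _ _).trans_lt ?_).ne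
    rw [lintegral_add_left measurable_const, lintegral_const, measure_univ, mul_one]
    exact ENNReal.add_lt_top.2 ⟨ENNReal.one_lt_top, (tsum_lintegral_enorm_ne_top
      (fun t => measurable_incr t 0) (by norm_num) fun t => lintegral_sq_incr t 0).lt_top⟩
  · refine ae_restrict_of_ae ?_
    filter_upwards [tendsto_limitGap] with D hD
    exact (ENNReal.continuous_ofReal.tendsto _).comp (tendsto_pi_nhds.1 hD 0)

theorem lintegral_limitGap : ∫⁻ D, ENNReal.ofReal (limitGap D 0) ∂choices = 1 := by
  have h := tendsto_setLIntegral_evol_one (fun _ => univ) (fun _ => ae_eq_rfl) (F := univ)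
  simp only [Measure.restrict_univ] at h
  refine tendsto_nhds_unique h ?_
  have : ∀ t, ∫⁻ D, ENNReal.ofReal (evol t D 1 0) ∂choices = 1 := fun t => by
    rw [← (isGapLaw_evol_one t).mean, lintegral_map (by fun_prop) (measurable_evol_one t)]
  simp only [this]
  exact tendsto_const_nhds

theorem limitGap_nonneg : ∀ᵐ D ∂choices, ∀ i, 0 ≤ limitGap D i := by
  filter_upwards [tendsto_limitGap, isGood_evol_one] with D h1 h2 i
  exact ge_of_tendsto' (tendsto_pi_nhds.1 h1 i) fun t => ((h2 t).1 i).le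

/-- The limiting gaps solve the recursion. -/
theorem limitGap_eq : ∀ᵐ D ∂choices, limitGap D = newgap (limitGap fun n => D (n + 1)) (D 0) := by
  filter_upwards [tendsto_limitGap, (choices_tail 1).quasiMeasurePreserving.ae tendsto_limitGap]
    with D h1 h2
  refine tendsto_nhds_unique ((tendsto_add_atTop_iff_nat 1).2 h1) ?_
  exact ((continuous_newgap (D 0)).tendsto _).comp h2

/-- Let `E` be the event that the limiting gap vanishes. The recursion makes `E` invariant under
dropping the first `t` directions, up to null sets, so `E` is almost surely decided by directions
that the first `t` maps do not use. The mean of `evol t D 1 0` over `E` is therefore the probability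
of `E` for every `t`, while its limit is the integral of `limitGap D 0` over `E`, which is zero. -/
theorem limitGap_zero_pos : ∀ᵐ D ∂choices, 0 < limitGap D 0 := by
  set E : Set (ℕ → ℤ → Bool) := {D | limitGap D 0 = 0} with hE
  have hmE : MeasurableSet E :=
    (measurable_pi_iff.1 measurable_limitGap 0) (measurableSet_singleton 0)
  have hsub : ∀ t, (fun (D : ℕ → ℤ → Bool) n => D (n + t)) ⁻¹' E =ᵐ[choices] E := by
    have h1 : E =ᵐ[choices] (fun (D : ℕ → ℤ → Bool) n => D (n + 1)) ⁻¹' E := by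
      -- A new gap dominates a positive multiple of the old gap at the origin, so vanishing passes
      -- to the shifted directions. This gives an inclusion between events of equal probability.
      refine ae_eq_of_ae_subset_of_measure_ge ?_ ?_ hmE.nullMeasurableSet (measure_ne_top _ _)
      · filter_upwards [limitGap_eq, (choices_tail 1).quasiMeasurePreserving.ae limitGap_nonneg]
          with D h1 h2 (hD : limitGap D 0 = 0)
        rw [h1, newgap_zero] at hD
        have h3 : 0 ≤ {d : ℤ → Bool | nxt d 0 = 2}.indicator (fun _ => 3 / 8 *
            (limitGap (fun n => D (n + 1)) 1 + limitGap (fun n => D (n + 1)) 2)) (D 0) :=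
          indicator_nonneg (fun _ _ => by have := h2 1; have := h2 2; positivity) _
        have := h2 0
        have := h2 1
        change limitGap (fun n => D (n + 1)) 0 = 0
        linarith
      · exact ((choices_tail 1).measure_preimage hmE.nullMeasurableSet).le
    intro t
    induction t with
    | zero => exact ae_eq_rfl
    | succ t ih =>
      have := (choices_tail 1).quasiMeasurePreserving.preimage_ae_eq ih
      exact this.trans h1.symm
  -- A random constant sequence, hence shift invariant. Conservation of the mean for it encodes the
  -- independence of the first `t` directions from the later ones.
  set h : (ℕ → ℤ → Bool) → ℤ → ℝ := fun D => E.indicator (fun _ => (1 : ℝ)) D • (1 : ℤ → ℝ) with hh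
  have hmh : Measurable h := measurable_pi_iff.2 fun i => by
    simp only [hh, Pi.smul_apply, smul_eq_mul, Pi.one_apply, mul_one]
    exact measurable_const.indicator hmE
  have : IsProbabilityMeasure (choices.map h) := Measure.isProbabilityMeasure_map hmh.aemeasurable
  have hinv : ∀ i, MeasurePreserving (seqShift i) (choices.map h) (choices.map h) := fun i => by
    refine ⟨measurable_seqShift i, ?_⟩
    rw [Measure.map_map (measurable_seqShift i) hmh]
    rfl
  have hnn : ∀ᵐ g ∂choices.map h, ∀ i, 0 ≤ g i := by
    refine (ae_map_iff hmh.aemeasurable ?_).2 (Eventually.of_forall fun D i => ?_)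
    · simp only [ofPred_forall]
      exact MeasurableSet.iInter fun i => measurableSet_le measurable_const (measurable_pi_apply i)
    · simp only [hh, Pi.smul_apply, smul_eq_mul, Pi.one_apply, mul_one]
      exact indicator_nonneg (fun _ _ => zero_le_one) _
  have hconst : ∀ t, ∫⁻ D in (fun (D : ℕ → ℤ → Bool) n => D (n + t)) ⁻¹' E,
      ENNReal.ofReal (evol t D 1 0) ∂choices = choices E := by
    intro t
    have e1 := lintegral_iterate_zero hinv hnn t
    have hm1 : Measurable fun D : ℕ → ℤ → Bool => evol t D (h fun n => D (n + t)) :=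
      measurable_evol_comp t measurable_id (hmh.comp (choices_tail t).measurable)
    rw [← map_evol_choices hmh, lintegral_map (by fun_prop) hm1, lintegral_map (by fun_prop) hmh] at e1
    have e2 : ∫⁻ D, ENNReal.ofReal (h D 0) ∂choices = choices E := by
      rw [← lintegral_indicator_one hmE]
      refine lintegral_congr fun D => ?_
      by_cases hD : D ∈ E <;> simp [hh, hD]
    rw [← e2, ← e1, ← lintegral_indicator ((choices_tail t).measurable hmE)]
    refine lintegral_congr fun D => ?_
    simp only [hh, evol_smul]
    by_cases hD : (fun n => D (n + t)) ∈ E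
    · rw [indicator_of_mem (show D ∈ (fun (D : ℕ → ℤ → Bool) n => D (n + t)) ⁻¹' E from hD),
        indicator_of_mem hD, one_smul]
    · rw [indicator_of_notMem (show D ∉ (fun (D : ℕ → ℤ → Bool) n => D (n + t)) ⁻¹' E from hD),
        indicator_of_notMem hD, zero_smul]
      simp
  have hlim := tendsto_setLIntegral_evol_one _ hsub
  simp only [hconst] at hlim
  have hz : ∫⁻ D in E, ENNReal.ofReal (limitGap D 0) ∂choices = 0 := by
    rw [setLIntegral_congr_fun hmE (g := fun _ => 0) fun D hD => by
      rw [show limitGap D 0 = 0 from hD, ENNReal.ofReal_zero]]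
    simp
  rw [hz] at hlim
  have hE0 : choices E = 0 := tendsto_nhds_unique tendsto_const_nhds hlim
  have hE0' : ∀ᵐ D ∂choices, D ∉ E := measure_eq_zero_iff_ae_notMem.1 hE0
  filter_upwards [limitGap_nonneg, hE0'] with D h1 h2
  exact lt_of_le_of_ne (h1 0) (Ne.symm h2)

/-! ### Recurrence -/

theorem not_tendsto_of_frequently {x : ℕ → ℝ} {c : ℝ} (hc : 0 < c)
    (h : ∃ᶠ k in atTop, c < x (k + 1) - x k) (l : ℝ) : ¬ Tendsto x atTop (𝓝 l) := by
  intro hx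
  have h1 := ((tendsto_add_atTop_iff_nat 1).2 hx).sub hx
  rw [sub_self] at h1
  obtain ⟨k, hk1, hk2⟩ := (h.and_eventually (h1.eventually_lt_const hc)).exists
  linarith

theorem exists_gt_of_frequently {x : ℕ → ℝ} (hx : Monotone x) {c : ℝ} (hc : 0 < c)
    (h : ∃ᶠ k in atTop, c < x (k + 1) - x k) (a : ℝ) : ∃ k, a < x k := by
  by_contra! hcon
  exact not_tendsto_of_frequently hc h _
    (tendsto_atTop_ciSup hx ⟨a, by rintro _ ⟨k, rfl⟩; exact hcon k⟩)

theorem seqShift_iterate {α : Type*} (i : ℤ) (g : ℤ → α) (k : ℕ) :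
    (seqShift i)^[k] g = seqShift (k * i) g := by
  induction k with
  | zero => funext j; simp [seqShift]
  | succ k ih =>
    rw [Function.iterate_succ_apply', ih, seqShift_seqShift]
    congr 1
    push_cast
    ring

/-- A stationary positive sequence exceeds some level infinitely often in each direction. -/
theorem frequently_gt {ν : Measure (ℤ → ℝ)} [IsProbabilityMeasure ν] {i : ℤ}
    (hν : MeasurePreserving (seqShift i) ν ν) (h0 : ∀ᵐ g ∂ν, 0 < g 0) :
    ∀ᵐ g ∂ν, ∃ c > 0, ∃ᶠ k : ℕ in atTop, c < g (k * i) := by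
  have h1 : ∀ᵐ g ∂ν, ∀ n : ℕ, 1 / ((n : ℝ) + 1) < g 0 →
      ∃ᶠ k : ℕ in atTop, 1 / ((n : ℝ) + 1) < g (k * i) := by
    refine ae_all_iff.2 fun n => ?_
    have hs : MeasurableSet {g : ℤ → ℝ | 1 / ((n : ℝ) + 1) < g 0} :=
      measurableSet_lt measurable_const (measurable_pi_apply 0)
    -- Poincaré recurrence: almost every sequence whose gap at the origin exceeds the level does so
    -- again infinitely often along the shifts.
    filter_upwards [hν.conservative.ae_mem_imp_frequently_image_mem hs.nullMeasurableSet] with g hg h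
    refine (hg h).mono fun k hk => ?_
    rw [seqShift_iterate] at hk
    simpa [seqShift] using hk
  filter_upwards [h0, h1] with g h0 h1
  obtain ⟨n, hn⟩ := exists_nat_one_div_lt h0
  exact ⟨_, by positivity, h1 n hn⟩

/-- Infinitely many gaps above a fixed positive level in each direction force the positions to
diverge both ways. -/
theorem isGood_of_stationary {ν : Measure (ℤ → ℝ)} [IsProbabilityMeasure ν]
    (hν : ∀ i, MeasurePreserving (seqShift i) ν ν) (h0 : ∀ᵐ g ∂ν, 0 < g 0) :
    ∀ᵐ g ∂ν, IsGood g := by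
  have hpos : ∀ᵐ g ∂ν, ∀ i : ℤ, 0 < g i := ae_all_iff.2 fun i => by
    filter_upwards [(hν i).quasiMeasurePreserving.ae h0] with g hg
    simpa [seqShift] using hg
  filter_upwards [hpos, frequently_gt (hν 1) h0, frequently_gt (hν (-1)) h0]
    with g hg ⟨c, hc, h1⟩ ⟨c', hc', h2⟩
  have hmono : StrictMono (pos g) :=
    strictMono_int_of_lt_succ fun i => by rw [pos_succ]; linarith [hg i]
  refine ⟨hg, fun a => ?_, fun a => ?_⟩
  · obtain ⟨k, hk⟩ := exists_gt_of_frequently (x := fun k : ℕ => pos g k)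
      (fun i j hij => hmono.monotone (by exact_mod_cast hij)) hc (h1.mono fun k hk => by
        push_cast
        rw [pos_succ]
        simpa using hk) a
    exact ⟨k, hk⟩
  · have h3 : ∃ᶠ k : ℕ in atTop, c' < -pos g (-((k + 1 : ℕ) : ℤ) + 1) - -pos g (-(k : ℤ) + 1) := by
      refine h2.mono fun k hk => ?_
      have e : pos g (-(k : ℤ) + 1) = pos g (-(k : ℤ)) + g (-(k : ℤ)) := pos_succ _ _
      rw [show -((k + 1 : ℕ) : ℤ) + 1 = -(k : ℤ) by push_cast; ring, e]
      simp only [mul_neg, mul_one] at hk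
      linarith
    obtain ⟨k, hk⟩ := exists_gt_of_frequently (x := fun k : ℕ => -pos g (-(k : ℤ) + 1))
      (fun i j hij => neg_le_neg (hmono.monotone (by
        have : (i : ℤ) ≤ j := by exact_mod_cast hij
        linarith))) hc' h3 (-a)
    exact ⟨_, by linarith⟩

theorem isGapLaw_limitLaw : IsGapLaw limitLaw where
  isProb := inferInstance
  preserving := limitLaw_preserving
  good := isGood_of_stationary limitLaw_preserving (by
    rw [limitLaw, ae_map_iff measurable_limitGap.aemeasurable
      (measurableSet_lt measurable_const (measurable_pi_apply 0))]
    exact limitGap_zero_pos)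
  mean := by
    rw [limitLaw, lintegral_map (by fun_prop) measurable_limitGap]
    exact lintegral_limitGap


/-! ### Weak convergence from almost sure convergence -/

/-- Fatou's lemma gives the lower bound on open sets, which suffices because all total masses are
one. The measure `m` itself may be infinite, as happens for an observer distributed by Lebesgue
measure and restricted to a random gap. -/
theorem weakConv_of_ae {α E : Type*} [MeasurableSpace α] {m : Measure α} [TopologicalSpace E]
    [MeasurableSpace E] [OpensMeasurableSpace E] {A : ℕ → Set α} {A' : Set α} {Y : ℕ → α → E}
    {Y' : α → E} (hA : ∀ t, MeasurableSet (A t)) (hA' : MeasurableSet A') (hY : ∀ t, Measurable (Y t))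
    (hY' : Measurable Y') (hP : ∀ t, IsProbabilityMeasure ((m.restrict (A t)).map (Y t)))
    (hQ : IsProbabilityMeasure ((m.restrict A').map Y'))
    (h : ∀ᵐ a ∂m, a ∈ A' → (∀ᶠ t in atTop, a ∈ A t) ∧ Tendsto (fun t => Y t a) atTop (𝓝 (Y' a))) :
    WeakConv (fun t => (m.restrict (A t)).map (Y t)) ((m.restrict A').map Y') := by
  refine ⟨hP, hQ, tendsto_of_forall_isOpen_le_liminf' fun G hG => ?_⟩
  have e : ∀ (B : Set α) (Z : α → E), MeasurableSet B → Measurable Z →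
      (m.restrict B).map Z G = ∫⁻ a, (Z ⁻¹' G ∩ B).indicator 1 a ∂m := fun B Z hB hZ => by
    have hZG := hZ hG.measurableSet
    rw [Measure.map_apply hZ hG.measurableSet, Measure.restrict_apply hZG,
      lintegral_indicator_one (hZG.inter hB)]
  change (m.restrict A').map Y' G ≤ liminf (fun t => (m.restrict (A t)).map (Y t) G) atTop
  rw [e _ _ hA' hY']
  simp only [e _ _ (hA _) (hY _)]
  refine le_trans (lintegral_mono_ae ?_) (lintegral_liminf_le fun t =>
    measurable_one.indicator (((hY t) hG.measurableSet).inter (hA t)))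
  filter_upwards [h] with a ha
  by_cases haG : a ∈ Y' ⁻¹' G ∩ A'
  · obtain ⟨h1, h2⟩ := ha haG.2
    rw [indicator_of_mem haG, Pi.one_apply]
    refine le_liminf_of_le (by isBoundedDefault) ?_
    filter_upwards [h1, h2.eventually (hG.mem_nhds haG.1)] with t ht1 ht2
    rw [indicator_of_mem (show a ∈ Y t ⁻¹' G ∩ A t from ⟨ht2, ht1⟩), Pi.one_apply]
  · rw [indicator_of_notMem haG]
    exact zero_le

theorem invPalm_map {α : Type*} [MeasurableSpace α] {m : Measure α} [IsProbabilityMeasure m]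
    {W : α → ℤ → ℝ} (hW : Measurable W) : invPalm (m.map W) =
      ((m.prod volume).restrict {q | q.2 ∈ Ico 0 (W q.1 0)}).map
        fun q => (conf (W q.1)).shift q.2 := by
  have h1 : (m.map W).prod (volume : Measure ℝ) = (m.prod volume).map (Prod.map W id) := by
    conv_lhs => rw [← Measure.map_id (μ := (volume : Measure ℝ))]
    exact Measure.map_prod_map _ _ hW measurable_id
  rw [invPalm, h1, Measure.restrict_map (hW.prodMap measurable_id) measurableSet_mem_Ico,
    Measure.map_map measurable_shift_conf (hW.prodMap measurable_id)]
  rfl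

theorem measurable_shift_conf_comp {α : Type*} [MeasurableSpace α] {W : α → ℤ → ℝ}
    (hW : Measurable W) : Measurable fun q : α × ℝ => (conf (W q.1)).shift q.2 :=
  measurable_shift_conf.comp ((hW.comp measurable_fst).prodMk measurable_snd)

theorem measurableSet_mem_Ico_comp {α : Type*} [MeasurableSpace α] {W : α → ℤ → ℝ}
    (hW : Measurable W) : MeasurableSet {q : α × ℝ | q.2 ∈ Ico 0 (W q.1 0)} :=
  (hW.prodMap measurable_id) measurableSet_mem_Ico

theorem pt_shift_conf {g : ℤ → ℝ} (hg : IsGood g) {s : ℝ} (hs : s ∈ Ico 0 (g 0)) (i : ℤ) :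
    ((conf g).shift s).pt i = pos g i - s := by
  have h := Config.pt_shift (conf g) (s := s) (i := 0) (by rw [pt_conf hg, pos_zero]; exact hs.1)
    (by rw [pt_conf hg, zero_add, pos_one]; exact hs.2) i
  rw [h, pt_conf hg, add_zero]

section

variable {α : Type*} [MeasurableSpace α] {m : Measure α} [IsProbabilityMeasure m]
  {W : ℕ → α → ℤ → ℝ} {W' : α → ℤ → ℝ}

/-- Almost sure convergence of the gaps implies weak convergence of functionals of the associated
stationary point processes that are almost surely continuous in the points. -/
theorem weakConv_invPalm (hW : ∀ t, Measurable (W t)) (hW' : Measurable W')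
    (hlaw : ∀ t, IsGapLaw (m.map (W t))) (hlaw' : IsGapLaw (m.map W'))
    (hlim : ∀ᵐ a ∂m, Tendsto (fun t => W t a) atTop (𝓝 (W' a))) {E : Type*} [TopologicalSpace E]
    [MeasurableSpace E] [OpensMeasurableSpace E] {Φ : Config → E} (hΦ : Measurable Φ) {N : Set Config}
    (hN : invPalm (m.map W') N = 0)
    (hcont : ∀ (ξ : ℕ → Config) (ξ' : Config), ξ' ∉ N →
      (∀ i, Tendsto (fun t => (ξ t).pt i) atTop (𝓝 (ξ'.pt i))) →
        Tendsto (fun t => Φ (ξ t)) atTop (𝓝 (Φ ξ'))) :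
    WeakConv (fun t => (invPalm (m.map (W t))).map Φ) ((invPalm (m.map W')).map Φ) := by
  have e : ∀ V : α → ℤ → ℝ, Measurable V → (invPalm (m.map V)).map Φ =
      ((m.prod volume).restrict {q | q.2 ∈ Ico 0 (V q.1 0)}).map
        fun q => Φ ((conf (V q.1)).shift q.2) := fun V hV => by
    rw [invPalm_map hV, Measure.map_map hΦ (measurable_shift_conf_comp hV)]
    rfl
  have hprob : ∀ V : α → ℤ → ℝ, IsGapLaw (m.map V) →
      IsProbabilityMeasure ((invPalm (m.map V)).map Φ) := fun V hV => by
    have := hV.isProbabilityMeasure_invPalm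
    exact Measure.isProbabilityMeasure_map hΦ.aemeasurable
  have hp := fun t => hprob _ (hlaw t)
  have hp' := hprob _ hlaw'
  rw [invPalm_map hW'] at hN
  have hN1 := ae_of_ae_map (measurable_shift_conf_comp hW').aemeasurable
    (measure_eq_zero_iff_ae_notMem.1 hN)
  rw [ae_restrict_iff' (measurableSet_mem_Ico_comp hW')] at hN1
  rw [e W' hW'] at hp' ⊢
  simp only [e (W _) (hW _)] at hp ⊢
  refine weakConv_of_ae (fun t => measurableSet_mem_Ico_comp (hW t)) (measurableSet_mem_Ico_comp hW')
    (fun t => hΦ.comp (measurable_shift_conf_comp (hW t)))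
    (hΦ.comp (measurable_shift_conf_comp hW')) hp hp' ?_
  have hg : ∀ᵐ a ∂m, ∀ t, IsGood (W t a) := ae_all_iff.2 fun t =>
    (ae_map_iff (hW t).aemeasurable measurableSet_isGood).1 (hlaw t).good
  have hg' : ∀ᵐ a ∂m, IsGood (W' a) :=
    (ae_map_iff hW'.aemeasurable measurableSet_isGood).1 hlaw'.good
  have hall : ∀ᵐ a ∂m, Tendsto (fun t => W t a) atTop (𝓝 (W' a)) ∧ (∀ t, IsGood (W t a)) ∧
      IsGood (W' a) := hlim.and (hg.and hg')
  have hall' := (Measure.quasiMeasurePreserving_fst (μ := m) (ν := (volume : Measure ℝ))).ae hall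
  filter_upwards [hN1, hall'] with q hq ⟨h1, h2, h3⟩ (hs : q.2 ∈ Ico 0 (W' q.1 0))
  -- The limiting gap strictly exceeds the location of the observer, so nearby gaps do too, and the
  -- indices of the points seen by the observer agree.
  have hev : ∀ᶠ t in atTop, q.2 ∈ Ico 0 (W t q.1 0) := by
    filter_upwards [(tendsto_pi_nhds.1 h1 0).eventually_const_lt hs.2] with t ht using ⟨hs.1, ht⟩
  refine ⟨hev, hcont _ _ (hq hs) fun i => ?_⟩
  rw [pt_shift_conf h3 hs]
  refine Tendsto.congr' ?_ ((((continuous_pos i).tendsto _).comp h1).sub_const q.2)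
  filter_upwards [hev] with t ht
  exact (pt_shift_conf (h2 t) ht i).symm

end

theorem tendsto_conf {g : ℕ → ℤ → ℝ} {g' : ℤ → ℝ} (hg : ∀ t, IsGood (g t)) (hg' : IsGood g')
    (h : Tendsto g atTop (𝓝 g')) : Tendsto (fun t => conf (g t)) atTop (𝓝 (conf g')) := by
  refine (Config.continuous_ofEnum.tendsto (gapEnum g')).comp (tendsto_subtype_rng.2 ?_)
  simp only [gapEnum_val (hg _), gapEnum_val hg']
  exact tendsto_pi_nhds.2 fun i => ((continuous_pos i).tendsto _).comp h

theorem weakConv_map_conf {α : Type*} [MeasurableSpace α] {m : Measure α} {W : ℕ → α → ℤ → ℝ}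
    {W' : α → ℤ → ℝ} (hW : ∀ t, Measurable (W t)) (hW' : Measurable W')
    (hlaw : ∀ t, IsGapLaw (m.map (W t))) (hlaw' : IsGapLaw (m.map W'))
    (hlim : ∀ᵐ a ∂m, Tendsto (fun t => W t a) atTop (𝓝 (W' a))) :
    WeakConv (fun t => (m.map (W t)).map conf) ((m.map W').map conf) := by
  have e : ∀ V : α → ℤ → ℝ, Measurable V → (m.map V).map conf =
      (m.restrict univ).map fun a => conf (V a) := fun V hV => by
    rw [Measure.map_map measurable_conf hV, Measure.restrict_univ]
    rfl
  have hprob : ∀ V : α → ℤ → ℝ, IsGapLaw (m.map V) →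
      IsProbabilityMeasure ((m.map V).map conf) := fun V hV => by
    have := hV.isProb
    exact Measure.isProbabilityMeasure_map measurable_conf.aemeasurable
  have hp := fun t => hprob _ (hlaw t)
  have hp' := hprob _ hlaw'
  rw [e W' hW'] at hp' ⊢
  simp only [e (W _) (hW _)] at hp ⊢
  have hg : ∀ᵐ a ∂m, ∀ t, IsGood (W t a) := ae_all_iff.2 fun t =>
    (ae_map_iff (hW t).aemeasurable measurableSet_isGood).1 (hlaw t).good
  have hg' : ∀ᵐ a ∂m, IsGood (W' a) :=
    (ae_map_iff hW'.aemeasurable measurableSet_isGood).1 hlaw'.good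
  refine weakConv_of_ae (fun _ => MeasurableSet.univ) MeasurableSet.univ
    (fun t => measurable_conf.comp (hW t)) (measurable_conf.comp hW') hp hp' ?_
  filter_upwards [hlim, hg, hg'] with a h1 h2 h3 _
  exact ⟨Eventually.of_forall fun _ => mem_univ _, tendsto_conf h2 h3 h1⟩

/-- The number of points in a bounded set is continuous in the points, if there are none on the
boundary. -/
theorem eventually_count_eq {ξ : ℕ → Config} {ξ' : Config} {B : Set ℝ} (hB : Bornology.IsBounded B)
    (hξ : ∀ i, Tendsto (fun t => (ξ t).pt i) atTop (𝓝 (ξ'.pt i)))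
    (hfr : ¬ (ξ'.carrier ∩ frontier B).Nonempty) : ∀ᶠ t in atTop, (ξ t).count B = ξ'.count B := by
  obtain ⟨M, hM⟩ := hB.subset_closedBall 0
  obtain ⟨lo, hlo⟩ : ∃ i, ξ'.pt i < -M := by
    obtain ⟨x, hx, h⟩ := ξ'.exists_lt (-M)
    rw [← ξ'.range_pt] at hx
    obtain ⟨i, rfl⟩ := hx
    exact ⟨i, h⟩
  obtain ⟨hi, hhi⟩ : ∃ i, M < ξ'.pt i := by
    obtain ⟨x, hx, h⟩ := ξ'.exists_gt M
    rw [← ξ'.range_pt] at hx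
    obtain ⟨i, rfl⟩ := hx
    exact ⟨i, h⟩
  have hmem : ∀ i, ∀ᶠ t in atTop, (ξ t).pt i ∈ B ↔ ξ'.pt i ∈ B := by
    intro i
    have hc : ξ'.pt i ∈ ξ'.carrier := ξ'.range_pt ▸ mem_range_self i
    have hn : ξ'.pt i ∉ frontier B := fun hf => hfr ⟨_, hc, hf⟩
    by_cases hi : ξ'.pt i ∈ B
    · have hint : ξ'.pt i ∈ interior B := by
        by_contra h
        exact hn ⟨subset_closure hi, h⟩
      filter_upwards [(hξ i).eventually (isOpen_interior.mem_nhds hint)] with t ht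
      exact ⟨fun _ => hi, fun _ => interior_subset ht⟩
    · have hcl : ξ'.pt i ∈ (closure B)ᶜ := fun h => hn ⟨h, fun h' => hi (interior_subset h')⟩
      filter_upwards [(hξ i).eventually (isClosed_closure.isOpen_compl.mem_nhds hcl)] with t ht
      exact ⟨fun h => absurd (subset_closure h) ht, fun h => absurd h hi⟩
  have hfin : ∀ᶠ t in atTop, ∀ i ∈ Icc lo hi, (ξ t).pt i ∈ B ↔ ξ'.pt i ∈ B :=
    (eventually_all_finite (finite_Icc lo hi)).2 fun i _ => hmem i
  have hout : ∀ η : Config, η.pt lo < -M → M < η.pt hi → ∀ i, η.pt i ∈ B → i ∈ Icc lo hi := by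
    intro η h1 h2 i hiB
    have h3 := hM hiB
    rw [Metric.mem_closedBall, dist_zero_right, Real.norm_eq_abs, abs_le] at h3
    exact ⟨(η.pt_strictMono.lt_iff_lt.1 (h1.trans_le h3.1)).le,
      (η.pt_strictMono.lt_iff_lt.1 (h3.2.trans_lt h2)).le⟩
  filter_upwards [hfin, (hξ lo).eventually_lt_const hlo, (hξ hi).eventually_const_lt hhi]
    with t h1 h2 h3
  rw [Config.count_eq_ncard, Config.count_eq_ncard]
  congr 1
  ext i
  refine ⟨fun h => (h1 i (hout _ h2 h3 i h)).1 h, fun h => (h1 i (hout _ hlo hhi i h)).2 h⟩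

/-! ### Renewal processes and their evolution -/

/-- The gaps have a product law with equal factors, hence a stationary one. Their mean is one
because Palm inversion writes the probability measure `P` as `invPalm` of this law, with total mass
the mean gap. -/
theorem IsUnitRenewal.isGapLaw {P : Measure Config} [IsProbabilityMeasure P] (h : IsUnitRenewal P) :
    IsGapLaw ((palm P).map Config.gap) := by
  have hprob : IsProbabilityMeasure (palm P) := h.indep.isProbabilityMeasure
  have hgap : ∀ i, IsProbabilityMeasure ((palm P).map fun ξ => ξ.gap i) := fun i =>
    Measure.isProbabilityMeasure_map (Config.measurable_gap i).aemeasurable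
  have hpi : (palm P).map Config.gap =
      Measure.infinitePi fun _ : ℤ => (palm P).map fun ξ => ξ.gap 0 := by
    have h1 := h.indep.map_fun_eq_infinitePi_map Config.measurable_gap
    simp only [(h.ident _).map_eq] at h1
    exact h1
  have hp : IsProbabilityMeasure ((palm P).map Config.gap) :=
    Measure.isProbabilityMeasure_map measurable_gap_seq.aemeasurable
  refine ⟨hp, fun i => ?_, ?_, ?_⟩
  · rw [hpi]
    exact infinitePi_seqShift_preserving _ i
  · exact (ae_map_iff measurable_gap_seq.aemeasurable measurableSet_isGood).2
      (Eventually.of_forall Config.isGood_gap)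
  · have h1 := lintegral_invPalm ((palm P).map Config.gap) (f := fun _ => 1) measurable_const
    rw [← h.stationary.eq_invPalm h.intensity_eq] at h1
    simp only [lintegral_const, mul_one, measure_univ] at h1
    rw [h1]
    refine lintegral_congr fun g => ?_
    rw [lintegral_indicator measurableSet_Ico]
    simp

theorem IsUnitRenewal.sqBound {P : Measure Config} [IsProbabilityMeasure P] (h : IsUnitRenewal P)
    (h2 : MemLp (fun ξ : Config => ξ.gap 0) 2 (palm P)) :
    SqBound (variance (fun ξ : Config => ξ.gap 0) (palm P))
      (((palm P).map Config.gap).map fun g => g - 1) := by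
  have hprob : IsProbabilityMeasure (palm P) := h.indep.isProbabilityMeasure
  have hint : ∫ ξ, ξ.gap 0 ∂palm P = 1 := by
    have h1 := h.isGapLaw.mean
    rw [lintegral_map (by fun_prop) measurable_gap_seq,
      ← ofReal_integral_eq_lintegral_ofReal (h2.integrable one_le_two)
        (Eventually.of_forall fun ξ => (ξ.isGood_gap.1 0).le)] at h1
    exact ENNReal.ofReal_eq_one.1 h1
  have hm : Measurable fun g : ℤ → ℝ => g - 1 := measurable_id.sub_const 1
  rw [Measure.map_map hm measurable_gap_seq]
  exact sqBound_of_iIndepFun (X := fun i ξ => Config.gap ξ i) Config.measurable_gap h.indep h.ident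
    h2 hint

section Evolution

variable {Ω : Type*} [MeasurableSpace Ω] {μ : Measure Ω} [IsProbabilityMeasure μ]
  {Ξ : ℕ → Ω → Config} {dir : ℕ → ℤ → Ω → Bool}

theorem IsClustering.map_dir (h : IsClustering μ Ξ dir) :
    μ.map (fun ω t i => dir t i ω) = Measure.infinitePi fun _ : ℕ => coins := by
  have hp : ∀ p : ℕ × ℤ, μ.map (dir p.1 p.2) = coin := fun p => by
    have : IsProbabilityMeasure (μ.map (dir p.1 p.2)) :=
      Measure.isProbabilityMeasure_map (h.measurable_dir _ _).aemeasurable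
    refine eq_coin ?_
    rw [Measure.map_apply (h.measurable_dir _ _) (measurableSet_singleton _)]
    exact h.fair p.1 p.2
  have h1 := h.indep_dir.map_fun_eq_infinitePi_map fun p : ℕ × ℤ => h.measurable_dir p.1 p.2
  simp only [hp] at h1
  have h2 := Measure.infinitePi_map_curry fun (_ : ℕ) (_ : ℤ) => coin
  have hm : Measurable fun ω (p : ℕ × ℤ) => dir p.1 p.2 ω :=
    measurable_pi_iff.2 fun p => h.measurable_dir p.1 p.2
  rw [← h1, Measure.map_map (MeasurableEquiv.measurable _) hm] at h2
  exact h2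

/-- The directions still to come are carried along so that their independence of the present
configuration is part of the induction. Numbering the points anew from the origin at each time does
no harm to it. -/
theorem IsClustering.joint_law (h : IsClustering μ Ξ dir) {ν : Measure (ℤ → ℝ)} (hν : IsGapLaw ν)
    (h0 : μ.map (Ξ 0) = invPalm ν) (t : ℕ) : AEMeasurable (Ξ t) μ ∧
      μ.map (fun ω => (Ξ t ω, fun s i => dir (s + t) i ω)) =
        (invPalm (clusterMap^[t] ν)).prod (Measure.infinitePi fun _ : ℕ => coins) := by
  have hdir : ∀ t, Measurable fun ω => fun s i => dir (s + t) i ω := fun t =>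
    measurable_pi_iff.2 fun s => measurable_pi_iff.2 fun i => h.measurable_dir (s + t) i
  induction t with
  | zero =>
    refine ⟨h.measurable_init.aemeasurable, ?_⟩
    have hcurry : Measurable fun (x : ℕ × ℤ → Bool) (s : ℕ) (i : ℤ) => x (s, i) := by fun_prop
    have hi : IndepFun (Ξ 0) (fun ω s i => dir s i ω) μ :=
      h.indep_init.comp measurable_id hcurry
    have h1 := (indepFun_iff_map_prod_eq_prod_map_map h.measurable_init.aemeasurable
      (hdir 0).aemeasurable).1 hi
    rw [h0] at h1
    rw [Function.iterate_zero_apply, ← h.map_dir]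
    exact h1
  | succ t ih =>
    obtain ⟨hm, hl⟩ := ih
    have hlaw := hν.iterate t
    have hq := hlaw.isProbabilityMeasure_invPalm
    have hstep : AEMeasurable (fun ω => (Ξ t ω).step fun i => dir t i ω) μ := by
      have hdt : Measurable fun ω i => dir t i ω := measurable_pi_iff.2 fun i => h.measurable_dir t i
      have h1 := Config.measurable_step.comp_aemeasurable (hm.prodMk hdt.aemeasurable)
      simp only [Function.comp_def] at h1
      exact h1
    refine ⟨hstep.congr ((h.evolve t).mono fun ω hω => hω.symm), ?_⟩
    have hΦ : MeasurePreserving (fun p : Config × (ℕ → ℤ → Bool) =>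
        (p.1.step (p.2 0), fun n => p.2 (n + 1)))
        ((invPalm (clusterMap^[t] ν)).prod (Measure.infinitePi fun _ : ℕ => coins))
        ((invPalm (clusterMap (clusterMap^[t] ν))).prod (Measure.infinitePi fun _ : ℕ => coins)) := by
      have e1 := (MeasurePreserving.id (invPalm (clusterMap^[t] ν))).prod
        (measurePreserving_uncons coins)
      have e2 := (measurePreserving_prodAssoc (invPalm (clusterMap^[t] ν)) coins
        (Measure.infinitePi fun _ : ℕ => coins)).symm
      have e3 : MeasurePreserving (fun p : Config × (ℤ → Bool) => p.1.step p.2)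
          ((invPalm (clusterMap^[t] ν)).prod coins) (invPalm (clusterMap (clusterMap^[t] ν))) :=
        ⟨Config.measurable_step, hlaw.map_step⟩
      have hq' := hlaw.clusterMap.isProbabilityMeasure_invPalm
      exact (e3.prod (MeasurePreserving.id _)).comp (e2.comp e1)
    have hcongr : (fun ω => (Ξ (t + 1) ω, fun s i => dir (s + (t + 1)) i ω)) =ᵐ[μ]
        fun ω => (fun p : Config × (ℕ → ℤ → Bool) => (p.1.step (p.2 0), fun n => p.2 (n + 1)))
          (Ξ t ω, fun s i => dir (s + t) i ω) := by
      filter_upwards [h.evolve t] with ω hω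
      simp only [hω, zero_add, add_assoc, add_comm 1 t]
    rw [Measure.map_congr hcongr, Function.iterate_succ_apply', ← hΦ.map_eq, ← hl,
      AEMeasurable.map_map_of_aemeasurable hΦ.measurable.aemeasurable
        (hm.prodMk (hdir t).aemeasurable)]
    rfl

theorem IsClustering.map_eq (h : IsClustering μ Ξ dir) {ν : Measure (ℤ → ℝ)} (hν : IsGapLaw ν)
    (h0 : μ.map (Ξ 0) = invPalm ν) (t : ℕ) : μ.map (Ξ t) = invPalm (clusterMap^[t] ν) := by
  obtain ⟨hm, hl⟩ := h.joint_law hν h0 t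
  have hdir : Measurable fun ω => fun s i => dir (s + t) i ω :=
    measurable_pi_iff.2 fun s => measurable_pi_iff.2 fun i => h.measurable_dir (s + t) i
  have h1 := congrArg Measure.fst hl
  rw [Measure.fst_prod, Measure.fst_map_prodMk₀ hdir.aemeasurable] at h1
  exact h1

end Evolution

end

theorem theorem1 :
    ∃ Q : Measure Config, IsProbabilityMeasure Q ∧ StationaryLaw Q ∧ intensity Q = 1 ∧
      ∀ {Ω : Type*} [MeasurableSpace Ω] (μ : Measure Ω) [IsProbabilityMeasure μ]
        (Ξ : ℕ → Ω → Config) (dir : ℕ → ℤ → Ω → Bool),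
        IsClustering μ Ξ dir →
        IsUnitRenewal (μ.map (Ξ 0)) →
        MemLp (fun ξ : Config => ξ.gap 0) 2 (palm (μ.map (Ξ 0))) →
        (∀ t, StationaryLaw (μ.map (Ξ t)) ∧ intensity (μ.map (Ξ t)) = 1) ∧
        FDDCounts (fun t => μ.map (Ξ t)) Q ∧
        FDDPoints (fun t => μ.map (Ξ t)) Q ∧
        WeakConv (fun t => palm (μ.map (Ξ t))) (palm Q) := by
  refine ⟨invPalm limitLaw, isGapLaw_limitLaw.isProbabilityMeasure_invPalm,
    isGapLaw_limitLaw.stationaryLaw_invPalm, isGapLaw_limitLaw.intensity_invPalm, ?_⟩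
  intro Ω _ μ _ Ξ dir hcl hren hL2
  have hP : IsProbabilityMeasure (μ.map (Ξ 0)) :=
    Measure.isProbabilityMeasure_map hcl.measurable_init.aemeasurable
  set ν := (palm (μ.map (Ξ 0))).map Config.gap
  have hν : IsGapLaw ν := hren.isGapLaw
  have hprob : IsProbabilityMeasure ν := hν.isProb
  have hmap := hcl.map_eq hν (hren.stationary.eq_invPalm hren.intensity_eq)
  have hlim := tendsto_evol (variance_nonneg _ _) (hren.sqBound hL2)
  have hW' : Measurable fun p : (ℕ → ℤ → Bool) × (ℤ → ℝ) => limitGap p.1 :=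
    measurable_limitGap.comp measurable_fst
  -- The limit is realized on the space of directions and initial gaps, where the evolved gaps
  -- converge to it almost surely.
  have hlimit : limitLaw = (choices.prod ν).map fun p => limitGap p.1 := by
    have := Measure.map_map (μ := choices.prod ν) measurable_limitGap measurable_fst
    rwa [Measure.map_fst_prod, measure_univ, one_smul] at this
  have hiter : ∀ t, clusterMap^[t] ν = (choices.prod ν).map fun p => evol t p.1 p.2 := fun t => by
    rw [map_evol ν (h := fun _ g => g) measurable_snd t, Measure.map_snd_prod, measure_univ, one_smul]
  have hlaw : ∀ t, IsGapLaw ((choices.prod ν).map fun p => evol t p.1 p.2) := fun t =>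
    hiter t ▸ hν.iterate t
  have hlaw' : IsGapLaw ((choices.prod ν).map fun p => limitGap p.1) := hlimit ▸ isGapLaw_limitLaw
  refine ⟨fun t => ?_, ?_, ?_, ?_⟩
  · rw [hmap t]
    exact ⟨(hν.iterate t).stationaryLaw_invPalm, (hν.iterate t).intensity_invPalm⟩
  · intro k B hB hb hfr
    simp only [hmap, hiter]
    rw [hlimit] at hfr ⊢
    refine weakConv_invPalm measurable_evol hW' hlaw hlaw' hlim
      (measurable_pi_iff.2 fun j => Config.measurable_count (hB j) (hb j))
      -- The exceptional set consists of the configurations with a point on one of the finitely many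
      -- boundaries.
      (measure_iUnion_null hfr) fun ξ ξ' hξ' hpt => tendsto_pi_nhds.2 fun j => ?_
    refine tendsto_const_nhds.congr' ?_
    have hj : ¬ (ξ'.carrier ∩ frontier (B j)).Nonempty := fun h => hξ' (mem_iUnion.2 ⟨j, h⟩)
    filter_upwards [eventually_count_eq (hb j) hpt hj] with t ht using ht.symm
  · intro I
    simp only [hmap, hiter]
    rw [hlimit]
    exact weakConv_invPalm measurable_evol hW' hlaw hlaw' hlim
      (measurable_pi_iff.2 fun i => Config.measurable_pt i) measure_empty
      fun ξ ξ' _ hpt => tendsto_pi_nhds.2 fun i => hpt i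
  · simp only [hmap, hiter, (hlaw _).palm_invPalm, isGapLaw_limitLaw.palm_invPalm]
    rw [hlimit]
    exact weakConv_map_conf measurable_evol hW' hlaw hlaw' hlim
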